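/- Let $G$ be one of the compact groups $\mathrm{SO}(3)$, $\mathrm{SU}(2)$, or $\mathbb S^3$ (the unit quaternions, identified with $\mathrm{SU}(2)$), with normalised Haar measure; functions are complex-valued. For $j=1,2$ let $D_j$ be the left-invariant vector field $(D_jf)(x)=\frac{d}{dt}f(x\,\omega_j(t))\big|_{t=0}$, where - on $\mathrm{SO}(3)$, $\omega_1(t)$ and $\omega_2(t)$ are the rotations by the angle $t$ about the first and the second coordinate axis; - on $\mathrm{SU}(2)$, $\omega_1(t)=\begin{pmatrix}\cos\frac t2&i\sin\frac t2\\ i\sin\frac t2&\cos\frac t2\end{pmatrix}$ and $\omega_2(t)=\begin{pmatrix}\cos\frac t2&-\sin\frac t2\\ \sin\frac t2&\cos\frac t2\end{pmatrix}$; - on $\mathbb S^3$, $\omega_1(t)=\cos\frac t2+\mathbf i\sin\frac t2$ and $\omega_2(t)=\cos\frac t2+\mathbf j\sin\frac t2$. Let $\mathcal L_{sub}=D_1^2+D_2^2$ be the sub-Laplacian. Let $0<r\le 1$, $\alpha>\frac4r$ and $1\le p<\infty$. Then the power $(I-\mathcal L_{sub})^{-\alpha/2}$ is a well-defined bounded operator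 on $L^p(G)$, in the sense that there is exactly one bounded linear operator $T$ on $L^p(G)$ such that $T\varphi=(1+c)^{-\alpha/2}\varphi$ for every $c\in\mathbb R$ and every $\varphi\in C^\infty(G)$ with $-\mathcal L_{sub}\varphi=c\,\varphi$. This operator is $r$-nuclear: there are sequences $(x_n')$ in $L^p(G)'$ and $(y_n)$ in $L^p(G)$ with $$Tf=\sum_{n=1}^\infty\langle f,x_n'\rangle y_n\quad\text{for all } f\in L^p(G),\qquad \sum_{n=1}^\infty\|x_n'\|^r\,\|y_n\|^r<\infty .$$ -/

import Mathlib

open MeasureTheory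
open scoped ENNReal Quaternion

namespace SubLap

/-! ### `r`-nuclear operators -/

/-- `T : E → F` is `r`-nuclear: `T x = ∑ₙ ⟨x, x'ₙ⟩ yₙ` for all `x`, with `x'ₙ ∈ E'`, `yₙ ∈ F` and
`∑ₙ ‖x'ₙ‖ ^ r ‖yₙ‖ ^ r < ∞`. -/
def IsRNuclear {E F : Type*} [NormedAddCommGroup E] [NormedSpace ℂ E]
    [NormedAddCommGroup F] [NormedSpace ℂ F] (r : ℝ) (T : E →L[ℂ] F) : Prop :=
  ∃ (x' : ℕ → (E →L[ℂ] ℂ)) (y : ℕ → F),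
    Summable (fun n => ‖x' n‖ ^ r * ‖y n‖ ^ r) ∧
    ∀ x : E, HasSum (fun n => x' n x • y n) (T x)

/-! ### Invariant vector fields, sub-Laplacians and their powers -/

/-- A function on `G` is smooth, for a group `G` embedded by `ι` as a compact smooth submanifold
of the real vector space `E`: it is the restriction of a smooth function on `E`. -/
def IsSmooth {G E : Type*} [NormedAddCommGroup E] [NormedSpace ℝ E] (ι : G → E) (f : G → ℂ) :
    Prop :=
  ∃ F : E → ℂ, ContDiff ℝ (⊤ : ℕ∞) F ∧ ∀ x, f x = F (ι x)

/-- The left-invariant vector field generated by the one-parameter subgroup `ω`: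
`(D f)(x) = d/dt f(x ω(t))` at `t = 0`. -/
noncomputable def invField {G : Type*} [Mul G] (ω : ℝ → G) (f : G → ℂ) (x : G) : ℂ :=
  deriv (fun t : ℝ => f (x * ω t)) 0

/-- The sub-Laplacian `D₁² + D₂²`. -/
noncomputable def subLaplacian {G : Type*} [Mul G] (ω₁ ω₂ : ℝ → G) (f : G → ℂ) (x : G) : ℂ :=
  invField ω₁ (invField ω₁ f) x + invField ω₂ (invField ω₂ f) x

/-- The bounded operator `T` on `L^p(μ)` is the power `(I - ℒ) ^ (-α/2)` of the sub-Laplacian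
`ℒ = D₁² + D₂²`: it multiplies each smooth eigenfunction `φ` of `-ℒ`, `-ℒ φ = c φ`,
by `(1 + c) ^ (-α/2)`. -/
def IsSubLaplacianPower {G E : Type*} [Mul G] [MeasurableSpace G]
    [NormedAddCommGroup E] [NormedSpace ℝ E] (ι : G → E) (ω₁ ω₂ : ℝ → G) (μ : Measure G)
    (α : ℝ) (p : ℝ≥0∞) [Fact (1 ≤ p)] (T : Lp ℂ p μ →L[ℂ] Lp ℂ p μ) : Prop :=
  ∀ (c : ℝ) (φ : G → ℂ), IsSmooth ι φ → (∀ x, -subLaplacian ω₁ ω₂ φ x = (c : ℂ) * φ x) →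
    ∀ u : Lp ℂ p μ, u =ᵐ[μ] φ → T u = (((1 + c) ^ (-(α / 2)) : ℝ) : ℂ) • u

/-- `(I - ℒ) ^ (-α/2)` is a well-defined bounded operator on `L^p(μ)` (there is exactly one
bounded operator acting on the eigenfunctions of the sub-Laplacian as this power has to), and it is
`r`-nuclear. -/
def SubLaplacianPowerIsRNuclear {G E : Type*} [Mul G] [MeasurableSpace G]
    [NormedAddCommGroup E] [NormedSpace ℝ E] (ι : G → E) (ω₁ ω₂ : ℝ → G) (μ : Measure G)
    (r α : ℝ) (p : ℝ≥0∞) [Fact (1 ≤ p)] : Prop :=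
  ∃ T : Lp ℂ p μ →L[ℂ] Lp ℂ p μ, IsSubLaplacianPower ι ω₁ ω₂ μ α p T ∧
    (∀ T', IsSubLaplacianPower ι ω₁ ω₂ μ α p T' → T' = T) ∧ IsRNuclear r T

/-- The normalised Haar measure of a compact group. -/
noncomputable def haarProb (G : Type*) [Group G] [TopologicalSpace G] [IsTopologicalGroup G]
    [CompactSpace G] [MeasurableSpace G] [BorelSpace G] : Measure G :=
  Measure.haarMeasure (⊤ : TopologicalSpace.PositiveCompacts G)

/-- The Haar measure is normalised. -/
theorem haarProb_univ (G : Type*) [Group G] [TopologicalSpace G] [IsTopologicalGroup G]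
    [CompactSpace G] [MeasurableSpace G] [BorelSpace G] : haarProb G Set.univ = 1 :=
  Measure.haarMeasure_self (K₀ := (⊤ : TopologicalSpace.PositiveCompacts G))

/-! ### The group `SU(2)` -/

/-- `SU(2)`. -/
abbrev SU2 : Type := Matrix.specialUnitaryGroup (Fin 2) ℂ

/-- The matrix entries of an element of `SU(2)`. -/
def SU2.entries (x : SU2) : Fin 2 → Fin 2 → ℂ := fun i j => x.1 i j

instance : IsTopologicalGroup SU2 where
  continuous_inv := by
    refine Continuous.subtype_mk ?_ _
    exact continuous_star.comp continuous_subtype_val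

instance : CompactSpace SU2 := by
  apply isCompact_iff_compactSpace.1
  have hK : IsCompact (Set.univ.pi fun _ : Fin 2 =>
      Set.univ.pi fun _ : Fin 2 => Metric.closedBall (0 : ℂ) 1) :=
    isCompact_univ_pi fun _ => isCompact_univ_pi fun _ => isCompact_closedBall _ _
  refine IsCompact.of_isClosed_subset hK ?_ ?_
  · have h : (Matrix.specialUnitaryGroup (Fin 2) ℂ : Set (Matrix (Fin 2) (Fin 2) ℂ)) =
        {A | A * star A = 1} ∩ {A | A.det = 1} := by
      ext A
      simp [Matrix.mem_specialUnitaryGroup_iff, Matrix.mem_unitaryGroup_iff]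
    rw [h]
    exact (isClosed_eq (continuous_id.mul continuous_star) continuous_const).inter
      (isClosed_eq continuous_id.matrix_det continuous_const)
  · intro A hA i _ j _
    rw [mem_closedBall_zero_iff]
    exact entry_norm_bound_of_unitary (Matrix.specialUnitaryGroup_le_unitaryGroup hA) i j

noncomputable instance : MeasurableSpace SU2 := borel SU2

instance : BorelSpace SU2 := ⟨rfl⟩

/-- `t ↦ ((cos (t/2), i sin (t/2)), (i sin (t/2), cos (t/2)))`, generating `D₁` on `SU(2)`. -/
noncomputable def SU2.omega₁ (t : ℝ) : SU2 :=
  ⟨!![(Real.cos (t / 2) : ℂ), Complex.I * (Real.sin (t / 2) : ℂ);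
      Complex.I * (Real.sin (t / 2) : ℂ), (Real.cos (t / 2) : ℂ)], by
    have h : (Real.sin (t / 2) : ℂ) ^ 2 + (Real.cos (t / 2) : ℂ) ^ 2 = 1 := by
      exact_mod_cast Real.sin_sq_add_cos_sq (t / 2)
    have hI := Complex.I_sq
    rw [Matrix.mem_specialUnitaryGroup_iff, Matrix.mem_unitaryGroup_iff]
    constructor
    · ext i j
      fin_cases i <;> fin_cases j <;>
        simp [Matrix.mul_apply, Fin.sum_univ_two, Matrix.star_apply, -Complex.ofReal_cos,
          -Complex.ofReal_sin] <;> grind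
    · rw [Matrix.det_fin_two_of]
      linear_combination h - (Real.sin (t / 2) : ℂ) ^ 2 * Complex.I_sq⟩

/-- `t ↦ ((cos (t/2), -sin (t/2)), (sin (t/2), cos (t/2)))`, generating `D₂` on `SU(2)`. -/
noncomputable def SU2.omega₂ (t : ℝ) : SU2 :=
  ⟨!![(Real.cos (t / 2) : ℂ), -(Real.sin (t / 2) : ℂ);
      (Real.sin (t / 2) : ℂ), (Real.cos (t / 2) : ℂ)], by
    have h : (Real.sin (t / 2) : ℂ) ^ 2 + (Real.cos (t / 2) : ℂ) ^ 2 = 1 := by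
      exact_mod_cast Real.sin_sq_add_cos_sq (t / 2)
    rw [Matrix.mem_specialUnitaryGroup_iff, Matrix.mem_unitaryGroup_iff]
    constructor
    · ext i j
      fin_cases i <;> fin_cases j <;>
        simp [Matrix.mul_apply, Fin.sum_univ_two, Matrix.star_apply, -Complex.ofReal_cos,
          -Complex.ofReal_sin] <;> grind
    · rw [Matrix.det_fin_two_of]
      linear_combination h⟩

/-! ### The group `SO(3)` -/

/-- `SO(3)`. -/
abbrev SO3 : Type := Matrix.specialOrthogonalGroup (Fin 3) ℝ

/-- The matrix entries of an element of `SO(3)`. -/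
def SO3.entries (x : SO3) : Fin 3 → Fin 3 → ℝ := fun i j => x.1 i j

theorem SO3.mem_iff (A : Matrix (Fin 3) (Fin 3) ℝ) :
    A ∈ Matrix.specialOrthogonalGroup (Fin 3) ℝ ↔ A * A.transpose = 1 ∧ A.det = 1 := by
  rw [Matrix.mem_specialOrthogonalGroup_iff, Matrix.mem_orthogonalGroup_iff]

instance : IsTopologicalGroup SO3 where
  continuous_inv := by
    refine Continuous.subtype_mk ?_ _
    exact (continuous_id.matrix_transpose).comp continuous_subtype_val

instance : CompactSpace SO3 := by
  apply isCompact_iff_compactSpace.1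
  have hK : IsCompact (Set.univ.pi fun _ : Fin 3 =>
      Set.univ.pi fun _ : Fin 3 => Metric.closedBall (0 : ℝ) 1) :=
    isCompact_univ_pi fun _ => isCompact_univ_pi fun _ => isCompact_closedBall _ _
  refine IsCompact.of_isClosed_subset hK ?_ ?_
  · have h : (Matrix.specialOrthogonalGroup (Fin 3) ℝ : Set (Matrix (Fin 3) (Fin 3) ℝ)) =
        {A | A * A.transpose = 1} ∩ {A | A.det = 1} := by
      ext A
      exact SO3.mem_iff A
    rw [h]
    exact (isClosed_eq (continuous_id.mul continuous_id.matrix_transpose) continuous_const).inter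
      (isClosed_eq continuous_id.matrix_det continuous_const)
  · intro A hA i _ j _
    rw [mem_closedBall_zero_iff]
    have h := congrFun (congrFun ((SO3.mem_iff A).1 hA).1 i) i
    simp only [Matrix.mul_apply, Matrix.transpose_apply, Matrix.one_apply_eq] at h
    have h2 : A i j * A i j ≤ ∑ k, A i k * A i k :=
      Finset.single_le_sum (f := fun k => A i k * A i k) (fun k _ => mul_self_nonneg _)
        (Finset.mem_univ j)
    rw [Real.norm_eq_abs, ← sq_le_one_iff_abs_le_one]
    nlinarith

noncomputable instance : MeasurableSpace SO3 := borel SO3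

instance : BorelSpace SO3 := ⟨rfl⟩

/-- The rotations about the first axis, generating `D₁` on `SO(3)`. -/
noncomputable def SO3.omega₁ (t : ℝ) : SO3 :=
  ⟨!![1, 0, 0; 0, Real.cos t, -Real.sin t; 0, Real.sin t, Real.cos t], by
    have h := Real.sin_sq_add_cos_sq t
    rw [SO3.mem_iff]
    constructor
    · ext i j
      fin_cases i <;> fin_cases j <;>
        simp [Matrix.mul_apply, Fin.sum_univ_three] <;> linarith
    · simp [Matrix.det_fin_three]
      linarith⟩

/-- The rotations about the second axis, generating `D₂` on `SO(3)`. -/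
noncomputable def SO3.omega₂ (t : ℝ) : SO3 :=
  ⟨!![Real.cos t, 0, Real.sin t; 0, 1, 0; -Real.sin t, 0, Real.cos t], by
    have h := Real.sin_sq_add_cos_sq t
    rw [SO3.mem_iff]
    constructor
    · ext i j
      fin_cases i <;> fin_cases j <;>
        simp [Matrix.mul_apply, Fin.sum_univ_three] <;> linarith
    · simp [Matrix.det_fin_three]
      linarith⟩

/-! ### The sphere `𝕊³`, as the group of unit quaternions -/

/-- `𝕊³`, with the quaternionic product. -/
abbrev S3 : Type := Metric.sphere (0 : ℍ[ℝ]) 1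

/-- The inclusion of `𝕊³` in the quaternions. -/
def S3.incl (x : S3) : ℍ[ℝ] := x.1

noncomputable instance : MeasurableSpace S3 := borel S3

instance : BorelSpace S3 := ⟨rfl⟩

/-- The quaternion `a + b i + c j + d k`. -/
def quat (a b c d : ℝ) : ℍ[ℝ] := ⟨a, b, c, d⟩

theorem quat_mem (a b c d : ℝ) (h : a ^ 2 + b ^ 2 + c ^ 2 + d ^ 2 = 1) :
    quat a b c d ∈ Metric.sphere (0 : ℍ[ℝ]) 1 := by
  have h2 : ‖quat a b c d‖ * ‖quat a b c d‖ = 1 := by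
    rw [← Quaternion.normSq_eq_norm_mul_self, Quaternion.normSq_def']
    exact h
  rw [mem_sphere_zero_iff_norm]
  nlinarith [norm_nonneg (quat a b c d)]

/-- `t ↦ cos (t/2) + i sin (t/2)`, generating `D₁` on `𝕊³`. -/
noncomputable def S3.omega₁ (t : ℝ) : S3 :=
  ⟨quat (Real.cos (t / 2)) (Real.sin (t / 2)) 0 0,
    quat_mem _ _ _ _ (by linarith [Real.sin_sq_add_cos_sq (t / 2)])⟩

/-- `t ↦ cos (t/2) + j sin (t/2)`, generating `D₂` on `𝕊³`. -/
noncomputable def S3.omega₂ (t : ℝ) : S3 :=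
  ⟨quat (Real.cos (t / 2)) 0 (Real.sin (t / 2)) 0,
    quat_mem _ _ _ _ (by linarith [Real.sin_sq_add_cos_sq (t / 2)])⟩

end SubLap

/-! All the analysis takes place on the unit quaternions. In the complex coordinates u, v put A = u
- t v and B = conj v + t conj u. Each of D₁ and D₂ exchanges A and B up to a scalar, and for every t
the function A^p B^q is an eigenfunction of -ℒ with eigenvalue λ = pq + (p+q)/2 (`isEigen_genFun`).
Its N = p + q + 1 coefficients in t are the spherical functions. They are pairwise orthogonal, with
explicit norms (`gram`), and they span a dense subspace of the continuous functions
(`sphSpan_topologicalClosure`). Only finitely many bidegrees share an eigenvalue and ℒ is symmetric,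
so every smooth eigenfunction is a finite sum of spherical functions of its own eigenvalue
(`IsEigen.exists_eq_sum`). The operator therefore has to be the sum of (1+λ)^(-α/2) P over all
bidegrees, where P is the orthogonal projection extended to L^p.

Nuclearity is a count. An Auerbach basis writes an operator of rank d as d elementary tensors of
norm at most that of the operator, so a bidegree costs N (1+λ)^(-αr/2) ‖P‖^r
(`exists_isRNuclear_hasSum`). The kernel of P is N times a translate of a zonal function f, and
Schur's test bounds ‖P‖ by N‖f‖₁. Plain Cauchy–Schwarz would give √N, which is too much when q = 0
and α is close to 4/r. The weight 1 + N|v|² exploits the concentration of f and gives ‖P‖² ≤ 3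
(p+1)(q+1) H / N, with H the N-th harmonic number (`sq_integral_norm_sphFun_le`). Put X = (p+1)(q+1)
and β = αr/2 > 2. Since 1+λ ≥ X/2, the cost is O(X^(1-β) H), hence O(X^(-β/2)), which is summable
over both indices (`summable_sphProj`).

The other groups are images of the sphere under a homomorphism π with kernel {1, κ}. Pull-back J is
an isometry on L^p, averaging over the kernel provides a left inverse A of J, and A T J is the
required operator. Uniqueness survives because each A^p B^q either is odd under κ, hence killed by
averaging, or descends to a smooth eigenfunction (`subLaplacianPowerIsRNuclear_of_cover`). -/

namespace SubLap

/-! ### Explicit spherical functions and their algebra -/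

open Polynomial ComplexConjugate

/-! ### Complex coordinates on `𝕊³` -/

namespace S3

/-- The first complex coordinate `a + d I` of the unit quaternion `a + b i + c j + d k`. -/
def u (x : S3) : ℂ := ⟨x.1.re, x.1.imK⟩

/-- The second complex coordinate `c + b I` of the unit quaternion `a + b i + c j + d k`. -/
def v (x : S3) : ℂ := ⟨x.1.imJ, x.1.imI⟩

theorem u_mul (x y : S3) : u (x * y) = u x * u y - conj (v x) * v y := by
  apply Complex.ext <;> simp [u, v, Metric.sphere] <;> ring

theorem v_mul (x y : S3) : v (x * y) = v x * u y + conj (u x) * v y := by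
  apply Complex.ext <;> simp [u, v] <;> ring

theorem u_one : u 1 = 1 := by
  apply Complex.ext <;> simp [u]

theorem v_one : v 1 = 0 := by
  apply Complex.ext <;> simp [v]

theorem sq_components (x : S3) :
    x.1.re ^ 2 + x.1.imI ^ 2 + x.1.imJ ^ 2 + x.1.imK ^ 2 = 1 := by
  have h := x.2
  rw [mem_sphere_zero_iff_norm] at h
  rw [← Quaternion.normSq_def', Quaternion.normSq_eq_norm_mul_self, h, one_mul]

theorem u_v_sphere (x : S3) : u x * conj (u x) + v x * conj (v x) = 1 := by
  have h := sq_components x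
  apply Complex.ext <;> simp [u, v] <;> linarith

theorem normSq_u_v (x : S3) : ‖u x‖ ^ 2 + ‖v x‖ ^ 2 = 1 := by
  have h := sq_components x
  rw [← Complex.normSq_eq_norm_sq, ← Complex.normSq_eq_norm_sq, Complex.normSq_apply,
    Complex.normSq_apply]
  simp only [u, v]
  linarith

theorem ext_u_v {x y : S3} (hu : u x = u y) (hv : v x = v y) : x = y := by
  have h1 := congrArg Complex.re hu
  have h2 := congrArg Complex.im hu
  have h3 := congrArg Complex.re hv
  have h4 := congrArg Complex.im hv
  exact Subtype.ext (QuaternionAlgebra.ext h1 h4 h3 h2)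

@[fun_prop]
theorem continuous_u : Continuous u := by
  have h : u = fun x : S3 => ((x.1.re : ℝ) : ℂ) + ((x.1.imK : ℝ) : ℂ) * Complex.I := by
    ext x; apply Complex.ext <;> simp [u]
  rw [h]
  have h1 := Quaternion.continuous_re.comp (continuous_subtype_val (p := fun x => x ∈ Metric.sphere (0 : ℍ[ℝ]) 1))
  have h2 := Quaternion.continuous_imK.comp (continuous_subtype_val (p := fun x => x ∈ Metric.sphere (0 : ℍ[ℝ]) 1))
  exact (Complex.continuous_ofReal.comp h1).add ((Complex.continuous_ofReal.comp h2).mul continuous_const)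

@[fun_prop]
theorem continuous_v : Continuous v := by
  have h : v = fun x : S3 => ((x.1.imJ : ℝ) : ℂ) + ((x.1.imI : ℝ) : ℂ) * Complex.I := by
    ext x; apply Complex.ext <;> simp [v]
  rw [h]
  have h1 := Quaternion.continuous_imJ.comp (continuous_subtype_val (p := fun x => x ∈ Metric.sphere (0 : ℍ[ℝ]) 1))
  have h2 := Quaternion.continuous_imI.comp (continuous_subtype_val (p := fun x => x ∈ Metric.sphere (0 : ℍ[ℝ]) 1))
  exact (Complex.continuous_ofReal.comp h1).add ((Complex.continuous_ofReal.comp h2).mul continuous_const)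

theorem u_omega₁ (t : ℝ) : u (omega₁ t) = Real.cos (t / 2) := by
  apply Complex.ext <;> simp [u, omega₁, quat, -Complex.ofReal_cos]

theorem v_omega₁ (t : ℝ) : v (omega₁ t) = Complex.I * Real.sin (t / 2) := by
  apply Complex.ext <;> simp [v, omega₁, quat, -Complex.ofReal_sin]

theorem u_omega₂ (t : ℝ) : u (omega₂ t) = Real.cos (t / 2) := by
  apply Complex.ext <;> simp [u, omega₂, quat, -Complex.ofReal_cos]

theorem v_omega₂ (t : ℝ) : v (omega₂ t) = Real.sin (t / 2) := by
  apply Complex.ext <;> simp [v, omega₂, quat, -Complex.ofReal_sin]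

theorem omega₁_zero : omega₁ 0 = 1 := by
  apply ext_u_v <;> simp [u_omega₁, v_omega₁, u_one, v_one]

theorem omega₂_zero : omega₂ 0 = 1 := by
  apply ext_u_v <;> simp [u_omega₂, v_omega₂, u_one, v_one]

theorem omega₁_add (s t : ℝ) : omega₁ (s + t) = omega₁ s * omega₁ t := by
  apply ext_u_v
  · rw [u_mul]
    simp only [u_omega₁, v_omega₁, add_div, Real.cos_add, map_mul, Complex.conj_I,
      Complex.conj_ofReal]
    push_cast
    linear_combination (-(Complex.sin (s / 2) * Complex.sin (t / 2))) * Complex.I_sq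
  · rw [v_mul]
    simp only [u_omega₁, v_omega₁, add_div, Real.sin_add, Complex.conj_ofReal]
    push_cast
    ring

theorem omega₂_add (s t : ℝ) : omega₂ (s + t) = omega₂ s * omega₂ t := by
  apply ext_u_v
  · rw [u_mul]
    simp only [u_omega₂, v_omega₂, add_div, Real.cos_add, Complex.conj_ofReal]
    push_cast
    ring
  · rw [v_mul]
    simp only [u_omega₂, v_omega₂, add_div, Real.sin_add, Complex.conj_ofReal]
    push_cast
    ring

/-- The one-parameter group of right translations commuting with the sub-Laplacian. -/
noncomputable def rot (θ : ℝ) : S3 :=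
  ⟨quat (Real.cos θ) 0 0 (Real.sin θ),
    quat_mem _ _ _ _ (by linarith [Real.sin_sq_add_cos_sq θ])⟩

theorem u_rot (θ : ℝ) : u (rot θ) = Complex.exp (θ * Complex.I) := by
  rw [Complex.exp_mul_I, ← Complex.ofReal_cos, ← Complex.ofReal_sin]
  apply Complex.ext <;> simp [u, rot, quat, -Complex.ofReal_cos, -Complex.ofReal_sin]

theorem v_rot (θ : ℝ) : v (rot θ) = 0 := by
  apply Complex.ext <;> simp [v, rot, quat]

end S3

/-! ### Interpolation -/

/-- Lagrange interpolation at 0, …, N, with weights independent of the polynomial. It carries linear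
facts from the generating functions, which are in closed form, to their individual coefficients. -/
theorem exists_coeff_eq_sum_eval (N k : ℕ) : ∃ c : ℕ → ℂ, ∀ P : ℂ[X], P.natDegree ≤ N →
    P.coeff k = ∑ i ∈ Finset.range (N + 1), c i * P.eval (i : ℂ) := by
  refine ⟨fun i => (Lagrange.basis (Finset.range (N + 1)) (fun i : ℕ => (i : ℂ)) i).coeff k,
    fun P hP => ?_⟩
  have h := Lagrange.eq_interpolate (F := ℂ) (s := Finset.range (N + 1))
    (v := fun i : ℕ => (i : ℂ)) (f := P) (fun a _ b _ hab => by simpa using hab)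
    (by
      rw [Finset.card_range]
      exact lt_of_le_of_lt (Polynomial.degree_le_of_natDegree_le hP)
        (by exact_mod_cast Nat.lt_succ_self N))
  conv_lhs => rw [h]
  simp [Lagrange.interpolate_apply, mul_comm]

/-! ### The spherical functions -/

/-- `u - v X`. -/
noncomputable def polyA (x : S3) : ℂ[X] := C (S3.u x) - C (S3.v x) * X

/-- `conj v + conj u X`. -/
noncomputable def polyB (x : S3) : ℂ[X] := C (conj (S3.v x)) + C (conj (S3.u x)) * X

/-- The generating polynomial `(u - v X) ^ p (conj v + conj u X) ^ q` of the spherical functions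
of bidegree `(p, q)`. -/
noncomputable def genPoly (p q : ℕ) (x : S3) : ℂ[X] := polyA x ^ p * polyB x ^ q

/-- The value of the generating polynomial at `t`. -/
noncomputable def genFun (p q : ℕ) (t : ℂ) (x : S3) : ℂ :=
  (S3.u x - t * S3.v x) ^ p * (conj (S3.v x) + t * conj (S3.u x)) ^ q

/-- The spherical function of bidegree `(p, q)` and index `k ≤ p + q`. -/
noncomputable def sphFun (p q k : ℕ) (x : S3) : ℂ := (genPoly p q x).coeff k

theorem eval_genPoly (p q : ℕ) (t : ℂ) (x : S3) : (genPoly p q x).eval t = genFun p q t x := by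
  simp only [genPoly, genFun, polyA, polyB, eval_mul, eval_pow, eval_sub, eval_add, eval_C, eval_X,
    mul_comm t]

theorem natDegree_polyA_le (x : S3) : (polyA x).natDegree ≤ 1 := by
  unfold polyA; compute_degree

theorem natDegree_polyB_le (x : S3) : (polyB x).natDegree ≤ 1 := by
  unfold polyB; compute_degree

theorem natDegree_genPoly_le (p q : ℕ) (x : S3) : (genPoly p q x).natDegree ≤ p + q := by
  refine natDegree_mul_le_of_le ?_ ?_
  · simpa using natDegree_pow_le_of_le p (natDegree_polyA_le x)
  · simpa using natDegree_pow_le_of_le q (natDegree_polyB_le x)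

theorem sphFun_eq_zero {p q k : ℕ} (hk : p + q < k) (x : S3) : sphFun p q k x = 0 :=
  coeff_eq_zero_of_natDegree_lt (lt_of_le_of_lt (natDegree_genPoly_le p q x) hk)

theorem genFun_eq_sum (p q : ℕ) (t : ℂ) (x : S3) :
    genFun p q t x = ∑ k ∈ Finset.range (p + q + 1), sphFun p q k x * t ^ k := by
  rw [← eval_genPoly, eval_eq_sum_range' (Nat.lt_succ_of_le (natDegree_genPoly_le p q x))]
  rfl

theorem exists_sphFun_eq_sum (p q k : ℕ) : ∃ c : ℕ → ℂ, ∀ x,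
    sphFun p q k x = ∑ i ∈ Finset.range (p + q + 1), c i * genFun p q (i : ℂ) x := by
  obtain ⟨c, hc⟩ := exists_coeff_eq_sum_eval (p + q) k
  refine ⟨c, fun x => ?_⟩
  rw [sphFun, hc _ (natDegree_genPoly_le p q x)]
  simp [eval_genPoly]

@[fun_prop]
theorem continuous_genFun (p q : ℕ) (t : ℂ) : Continuous (genFun p q t) := by
  unfold genFun
  fun_prop

@[fun_prop]
theorem continuous_sphFun (p q k : ℕ) : Continuous (sphFun p q k) := by
  obtain ⟨c, hc⟩ := exists_sphFun_eq_sum p q k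
  rw [funext hc]
  fun_prop

/-! ### Multiplication by the coordinates -/

/-- The X-terms cancel and the sphere equation remains. The recurrences for multiplication by v and
by conj u rest on this relation. -/
theorem polyA_polyB_sphere (x : S3) :
    polyA x * C (conj (S3.u x)) + C (S3.v x) * polyB x = 1 := by
  have h := congrArg C (S3.u_v_sphere x)
  simp only [map_add, map_mul, map_one] at h
  simp only [polyA, polyB]
  linear_combination h

theorem derivative_genPoly (p q : ℕ) (x : S3) : derivative (genPoly p q x) =
    -(p : ℂ[X]) * C (S3.v x) * (polyA x ^ (p - 1) * polyB x ^ q) +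
      (q : ℂ[X]) * C (conj (S3.u x)) * (polyA x ^ p * polyB x ^ (q - 1)) := by
  simp only [genPoly, derivative_mul, derivative_pow, polyA, polyB, derivative_sub,
    derivative_C, derivative_add, derivative_X, C_eq_natCast]
  ring

/-- The Leibniz rule for A^(p+1) B^q produces v A^p B^q and a term containing conj u · A. Replacing
conj u · A by 1 - v B collects the factor p + q + 1. At q = 0 the truncated q - 1 is harmless, as
its coefficient is q. -/
theorem v_mul_genPoly (p q : ℕ) (x : S3) :
    ((p + q + 1 : ℕ) : ℂ[X]) * (C (S3.v x) * genPoly p q x) =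
      (q : ℂ[X]) * genPoly p (q - 1) x - derivative (genPoly (p + 1) q x) := by
  rw [derivative_genPoly]
  have h := polyA_polyB_sphere x
  rcases q with - | q
  · simp [genPoly]
    ring
  · simp only [genPoly, Nat.add_sub_cancel]
    push_cast
    linear_combination (((q : ℂ[X]) + 1) * polyA x ^ p * polyB x ^ q) * h

theorem uconj_mul_genPoly (p q : ℕ) (x : S3) :
    ((p + q + 1 : ℕ) : ℂ[X]) * (C (conj (S3.u x)) * genPoly p q x) =
      (p : ℂ[X]) * genPoly (p - 1) q x + derivative (genPoly p (q + 1) x) := by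
  rw [derivative_genPoly]
  have h := polyA_polyB_sphere x
  rcases p with - | p
  · simp [genPoly]
    ring
  · simp only [genPoly, Nat.add_sub_cancel]
    push_cast
    linear_combination (((p : ℂ[X]) + 1) * polyA x ^ p * polyB x ^ q) * h

theorem u_mul_genPoly (p q : ℕ) (x : S3) :
    C (S3.u x) * genPoly p q x = genPoly (p + 1) q x + X * (C (S3.v x) * genPoly p q x) := by
  have h : polyA x = C (S3.u x) - C (S3.v x) * X := rfl
  simp only [genPoly, pow_succ]
  linear_combination (-(polyA x ^ p * polyB x ^ q)) * h

theorem vconj_mul_genPoly (p q : ℕ) (x : S3) :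
    C (conj (S3.v x)) * genPoly p q x =
      genPoly p (q + 1) x - X * (C (conj (S3.u x)) * genPoly p q x) := by
  have h : polyB x = C (conj (S3.v x)) + C (conj (S3.u x)) * X := rfl
  simp only [genPoly, pow_succ]
  linear_combination (-(polyA x ^ p * polyB x ^ q)) * h

theorem v_mul_sphFun (p q k : ℕ) (x : S3) :
    ((p + q + 1 : ℕ) : ℂ) * (S3.v x * sphFun p q k x) =
      q * sphFun p (q - 1) k x - (k + 1) * sphFun (p + 1) q (k + 1) x := by
  have h := congrArg (fun P => P.coeff k) (v_mul_genPoly p q x)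
  simp only [coeff_sub, ← C_eq_natCast, coeff_C_mul, coeff_derivative] at h
  simp only [sphFun]
  linear_combination h

theorem uconj_mul_sphFun (p q k : ℕ) (x : S3) :
    ((p + q + 1 : ℕ) : ℂ) * (conj (S3.u x) * sphFun p q k x) =
      p * sphFun (p - 1) q k x + (k + 1) * sphFun p (q + 1) (k + 1) x := by
  have h := congrArg (fun P => P.coeff k) (uconj_mul_genPoly p q x)
  simp only [coeff_add, ← C_eq_natCast, coeff_C_mul, coeff_derivative] at h
  simp only [sphFun]
  linear_combination h

theorem u_mul_sphFun_zero (p q : ℕ) (x : S3) :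
    S3.u x * sphFun p q 0 x = sphFun (p + 1) q 0 x := by
  have h := congrArg (fun P => P.coeff 0) (u_mul_genPoly p q x)
  simpa only [coeff_add, coeff_C_mul, coeff_X_mul_zero, add_zero, sphFun] using h

theorem u_mul_sphFun_succ (p q k : ℕ) (x : S3) :
    S3.u x * sphFun p q (k + 1) x = sphFun (p + 1) q (k + 1) x + S3.v x * sphFun p q k x := by
  have h := congrArg (fun P => P.coeff (k + 1)) (u_mul_genPoly p q x)
  simpa only [coeff_add, coeff_C_mul, coeff_X_mul, sphFun] using h

theorem vconj_mul_sphFun_zero (p q : ℕ) (x : S3) :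
    conj (S3.v x) * sphFun p q 0 x = sphFun p (q + 1) 0 x := by
  have h := congrArg (fun P => P.coeff 0) (vconj_mul_genPoly p q x)
  simpa only [coeff_sub, coeff_C_mul, coeff_X_mul_zero, sub_zero, sphFun] using h

theorem vconj_mul_sphFun_succ (p q k : ℕ) (x : S3) :
    conj (S3.v x) * sphFun p q (k + 1) x =
      sphFun p (q + 1) (k + 1) x - conj (S3.u x) * sphFun p q k x := by
  have h := congrArg (fun P => P.coeff (k + 1)) (vconj_mul_genPoly p q x)
  simpa only [coeff_sub, coeff_C_mul, coeff_X_mul, sphFun] using h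

/-- At the identity A = 1 and B = X. The index k = q is thus the zonal one. -/
theorem sphFun_one (p q k : ℕ) : sphFun p q k 1 = if k = q then 1 else 0 := by
  simp [sphFun, genPoly, polyA, polyB, S3.u_one, S3.v_one, coeff_X_pow]

/-! ### Translations -/

theorem genFun_mul_rot (p q : ℕ) (t : ℂ) (x : S3) (θ : ℝ) : genFun p q t (x * S3.rot θ) =
    Complex.exp (θ * Complex.I) ^ p * Complex.exp (-(θ * Complex.I)) ^ q * genFun p q t x := by
  have h : conj (Complex.exp (θ * Complex.I)) = Complex.exp (-(θ * Complex.I)) := by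
    rw [← Complex.exp_conj]; simp
  simp only [genFun, S3.u_mul, S3.v_mul, S3.u_rot, S3.v_rot, mul_zero, sub_zero, add_zero,
    map_mul, h]
  rw [show S3.u x * Complex.exp (θ * Complex.I) - t * (S3.v x * Complex.exp (θ * Complex.I)) =
    Complex.exp (θ * Complex.I) * (S3.u x - t * S3.v x) by ring,
    show conj (S3.v x) * Complex.exp (-(θ * Complex.I)) +
      t * (conj (S3.u x) * Complex.exp (-(θ * Complex.I))) =
    Complex.exp (-(θ * Complex.I)) * (conj (S3.v x) + t * conj (S3.u x)) by ring, mul_pow,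
    mul_pow]
  ring

/-- Left translation moves the parameter (1 : t) to a pair whose first entry may vanish, so the
generating function is needed on the whole projective line. -/
theorem genFun_homogeneous (p q : ℕ) (s t : ℂ) (x : S3) :
    (s * S3.u x - t * S3.v x) ^ p * (s * conj (S3.v x) + t * conj (S3.u x)) ^ q =
      ∑ k ∈ Finset.range (p + q + 1), s ^ (p + q - k) * t ^ k * sphFun p q k x := by
  rcases eq_or_ne s 0 with rfl | hs
  -- For s = 0 only the top coefficient survives, and it is the product of the top coefficients of
  -- the two factors.
  · rw [Finset.sum_range_succ, Finset.sum_eq_zero]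
    · have h1 : (polyA x ^ p).coeff p = (-S3.v x) ^ p := by
        have := coeff_pow_of_natDegree_le (m := p) (natDegree_polyA_le x)
        simpa [polyA] using this
      have h2 : (polyB x ^ q).coeff q = (conj (S3.u x)) ^ q := by
        have := coeff_pow_of_natDegree_le (m := q) (natDegree_polyB_le x)
        simpa [polyB] using this
      have h3 : sphFun p q (p + q) x = (-S3.v x) ^ p * conj (S3.u x) ^ q := by
        rw [sphFun, genPoly, coeff_mul_add_eq_of_natDegree_le
          (by simpa using natDegree_pow_le_of_le p (natDegree_polyA_le x))
          (by simpa using natDegree_pow_le_of_le q (natDegree_polyB_le x)), h1, h2]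
      rw [h3]
      simp only [zero_mul, zero_sub, zero_add, Nat.sub_self, pow_zero, one_mul, pow_add]
      rw [show -(t * S3.v x) = t * (-S3.v x) by ring, mul_pow, mul_pow]
      ring
    · intro k hk
      rw [Finset.mem_range] at hk
      rw [zero_pow (by omega)]
      simp
  · have h : (s * S3.u x - t * S3.v x) ^ p * (s * conj (S3.v x) + t * conj (S3.u x)) ^ q =
        s ^ (p + q) * genFun p q (t / s) x := by
      rw [genFun, pow_add, mul_mul_mul_comm, ← mul_pow, ← mul_pow]
      congr 2 <;> field_simp
    rw [h, genFun_eq_sum, Finset.mul_sum]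
    refine Finset.sum_congr rfl fun k hk => ?_
    have hk : k ≤ p + q := Nat.lt_succ_iff.1 (Finset.mem_range.1 hk)
    rw [div_pow, ← Nat.sub_add_cancel hk, pow_add, Nat.add_sub_cancel]
    field_simp

/-- Translation by g acts linearly on the pair (1, t) and leaves the coordinates of x alone. Each
bidegree therefore spans a left-invariant space. -/
theorem genFun_mul_left (p q : ℕ) (t : ℂ) (g x : S3) : genFun p q t (g * x) =
    ∑ k ∈ Finset.range (p + q + 1), (S3.u g - t * S3.v g) ^ (p + q - k) *
      (conj (S3.v g) + t * conj (S3.u g)) ^ k * sphFun p q k x := by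
  rw [← genFun_homogeneous, genFun, S3.u_mul, S3.v_mul]
  congr 2
  · ring
  · simp only [map_sub, map_add, map_mul, Complex.conj_conj]
    ring

theorem exists_sphFun_mul_left (p q k : ℕ) (g : S3) : ∃ c : ℕ → ℂ, ∀ x,
    sphFun p q k (g * x) = ∑ l ∈ Finset.range (p + q + 1), c l * sphFun p q l x := by
  obtain ⟨c, hc⟩ := exists_sphFun_eq_sum p q k
  refine ⟨fun l => ∑ i ∈ Finset.range (p + q + 1), c i * ((S3.u g - i * S3.v g) ^ (p + q - l) *
      (conj (S3.v g) + i * conj (S3.u g)) ^ l), fun x => ?_⟩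
  rw [hc]
  simp only [genFun_mul_left, Finset.mul_sum, Finset.sum_mul]
  rw [Finset.sum_comm]
  simp only [mul_assoc]

end SubLap

/-! ### Integration by parts and eigenfunctions of the sub-Laplacian -/

namespace SubLap

open ComplexConjugate

/-! ### Haar measure -/

section Haar

variable (G : Type*) [Group G] [TopologicalSpace G] [IsTopologicalGroup G]
    [CompactSpace G] [MeasurableSpace G] [BorelSpace G]

instance : IsProbabilityMeasure (haarProb G) := ⟨haarProb_univ G⟩

instance : (haarProb G).IsHaarMeasure := by unfold haarProb; infer_instance

/-- A right translate is again a left Haar probability measure, and that measure is unique. -/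
instance : (haarProb G).IsMulRightInvariant where
  map_mul_right_eq_self g := by
    have : IsProbabilityMeasure ((haarProb G).map (· * g)) :=
      Measure.isProbabilityMeasure_map (measurable_mul_const g).aemeasurable
    exact Measure.isHaarMeasure_eq_of_isProbabilityMeasure _ _

end Haar

theorem integrable_of_continuous {G : Type*} [Group G] [TopologicalSpace G] [IsTopologicalGroup G]
    [CompactSpace G] [MeasurableSpace G] [BorelSpace G] {E : Type*} [NormedAddCommGroup E]
    [SecondCountableTopology E] {f : G → E}
    (hf : Continuous f) : Integrable f (haarProb G) := by
  borelize E
  exact hf.integrable_of_hasCompactSupport (HasCompactSupport.of_compactSpace f)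

/-! ### Smooth functions on `𝕊³` -/

namespace IsSmooth

variable {G E : Type*} [NormedAddCommGroup E] [NormedSpace ℝ E] {ι : G → E} {f g : G → ℂ}

theorem const (c : ℂ) : IsSmooth ι (fun _ => c) := ⟨fun _ => c, contDiff_const, fun _ => rfl⟩

theorem add (hf : IsSmooth ι f) (hg : IsSmooth ι g) : IsSmooth ι (fun x => f x + g x) := by
  obtain ⟨F, hF, hfF⟩ := hf
  obtain ⟨K, hK, hgK⟩ := hg
  exact ⟨fun e => F e + K e, hF.add hK, fun x => by simp only [hfF, hgK]⟩

theorem mul (hf : IsSmooth ι f) (hg : IsSmooth ι g) : IsSmooth ι (fun x => f x * g x) := by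
  obtain ⟨F, hF, hfF⟩ := hf
  obtain ⟨K, hK, hgK⟩ := hg
  exact ⟨fun e => F e * K e, hF.mul hK, fun x => by simp only [hfF, hgK]⟩

theorem pow (hf : IsSmooth ι f) (n : ℕ) : IsSmooth ι (fun x => f x ^ n) := by
  obtain ⟨F, hF, hfF⟩ := hf
  exact ⟨fun e => F e ^ n, hF.pow n, fun x => by simp only [hfF]⟩

theorem conjugate (hf : IsSmooth ι f) : IsSmooth ι (fun x => conj (f x)) := by
  obtain ⟨F, hF, hfF⟩ := hf
  exact ⟨fun e => (starRingEnd ℂ) (F e), Complex.conjCLE.contDiff.comp hF, fun x => by simp only [hfF]⟩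

theorem of_clm (l : E →L[ℝ] ℝ) : IsSmooth ι (fun x => (l (ι x) : ℂ)) :=
  ⟨fun e => (l e : ℂ), Complex.ofRealCLM.contDiff.comp l.contDiff, fun _ => rfl⟩

theorem continuous [TopologicalSpace G] (hf : IsSmooth ι f) (hι : Continuous ι) :
    Continuous f := by
  obtain ⟨F, hF, hfF⟩ := hf
  rw [funext hfF]
  exact hF.continuous.comp hι

end IsSmooth

/-- Quaternion coordinates as continuous linear forms. -/
noncomputable def quatCoord (l : ℍ[ℝ] →ₗ[ℝ] ℝ) : ℍ[ℝ] →L[ℝ] ℝ :=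
  LinearMap.toContinuousLinearMap l

theorem isSmooth_re : IsSmooth S3.incl (fun x => (x.1.re : ℂ)) :=
  IsSmooth.of_clm (ι := S3.incl) (quatCoord ⟨⟨fun q => q.re, fun _ _ => rfl⟩, fun _ _ => by simp⟩)

theorem isSmooth_imI : IsSmooth S3.incl (fun x => (x.1.imI : ℂ)) :=
  IsSmooth.of_clm (ι := S3.incl) (quatCoord ⟨⟨fun q => q.imI, fun _ _ => rfl⟩, fun _ _ => by simp⟩)

theorem isSmooth_imJ : IsSmooth S3.incl (fun x => (x.1.imJ : ℂ)) :=
  IsSmooth.of_clm (ι := S3.incl) (quatCoord ⟨⟨fun q => q.imJ, fun _ _ => rfl⟩, fun _ _ => by simp⟩)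

theorem isSmooth_imK : IsSmooth S3.incl (fun x => (x.1.imK : ℂ)) :=
  IsSmooth.of_clm (ι := S3.incl) (quatCoord ⟨⟨fun q => q.imK, fun _ _ => rfl⟩, fun _ _ => by simp⟩)

theorem isSmooth_u : IsSmooth S3.incl S3.u := by
  have h := isSmooth_re.add (isSmooth_imK.mul (IsSmooth.const Complex.I))
  convert h using 1
  ext x
  apply Complex.ext <;> simp [S3.u]

theorem isSmooth_v : IsSmooth S3.incl S3.v := by
  have h := isSmooth_imJ.add (isSmooth_imI.mul (IsSmooth.const Complex.I))
  convert h using 1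
  ext x
  apply Complex.ext <;> simp [S3.v]

theorem isSmooth_genFun (p q : ℕ) (t : ℂ) : IsSmooth S3.incl (genFun p q t) := by
  have hA := (isSmooth_u.add ((IsSmooth.const (-t)).mul isSmooth_v)).pow p
  have hB := (isSmooth_v.conjugate.add ((IsSmooth.const t).mul isSmooth_u.conjugate)).pow q
  have h : genFun p q t = fun x => (S3.u x + -t * S3.v x) ^ p *
      (conj (S3.v x) + t * conj (S3.u x)) ^ q := by
    ext x
    simp only [genFun, neg_mul, sub_eq_add_neg]
  rw [h]
  exact hA.mul hB

@[simp] theorem quat_re (a b c d : ℝ) : (quat a b c d).re = a := rfl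

@[simp] theorem quat_imI (a b c d : ℝ) : (quat a b c d).imI = b := rfl

@[simp] theorem quat_imJ (a b c d : ℝ) : (quat a b c d).imJ = c := rfl

@[simp] theorem quat_imK (a b c d : ℝ) : (quat a b c d).imK = d := rfl

/-! ### Left-invariant vector fields on `𝕊³` -/

/-- `ω` is a one-parameter subgroup of `𝕊³` with velocity `e`. -/
structure IsOneParam (ω : ℝ → S3) (e : ℍ[ℝ]) : Prop where
  zero : ω 0 = 1
  add : ∀ s t, ω (s + t) = ω s * ω t
  deriv : HasDerivAt (fun t => (ω t).1) e 0

theorem isOneParam_omega₁ : IsOneParam S3.omega₁ (quat 0 (1 / 2) 0 0) where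
  zero := S3.omega₁_zero
  add := S3.omega₁_add
  deriv := by
    have h : HasDerivAt (fun t : ℝ => t / 2) (1 / 2) 0 := (hasDerivAt_id 0).div_const 2
    have h1 := (h.cos.smul_const (1 : ℍ[ℝ])).add (h.sin.smul_const (quat 0 1 0 0))
    have e : (fun t => (S3.omega₁ t).1) =
        fun t => Real.cos (t / 2) • (1 : ℍ[ℝ]) + Real.sin (t / 2) • quat 0 1 0 0 := by
      ext t <;> simp [S3.omega₁]
    rw [e]
    exact h1.congr_deriv (by ext <;> simp)

theorem isOneParam_omega₂ : IsOneParam S3.omega₂ (quat 0 0 (1 / 2) 0) where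
  zero := S3.omega₂_zero
  add := S3.omega₂_add
  deriv := by
    have h : HasDerivAt (fun t : ℝ => t / 2) (1 / 2) 0 := (hasDerivAt_id 0).div_const 2
    have h1 := (h.cos.smul_const (1 : ℍ[ℝ])).add (h.sin.smul_const (quat 0 0 1 0))
    have e : (fun t => (S3.omega₂ t).1) =
        fun t => Real.cos (t / 2) • (1 : ℍ[ℝ]) + Real.sin (t / 2) • quat 0 0 1 0 := by
      ext t <;> simp [S3.omega₂]
    rw [e]
    exact h1.congr_deriv (by ext <;> simp)

theorem continuous_incl : Continuous S3.incl := continuous_subtype_val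

namespace IsOneParam

variable {ω : ℝ → S3} {e : ℍ[ℝ]} {f g : S3 → ℂ}

/-- The derivative along q ω(t) is the differential of F at q applied to q e, which is smooth in q
on all quaternions. Hence the fields preserve smoothness, and the `deriv` in `invField` is a genuine
derivative on smooth functions. -/
theorem exists_hasDerivAt (hω : IsOneParam ω e) (hf : IsSmooth S3.incl f) : ∃ F : ℍ[ℝ] → ℂ,
    ContDiff ℝ (⊤ : ℕ∞) F ∧ ∀ x, HasDerivAt (fun t => f (x * ω t)) (F (S3.incl x)) 0 := by
  obtain ⟨F, hF, hfF⟩ := hf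
  refine ⟨fun q => fderiv ℝ F q (q * e), ?_, fun x => ?_⟩
  · have h1 : ContDiff ℝ (⊤ : ℕ∞) (fderiv ℝ F) := hF.fderiv_right (by simp)
    exact h1.clm_apply (contDiff_id.mul contDiff_const)
  · have h1 : HasDerivAt (fun t => x.1 * (ω t).1) (x.1 * e) 0 := hω.deriv.const_mul x.1
    have h2 : HasFDerivAt F (fderiv ℝ F (S3.incl x)) (x.1 * (ω 0).1) := by
      have : x.1 * (ω 0).1 = S3.incl x := by rw [hω.zero]; simp [S3.incl]
      rw [this]
      exact (hF.differentiable (by simp) _).hasFDerivAt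
    have h3 := h2.comp_hasDerivAt 0 h1
    have e : (fun t => f (x * ω t)) = F ∘ fun t => x.1 * (ω t).1 := funext fun t => hfF _
    rw [e]
    exact h3

theorem hasDerivAt (hω : IsOneParam ω e) (hf : IsSmooth S3.incl f) (x : S3) :
    HasDerivAt (fun t => f (x * ω t)) (invField ω f x) 0 := by
  obtain ⟨F, -, h⟩ := hω.exists_hasDerivAt hf
  exact (h x).differentiableAt.hasDerivAt

theorem isSmooth_invField (hω : IsOneParam ω e) (hf : IsSmooth S3.incl f) : IsSmooth S3.incl (invField ω f) := by
  obtain ⟨F, hF, h⟩ := hω.exists_hasDerivAt hf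
  exact ⟨F, hF, fun x => (h x).deriv⟩

theorem hasDerivAt_translate (hω : IsOneParam ω e) (hf : IsSmooth S3.incl f) (x : S3) (s : ℝ) :
    HasDerivAt (fun t => f (x * ω t)) (invField ω f (x * ω s)) s := by
  have h := hω.hasDerivAt hf (x * ω s)
  have h2 : HasDerivAt (fun t : ℝ => t - s) 1 s := (hasDerivAt_id s).sub_const s
  rw [show (0 : ℝ) = s - s by ring] at h
  have h3 := HasDerivAt.scomp (h := fun t => t - s) s h h2
  rw [one_smul] at h3
  have e : (fun t => f (x * ω t)) = (fun t => f (x * ω s * ω t)) ∘ fun t => t - s := by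
    ext t
    simp only [Function.comp_apply]
    rw [mul_assoc, ← hω.add, add_sub_cancel]
  rw [e]
  exact h3

theorem invField_eq {f' : S3 → ℂ} (h : ∀ x, HasDerivAt (fun t => f (x * ω t)) (f' x) 0) :
    invField ω f = f' := funext fun x => (h x).deriv

/-- By right invariance the integral of f(x ω(t)) does not depend on t. Differentiate under the
integral sign; compactness supplies the dominating constant. -/
theorem integral_invField (hω : IsOneParam ω e) (hf : IsSmooth S3.incl f) :
    ∫ x, invField ω f x ∂haarProb S3 = 0 := by
  have hcf := hf.continuous continuous_incl
  have hcD := (hω.isSmooth_invField hf).continuous continuous_incl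
  obtain ⟨C, hC⟩ := IsCompact.exists_bound_of_continuousOn (isCompact_univ (X := S3))
    hcD.continuousOn
  have key := hasDerivAt_integral_of_dominated_loc_of_deriv_le (μ := haarProb S3)
    (F := fun (t : ℝ) x => f (x * ω t)) (F' := fun t x => invField ω f (x * ω t))
    (x₀ := (0 : ℝ)) (s := Set.univ) (bound := fun _ => C) Filter.univ_mem
    (Filter.Eventually.of_forall fun t =>
      (integrable_of_continuous (hcf.comp (continuous_mul_const (ω t)))).aestronglyMeasurable)
    (integrable_of_continuous (hcf.comp (continuous_mul_const (ω 0))))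
    (integrable_of_continuous (hcD.comp (continuous_mul_const (ω 0)))).aestronglyMeasurable
    (Filter.Eventually.of_forall fun x t _ => hC _ (Set.mem_univ _)) (integrable_const C)
    (Filter.Eventually.of_forall fun x t _ => hω.hasDerivAt_translate hf x t)
  have h1 := key.2
  simp only [integral_mul_right_eq_self f] at h1
  have h2 := h1.unique (hasDerivAt_const 0 _)
  rwa [integral_mul_right_eq_self (invField ω f)] at h2

theorem invField_mul (hω : IsOneParam ω e) (hf : IsSmooth S3.incl f) (hg : IsSmooth S3.incl g) (x : S3) :
    invField ω (fun y => f y * g y) x = invField ω f x * g x + f x * invField ω g x := by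
  have h := ((hω.hasDerivAt hf x).mul (hω.hasDerivAt hg x)).deriv
  simp only [hω.zero, mul_one] at h
  exact h

theorem invField_add (hω : IsOneParam ω e) (hf : IsSmooth S3.incl f) (hg : IsSmooth S3.incl g) :
    invField ω (fun y => f y + g y) = fun x => invField ω f x + invField ω g x :=
  invField_eq fun x => (hω.hasDerivAt hf x).add (hω.hasDerivAt hg x)

theorem invField_const_mul (hω : IsOneParam ω e) (hf : IsSmooth S3.incl f) (c : ℂ) :
    invField ω (fun y => c * f y) = fun x => c * invField ω f x :=
  invField_eq fun x => (hω.hasDerivAt hf x).const_mul c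

theorem invField_conj (hω : IsOneParam ω e) (hf : IsSmooth S3.incl f) :
    invField ω (fun y => conj (f y)) = fun x => conj (invField ω f x) :=
  invField_eq fun x => (hω.hasDerivAt hf x).star

theorem integral_invField_mul (hω : IsOneParam ω e) (hf : IsSmooth S3.incl f) (hg : IsSmooth S3.incl g) :
    ∫ x, invField ω f x * g x ∂haarProb S3 = -∫ x, f x * invField ω g x ∂haarProb S3 := by
  have h := hω.integral_invField (hf.mul hg)
  simp only [hω.invField_mul hf hg] at h
  have hc := hf.continuous continuous_incl
  have hc' := hg.continuous continuous_incl
  have hd := (hω.isSmooth_invField hf).continuous continuous_incl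
  have hd' := (hω.isSmooth_invField hg).continuous continuous_incl
  rw [integral_add (f := fun x => invField ω f x * g x) (g := fun x => f x * invField ω g x)
    (integrable_of_continuous (hd.mul hc')) (integrable_of_continuous (hc.mul hd'))] at h
  exact eq_neg_of_add_eq_zero_left h

theorem integral_invField_sq_mul (hω : IsOneParam ω e) (hf : IsSmooth S3.incl f) (hg : IsSmooth S3.incl g) :
    ∫ x, invField ω (invField ω f) x * g x ∂haarProb S3 =
      ∫ x, f x * invField ω (invField ω g) x ∂haarProb S3 := by
  rw [hω.integral_invField_mul (hω.isSmooth_invField hf) hg,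
    hω.integral_invField_mul hf (hω.isSmooth_invField hg), neg_neg]

end IsOneParam

/-! ### Eigenfunctions of the sub-Laplacian on `𝕊³` -/

/-- `φ` is a smooth function on `𝕊³` with `-ℒ φ = c φ`. -/
def IsEigen (c : ℝ) (φ : S3 → ℂ) : Prop :=
  IsSmooth S3.incl φ ∧ ∀ x, -subLaplacian S3.omega₁ S3.omega₂ φ x = (c : ℂ) * φ x

namespace IsEigen

variable {c d : ℝ} {φ ψ : S3 → ℂ}

theorem continuous (h : IsEigen c φ) : Continuous φ := h.1.continuous continuous_incl

theorem add (h : IsEigen c φ) (h' : IsEigen c ψ) : IsEigen c (fun x => φ x + ψ x) := by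
  refine ⟨h.1.add h'.1, fun x => ?_⟩
  have h1 := h.2 x
  have h2 := h'.2 x
  simp only [subLaplacian] at h1 h2 ⊢
  have o1 := isOneParam_omega₁
  have o2 := isOneParam_omega₂
  rw [o1.invField_add h.1 h'.1, o1.invField_add (o1.isSmooth_invField h.1)
    (o1.isSmooth_invField h'.1), o2.invField_add h.1 h'.1, o2.invField_add
    (o2.isSmooth_invField h.1) (o2.isSmooth_invField h'.1)]
  linear_combination h1 + h2

theorem const_mul (h : IsEigen c φ) (a : ℂ) : IsEigen c (fun x => a * φ x) := by
  refine ⟨(IsSmooth.const a).mul h.1, fun x => ?_⟩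
  have h1 := h.2 x
  simp only [subLaplacian] at h1 ⊢
  have o1 := isOneParam_omega₁
  have o2 := isOneParam_omega₂
  rw [o1.invField_const_mul h.1, o1.invField_const_mul (o1.isSmooth_invField h.1),
    o2.invField_const_mul h.1, o2.invField_const_mul (o2.isSmooth_invField h.1)]
  linear_combination a * h1

theorem conjugate (h : IsEigen c φ) : IsEigen c (fun x => conj (φ x)) := by
  refine ⟨h.1.conjugate, fun x => ?_⟩
  have h1 := congrArg (starRingEnd ℂ) (h.2 x)
  have o1 := isOneParam_omega₁
  have o2 := isOneParam_omega₂
  simp only [subLaplacian, map_neg, map_add, map_mul, Complex.conj_ofReal] at h1 ⊢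
  rw [o1.invField_conj h.1, o1.invField_conj (o1.isSmooth_invField h.1),
    o2.invField_conj h.1, o2.invField_conj (o2.isSmooth_invField h.1)]
  exact h1

theorem zero (c : ℝ) : IsEigen c (fun _ => 0) := by
  refine ⟨IsSmooth.const 0, fun x => ?_⟩
  simp [subLaplacian, invField]

theorem sum {ι : Type*} (s : Finset ι) {F : ι → S3 → ℂ} (h : ∀ i ∈ s, IsEigen c (F i)) :
    IsEigen c (fun x => ∑ i ∈ s, F i x) := by
  classical
  induction s using Finset.induction_on with
  | empty => simpa using zero c
  | insert a s ha ih =>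
    simp only [Finset.sum_insert ha]
    exact (h a (Finset.mem_insert_self a s)).add
      (ih fun i hi => h i (Finset.mem_insert_of_mem hi))

/-- Two integrations by parts make ℒ symmetric for the bilinear pairing, so the integral is
multiplied equally by c and by d. -/
theorem integral_mul_eq_zero (h : IsEigen c φ) (h' : IsEigen d ψ) (hcd : c ≠ d) :
    ∫ x, φ x * ψ x ∂haarProb S3 = 0 := by
  have o1 := isOneParam_omega₁
  have o2 := isOneParam_omega₂
  have hc := h.continuous
  have hc' := h'.continuous
  have c1 := (o1.isSmooth_invField (o1.isSmooth_invField h.1)).continuous continuous_incl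
  have c2 := (o2.isSmooth_invField (o2.isSmooth_invField h.1)).continuous continuous_incl
  have c3 := (o1.isSmooth_invField (o1.isSmooth_invField h'.1)).continuous continuous_incl
  have c4 := (o2.isSmooth_invField (o2.isSmooth_invField h'.1)).continuous continuous_incl
  have e1 : ∫ x, subLaplacian S3.omega₁ S3.omega₂ φ x * ψ x ∂haarProb S3 =
      ∫ x, φ x * subLaplacian S3.omega₁ S3.omega₂ ψ x ∂haarProb S3 := by
    simp only [subLaplacian, add_mul, mul_add]
    have a1 := integral_add (integrable_of_continuous (c1.mul hc'))
      (integrable_of_continuous (c2.mul hc'))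
    have a2 := integral_add (integrable_of_continuous (hc.mul c3))
      (integrable_of_continuous (hc.mul c4))
    simp only [Pi.mul_apply] at a1 a2
    rw [a1, a2, o1.integral_invField_sq_mul h.1 h'.1, o2.integral_invField_sq_mul h.1 h'.1]
  have e2 : ∀ x, subLaplacian S3.omega₁ S3.omega₂ φ x * ψ x = -(c : ℂ) * (φ x * ψ x) := fun x => by
    linear_combination (-ψ x) * h.2 x
  have e3 : ∀ x, φ x * subLaplacian S3.omega₁ S3.omega₂ ψ x = -(d : ℂ) * (φ x * ψ x) := fun x => by
    linear_combination (-φ x) * h'.2 x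
  simp only [e2, e3, integral_const_mul] at e1
  have hne : (c : ℂ) - d ≠ 0 := sub_ne_zero.2 (by exact_mod_cast hcd)
  have e4 : ((c : ℂ) - d) * ∫ x, φ x * ψ x ∂haarProb S3 = 0 := by linear_combination -e1
  exact (mul_eq_zero.1 e4).resolve_left hne

end IsEigen

/-- The eigenvalue of `-ℒ` on the spherical functions of bidegree `(p, q)`. -/
noncomputable def eigenval (p q : ℕ) : ℝ := p * q + (p + q) / 2

theorem hasDerivAt_A₁ (t : ℂ) (x : S3) :
    HasDerivAt (fun s => S3.u (x * S3.omega₁ s) - t * S3.v (x * S3.omega₁ s))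
      (-(Complex.I / 2) * (conj (S3.v x) + t * conj (S3.u x))) 0 := by
  have h : HasDerivAt (fun t : ℝ => t / 2) (1 / 2) 0 := (hasDerivAt_id 0).div_const 2
  have hc := h.cos.ofReal_comp
  have hs := h.sin.ofReal_comp
  simp only [S3.u_mul, S3.v_mul, S3.u_omega₁, S3.v_omega₁]
  have := ((hc.const_mul (S3.u x)).sub ((hs.const_mul Complex.I).const_mul (conj (S3.v x)))).sub
    (((hc.const_mul (S3.v x)).add ((hs.const_mul Complex.I).const_mul (conj (S3.u x)))).const_mul t)
  exact this.congr_deriv (by simp; ring)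

theorem hasDerivAt_B₁ (t : ℂ) (x : S3) :
    HasDerivAt (fun s => conj (S3.v (x * S3.omega₁ s)) + t * conj (S3.u (x * S3.omega₁ s)))
      (-(Complex.I / 2) * (S3.u x - t * S3.v x)) 0 := by
  have h : HasDerivAt (fun t : ℝ => t / 2) (1 / 2) 0 := (hasDerivAt_id 0).div_const 2
  have hc := h.cos.ofReal_comp
  have hs := h.sin.ofReal_comp
  simp only [S3.u_mul, S3.v_mul, S3.u_omega₁, S3.v_omega₁, map_sub, map_add, map_mul,
    Complex.conj_I, Complex.conj_ofReal, Complex.conj_conj]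
  have := ((hc.const_mul (conj (S3.v x))).add ((hs.const_mul (-Complex.I)).const_mul (S3.u x))).add
    (((hc.const_mul (conj (S3.u x))).sub ((hs.const_mul (-Complex.I)).const_mul (S3.v x))).const_mul
      t)
  exact this.congr_deriv (by simp; ring)

theorem hasDerivAt_A₂ (t : ℂ) (x : S3) :
    HasDerivAt (fun s => S3.u (x * S3.omega₂ s) - t * S3.v (x * S3.omega₂ s))
      (-(1 / 2) * (conj (S3.v x) + t * conj (S3.u x))) 0 := by
  have h : HasDerivAt (fun t : ℝ => t / 2) (1 / 2) 0 := (hasDerivAt_id 0).div_const 2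
  have hc := h.cos.ofReal_comp
  have hs := h.sin.ofReal_comp
  simp only [S3.u_mul, S3.v_mul, S3.u_omega₂, S3.v_omega₂]
  have := ((hc.const_mul (S3.u x)).sub (hs.const_mul (conj (S3.v x)))).sub
    (((hc.const_mul (S3.v x)).add (hs.const_mul (conj (S3.u x)))).const_mul t)
  exact this.congr_deriv (by simp; ring)

theorem hasDerivAt_B₂ (t : ℂ) (x : S3) :
    HasDerivAt (fun s => conj (S3.v (x * S3.omega₂ s)) + t * conj (S3.u (x * S3.omega₂ s)))
      (1 / 2 * (S3.u x - t * S3.v x)) 0 := by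
  have h : HasDerivAt (fun t : ℝ => t / 2) (1 / 2) 0 := (hasDerivAt_id 0).div_const 2
  have hc := h.cos.ofReal_comp
  have hs := h.sin.ofReal_comp
  simp only [S3.u_mul, S3.v_mul, S3.u_omega₂, S3.v_omega₂, map_sub, map_add, map_mul,
    Complex.conj_ofReal, Complex.conj_conj]
  have := ((hc.const_mul (conj (S3.v x))).add (hs.const_mul (S3.u x))).add
    (((hc.const_mul (conj (S3.u x))).sub (hs.const_mul (S3.v x))).const_mul t)
  exact this.congr_deriv (by simp; ring)

/-- The constants a and b record that the field sends A to a B and B to b A. -/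
theorem IsOneParam.invField_genFun {ω : ℝ → S3} {e : ℍ[ℝ]} (hω : IsOneParam ω e) {t a b : ℂ}
    (hA : ∀ x, HasDerivAt (fun s => S3.u (x * ω s) - t * S3.v (x * ω s))
      (a * (conj (S3.v x) + t * conj (S3.u x))) 0)
    (hB : ∀ x, HasDerivAt (fun s => conj (S3.v (x * ω s)) + t * conj (S3.u (x * ω s)))
      (b * (S3.u x - t * S3.v x)) 0) (p q : ℕ) :
    invField ω (genFun p q t) = fun x =>
      a * p * genFun (p - 1) (q + 1) t x + b * q * genFun (p + 1) (q - 1) t x := by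
  refine IsOneParam.invField_eq fun x => ?_
  have h := ((hA x).pow p).mul ((hB x).pow q)
  simp only [hω.zero, mul_one] at h
  exact h.congr_deriv (by simp only [genFun, Pi.pow_apply, hω.zero, mul_one]; ring)

/-- Here (a, b) is (-i/2, -i/2) for D₁ and (-1/2, 1/2) for D₂. The terms of D₁² and D₂² that shift
the bidegree carry a² or b², which is -1/4 for one field and 1/4 for the other, so they cancel. The
remaining terms carry ab = -1/4 for both fields and add up to -(2pq + p + q)/2. -/
theorem isEigen_genFun (p q : ℕ) (t : ℂ) : IsEigen (eigenval p q) (genFun p q t) := by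
  refine ⟨isSmooth_genFun p q t, fun x => ?_⟩
  have o1 := isOneParam_omega₁
  have o2 := isOneParam_omega₂
  have e1 := o1.invField_genFun (hasDerivAt_A₁ t) (hasDerivAt_B₁ t)
  have e2 := o2.invField_genFun (hasDerivAt_A₂ t) (hasDerivAt_B₂ t)
  have hs := isSmooth_genFun (t := t)
  have hc (c : ℂ) := IsSmooth.const (ι := S3.incl) c
  simp only [subLaplacian]
  rw [e1, o1.invField_add ((hc _).mul (hs _ _)) ((hc _).mul (hs _ _)),
    o1.invField_const_mul (hs _ _), o1.invField_const_mul (hs _ _), e1, e1,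
    e2, o2.invField_add ((hc _).mul (hs _ _)) ((hc _).mul (hs _ _)),
    o2.invField_const_mul (hs _ _), o2.invField_const_mul (hs _ _), e2, e2]
  have hI := Complex.I_sq
  simp only [eigenval]
  -- Splitting off zero resolves the truncated exponents p - 1 and q - 1.
  rcases p with - | p <;> rcases q with - | q <;> push_cast <;>
    simp only [genFun] <;> grind

theorem isEigen_sphFun (p q k : ℕ) : IsEigen (eigenval p q) (sphFun p q k) := by
  obtain ⟨c, hc⟩ := exists_sphFun_eq_sum p q k
  rw [funext hc]
  exact IsEigen.sum _ fun i _ => (isEigen_genFun p q i).const_mul (c i)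

end SubLap

/-! ### Orthogonality, reproducing kernels and the zonal L¹ estimate -/

namespace SubLap

open ComplexConjugate

/-! ### The `L²` pairing on `𝕊³` -/

/-- The `L²` inner product, linear in the first argument. -/
noncomputable def pairing (f g : S3 → ℂ) : ℂ := ∫ x, f x * conj (g x) ∂haarProb S3

theorem pairing_conj (f g : S3 → ℂ) : conj (pairing f g) = pairing g f := by
  rw [pairing, ← integral_conj]
  simp [pairing, mul_comm]

theorem pairing_mul_left (a f g : S3 → ℂ) :
    pairing (fun x => a x * f x) g = pairing f (fun x => conj (a x) * g x) := by
  simp only [pairing, map_mul, Complex.conj_conj]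
  congr 1; ext x; ring

theorem pairing_linear {f g h : S3 → ℂ} (hf : Continuous f) (hg : Continuous g)
    (hh : Continuous h) (a b : ℂ) :
    pairing (fun x => a * f x + b * g x) h = a * pairing f h + b * pairing g h := by
  have hc : Continuous fun x => conj (h x) := Complex.continuous_conj.comp hh
  simp only [pairing]
  rw [← integral_const_mul, ← integral_const_mul, ← integral_add]
  · congr 1; ext x; ring
  · exact (integrable_of_continuous (hf.mul hc)).const_mul a
  · exact (integrable_of_continuous (hg.mul hc)).const_mul b

theorem pairing_const_mul (a : ℂ) (f g : S3 → ℂ) :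
    pairing (fun x => a * f x) g = a * pairing f g := by
  simp only [pairing, ← integral_const_mul, mul_assoc]

theorem pairing_sum {ι : Type*} (s : Finset ι) {f : ι → S3 → ℂ} {g : S3 → ℂ}
    (hf : ∀ i ∈ s, Continuous (f i)) (hg : Continuous g) (c : ι → ℂ) :
    pairing (fun x => ∑ i ∈ s, c i * f i x) g = ∑ i ∈ s, c i * pairing (f i) g := by
  have hc : Continuous fun x => conj (g x) := Complex.continuous_conj.comp hg
  simp only [pairing, Finset.sum_mul, ← integral_const_mul]
  rw [integral_finsetSum]
  · simp only [mul_assoc]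
  · exact fun i hi => integrable_of_continuous ((continuous_const.mul (hf i hi)).mul hc)

theorem pairing_self (f : S3 → ℂ) :
    pairing f f = ((∫ x, ‖f x‖ ^ 2 ∂haarProb S3 : ℝ) : ℂ) := by
  refine Eq.trans ?_ (integral_ofReal (𝕜 := ℂ))
  unfold pairing
  congr 1; ext x
  rw [Complex.mul_conj, Complex.normSq_eq_norm_sq]
  rfl

/-! ### Orthogonality of the spherical functions -/

/-- For fixed p - q the difference of the eigenvalues factors as (q' - q)(p + q' + 1). -/
theorem eigenval_ne {p q p' q' : ℕ} (h : p + q' = p' + q) (hne : (p, q) ≠ (p', q')) :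
    eigenval p q ≠ eigenval p' q' := by
  intro he
  have h' : (p : ℝ) + q' = p' + q := by exact_mod_cast h
  have hp : (p' : ℝ) = p + (q' - q) := by linarith
  simp only [eigenval] at he
  have h2 : ((q' : ℝ) - q) * (p + q' + 1) = 0 := by rw [hp] at he; linarith
  have h3 : (p : ℝ) + q' + 1 ≠ 0 := by positivity
  have h4 : (q' : ℝ) = q := sub_eq_zero.1 ((mul_eq_zero.1 h2).resolve_right h3)
  have h5 : q' = q := by exact_mod_cast h4
  subst h5
  exact hne (by rw [Nat.add_right_cancel h])

theorem sphFun_mul_rot (p q k : ℕ) (x : S3) (θ : ℝ) : sphFun p q k (x * S3.rot θ) =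
    Complex.exp (θ * Complex.I) ^ p * Complex.exp (-(θ * Complex.I)) ^ q * sphFun p q k x := by
  obtain ⟨c, hc⟩ := exists_sphFun_eq_sum p q k
  rw [hc, hc, Finset.mul_sum]
  refine Finset.sum_congr rfl fun i _ => ?_
  rw [genFun_mul_rot]
  ring

theorem pairing_sphFun_of_weight_ne {p q p' q' : ℕ} (h : p + q' ≠ p' + q) (k l : ℕ) :
    pairing (sphFun p q k) (sphFun p' q' l) = 0 := by
  have hd : (p : ℝ) + q' - (p' + q) ≠ 0 := sub_ne_zero.2 (by exact_mod_cast h)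
  -- With this angle, right translation by `S3.rot θ` multiplies the integrand by exp(iπ) = -1, and
  -- invariance forces the integral to vanish.
  set θ : ℝ := Real.pi / (p + q' - (p' + q)) with hθ
  have e := integral_mul_right_eq_self (μ := haarProb S3)
    (fun x => sphFun p q k x * conj (sphFun p' q' l x)) (S3.rot θ)
  have hc : conj (Complex.exp (θ * Complex.I)) = Complex.exp (-(θ * Complex.I)) := by
    rw [← Complex.exp_conj]; simp
  have hc' : conj (Complex.exp (-(θ * Complex.I))) = Complex.exp (θ * Complex.I) := by
    rw [← Complex.exp_conj]; simp
  have hm : Complex.exp (θ * Complex.I) ^ p * Complex.exp (-(θ * Complex.I)) ^ q *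
      (Complex.exp (-(θ * Complex.I)) ^ p' * Complex.exp (θ * Complex.I) ^ q') = -1 := by
    simp only [← Complex.exp_nat_mul, ← Complex.exp_add]
    rw [← Complex.exp_pi_mul_I]
    congr 1
    have h1 : (θ : ℂ) * (p + q' - (p' + q)) = Real.pi := by
      have : θ * (p + q' - (p' + q)) = Real.pi := by rw [hθ]; field_simp
      exact_mod_cast this
    linear_combination Complex.I * h1
  have e2 : ∀ x, sphFun p q k (x * S3.rot θ) * conj (sphFun p' q' l (x * S3.rot θ)) =
      -1 * (sphFun p q k x * conj (sphFun p' q' l x)) := fun x => by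
    rw [sphFun_mul_rot, sphFun_mul_rot, ← hm]
    simp only [map_mul, map_pow, hc, hc']
    ring
  simp only [e2, integral_const_mul] at e
  have e3 : (2 : ℂ) * pairing (sphFun p q k) (sphFun p' q' l) = 0 := by
    rw [pairing]; linear_combination -e
  exact (mul_eq_zero.1 e3).resolve_left two_ne_zero

theorem pairing_sphFun_of_ne {p q p' q' : ℕ} (h : (p, q) ≠ (p', q')) (k l : ℕ) :
    pairing (sphFun p q k) (sphFun p' q' l) = 0 := by
  by_cases hw : p + q' = p' + q
  · exact (isEigen_sphFun p q k).integral_mul_eq_zero (isEigen_sphFun p' q' l).conjugate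
      (eigenval_ne hw h)
  · exact pairing_sphFun_of_weight_ne hw k l

/-! ### The Gram matrix by raising and lowering bidegrees -/

section Recurrence

variable (p q k : ℕ) {g : S3 → ℂ}

theorem pairing_v_mul (hg : Continuous g) :
    ((p + q + 1 : ℕ) : ℂ) * pairing (fun x => S3.v x * sphFun p q k x) g =
      q * pairing (sphFun p (q - 1) k) g - (k + 1) * pairing (sphFun (p + 1) q (k + 1)) g := by
  rw [← pairing_const_mul]
  simp only [v_mul_sphFun]
  have := pairing_linear (continuous_sphFun p (q - 1) k) (continuous_sphFun (p + 1) q (k + 1)) hg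
    q (-(k + 1))
  simp only [neg_mul, ← sub_eq_add_neg] at this
  exact this

theorem pairing_uconj_mul (hg : Continuous g) :
    ((p + q + 1 : ℕ) : ℂ) * pairing (fun x => conj (S3.u x) * sphFun p q k x) g =
      p * pairing (sphFun (p - 1) q k) g + (k + 1) * pairing (sphFun p (q + 1) (k + 1)) g := by
  rw [← pairing_const_mul]
  simp only [uconj_mul_sphFun]
  exact pairing_linear (continuous_sphFun (p - 1) q k) (continuous_sphFun p (q + 1) (k + 1)) hg
    p (k + 1)

theorem pairing_u_mul_succ (hg : Continuous g) :
    pairing (fun x => S3.u x * sphFun p q (k + 1) x) g =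
      pairing (sphFun (p + 1) q (k + 1)) g + pairing (fun x => S3.v x * sphFun p q k x) g := by
  simp only [u_mul_sphFun_succ]
  have := pairing_linear (continuous_sphFun (p + 1) q (k + 1))
    (S3.continuous_v.mul (continuous_sphFun p q k)) hg 1 1
  simp only [one_mul] at this
  exact this

theorem pairing_vconj_mul_succ (hg : Continuous g) :
    pairing (fun x => conj (S3.v x) * sphFun p q (k + 1) x) g =
      pairing (sphFun p (q + 1) (k + 1)) g -
        pairing (fun x => conj (S3.u x) * sphFun p q k x) g := by
  simp only [vconj_mul_sphFun_succ]
  have := pairing_linear (continuous_sphFun p (q + 1) (k + 1))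
    ((Complex.continuous_conj.comp S3.continuous_u).mul (continuous_sphFun p q k)) hg 1 (-1)
  simp only [one_mul, neg_mul, ← sub_eq_add_neg] at this
  exact this

end Recurrence

/-- The four Gram recurrences share one mechanism. Multiplication by a coordinate raises the
bidegree of the left entry; it is moved to the right entry as its conjugate; there it yields one
term of the original bidegree and one of a different bidegree, which drops out by orthogonality. At
index 0 the raising factor is u or conj v, at positive index v or conj u. -/
theorem gram_succ_left_zero (p q l : ℕ) :
    ((p + q + 2 : ℕ) : ℂ) * pairing (sphFun (p + 1) q 0) (sphFun (p + 1) q l) =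
      (p + 1) * pairing (sphFun p q 0) (sphFun p q l) := by
  have h1 : pairing (sphFun (p + 1) q 0) (sphFun (p + 1) q l) =
      pairing (sphFun p q 0) (fun x => conj (S3.u x) * sphFun (p + 1) q l x) := by
    rw [← pairing_mul_left]
    simp only [u_mul_sphFun_zero]
  have h2 := pairing_uconj_mul (p + 1) q l (continuous_sphFun p q 0)
  rw [pairing_sphFun_of_ne (q := q + 1) (by simp), mul_zero, add_zero, Nat.add_sub_cancel] at h2
  have h3 := congrArg (starRingEnd ℂ) h2
  simp only [map_mul, pairing_conj, Complex.conj_natCast] at h3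
  rw [h1]
  push_cast at h3 ⊢
  linear_combination h3

theorem gram_succ_left_succ (p q k l : ℕ) :
    ((p + q + 2 : ℕ) : ℂ) * (k + 1) *
        pairing (sphFun (p + 1) q (k + 1)) (sphFun (p + 1) q (l + 1)) =
      ((p + q + 1 : ℕ) : ℂ) * (p + 1) * pairing (sphFun p q k) (sphFun p q l) := by
  have h1 := pairing_v_mul p q k (continuous_sphFun (p + 1) q (l + 1))
  rw [pairing_sphFun_of_ne (by simp), mul_zero, zero_sub, pairing_mul_left] at h1
  have h2 := pairing_vconj_mul_succ (p + 1) q l (continuous_sphFun p q k)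
  rw [pairing_sphFun_of_ne (by simp), zero_sub] at h2
  have h3 := pairing_uconj_mul (p + 1) q l (continuous_sphFun p q k)
  rw [pairing_sphFun_of_ne (q := q + 1) (by simp), mul_zero, add_zero, Nat.add_sub_cancel] at h3
  have h4 := congrArg (starRingEnd ℂ) h2
  have h5 := congrArg (starRingEnd ℂ) h3
  simp only [map_mul, map_neg, pairing_conj, Complex.conj_natCast] at h4 h5
  rw [h4] at h1
  push_cast at h1 h5 ⊢
  linear_combination (p + q + 2 : ℂ) * h1 + (p + q + 1 : ℂ) * h5

theorem gram_succ_right_zero (p q l : ℕ) :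
    ((p + q + 2 : ℕ) : ℂ) * pairing (sphFun p (q + 1) 0) (sphFun p (q + 1) l) =
      (q + 1) * pairing (sphFun p q 0) (sphFun p q l) := by
  have h1 : pairing (sphFun p (q + 1) 0) (sphFun p (q + 1) l) =
      pairing (sphFun p q 0) (fun x => S3.v x * sphFun p (q + 1) l x) := by
    have := pairing_mul_left (fun x => conj (S3.v x)) (sphFun p q 0) (sphFun p (q + 1) l)
    simpa only [vconj_mul_sphFun_zero, Complex.conj_conj] using this
  have h2 := pairing_v_mul p (q + 1) l (continuous_sphFun p q 0)
  rw [pairing_sphFun_of_ne (p := p + 1) (by simp), mul_zero, sub_zero, Nat.add_sub_cancel] at h2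
  have h3 := congrArg (starRingEnd ℂ) h2
  simp only [map_mul, pairing_conj, Complex.conj_natCast] at h3
  rw [h1]
  push_cast at h3 ⊢
  linear_combination h3

theorem gram_succ_right_succ (p q k l : ℕ) :
    ((p + q + 2 : ℕ) : ℂ) * (k + 1) *
        pairing (sphFun p (q + 1) (k + 1)) (sphFun p (q + 1) (l + 1)) =
      ((p + q + 1 : ℕ) : ℂ) * (q + 1) * pairing (sphFun p q k) (sphFun p q l) := by
  have h1 := pairing_uconj_mul p q k (continuous_sphFun p (q + 1) (l + 1))
  rw [pairing_sphFun_of_ne (by simp), mul_zero, zero_add, pairing_mul_left] at h1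
  simp only [Complex.conj_conj] at h1
  have h2 := pairing_u_mul_succ p (q + 1) l (continuous_sphFun p q k)
  rw [pairing_sphFun_of_ne (by simp), zero_add] at h2
  have h3 := pairing_v_mul p (q + 1) l (continuous_sphFun p q k)
  rw [pairing_sphFun_of_ne (p := p + 1) (by simp), mul_zero, sub_zero, Nat.add_sub_cancel] at h3
  have h4 := congrArg (starRingEnd ℂ) h2
  have h5 := congrArg (starRingEnd ℂ) h3
  simp only [map_mul, pairing_conj, Complex.conj_natCast] at h4 h5
  rw [h4] at h1
  push_cast at h1 h5 ⊢
  linear_combination (-(p + q + 2 : ℂ)) * h1 + (p + q + 1 : ℂ) * h5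

/-- The squared `L²` norm of the spherical functions. -/
noncomputable def sphNorm (p q k : ℕ) : ℝ :=
  (p.factorial * q.factorial : ℝ) / (p + q + 1).factorial * (p + q).choose k

theorem sphNorm_pos {p q k : ℕ} (hk : k ≤ p + q) : 0 < sphNorm p q k := by
  have := Nat.choose_pos hk
  unfold sphNorm
  positivity

theorem sphNorm_succ_left_zero (p q : ℕ) :
    ((p + q + 2 : ℕ) : ℝ) * sphNorm (p + 1) q 0 = (p + 1) * sphNorm p q 0 := by
  simp only [sphNorm, Nat.choose_zero_right, show p + 1 + q + 1 = (p + q + 1) + 1 by ring,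
    Nat.factorial_succ]
  push_cast
  field_simp
  ring

theorem sphNorm_succ_left_succ (p q k : ℕ) :
    ((p + q + 2 : ℕ) : ℝ) * (k + 1) * sphNorm (p + 1) q (k + 1) =
      ((p + q + 1 : ℕ) : ℝ) * (p + 1) * sphNorm p q k := by
  have h : ((p + q + 1).choose (k + 1) : ℝ) * (k + 1) = (p + q + 1) * (p + q).choose k := by
    exact_mod_cast (Nat.add_one_mul_choose_eq (p + q) k).symm
  simp only [sphNorm, show p + 1 + q = p + q + 1 by ring, Nat.factorial_succ (p + q + 1), Nat.factorial_succ p]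
  have h1 : ((p + q + 1).factorial : ℝ) ≠ 0 := by positivity
  push_cast
  field_simp
  linear_combination ((p : ℝ) + q + 2) * h

theorem sphNorm_symm (p q k : ℕ) : sphNorm p q k = sphNorm q p k := by
  simp only [sphNorm, add_comm q p, mul_comm (q.factorial : ℝ)]

theorem sphNorm_middle (p q : ℕ) : sphNorm p q q = 1 / (p + q + 1) := by
  have h : ((p + q).choose q * q.factorial * p.factorial : ℝ) = (p + q).factorial := by
    have := Nat.choose_mul_factorial_mul_factorial (Nat.le_add_left q p)
    rw [Nat.add_sub_cancel] at this
    exact_mod_cast this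
  have h1 : ((p + q).factorial : ℝ) ≠ 0 := by positivity
  simp only [sphNorm, Nat.factorial_succ]
  push_cast
  field_simp
  linear_combination h

theorem sphNorm_middle_succ (p q : ℕ) : (q + 1) * sphNorm p q (q + 1) = p / (p + q + 1) := by
  have h : ((p + q).choose (q + 1) : ℝ) * (q + 1) = (p + q).choose q * p := by
    have := Nat.choose_succ_right_eq (p + q) q
    rw [Nat.add_sub_cancel] at this
    exact_mod_cast this
  have h2 := sphNorm_middle p q
  simp only [sphNorm] at h2 ⊢
  have h3 : (p : ℝ) / (p + q + 1) = p * (1 / (p + q + 1)) := by ring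
  rw [h3, ← h2]
  linear_combination ((p.factorial * q.factorial : ℝ) / (p + q + 1).factorial) * h

/-- The recurrences determine the Gram matrix by induction on the bidegree, and the closed form of
`sphNorm` satisfies the same ones. Row 0 is the separate fact `z`; column 0 follows by conjugate
symmetry. -/
theorem gram (p q k l : ℕ) :
    pairing (sphFun p q k) (sphFun p q l) = if k = l then (sphNorm p q k : ℂ) else 0 := by
  have hN (n : ℕ) : ((n + 1 : ℕ) : ℂ) ≠ 0 := by exact_mod_cast n.succ_ne_zero
  induction p generalizing k l with
  | zero =>
    induction q generalizing k l with
    | zero =>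
      have h0 : sphFun 0 0 0 = fun _ => 1 := by ext x; simp [sphFun, genPoly]
      have h1 (k : ℕ) : sphFun 0 0 (k + 1) = fun _ => 0 :=
        funext fun x => sphFun_eq_zero (by omega) x
      rcases k with - | k <;> rcases l with - | l
      · simp [h0, pairing, sphNorm]
      · simp [h1, pairing]
      · simp [h1, pairing]
      · simp [h1, pairing, sphNorm]
    | succ q ih =>
      have z (l : ℕ) : pairing (sphFun 0 (q + 1) 0) (sphFun 0 (q + 1) l) =
          if 0 = l then (sphNorm 0 (q + 1) 0 : ℂ) else 0 := by
        refine mul_left_cancel₀ (hN (0 + q + 1)) ((gram_succ_right_zero 0 q l).trans ?_)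
        rw [ih]
        split_ifs with h
        · have := sphNorm_succ_left_zero q 0
          rw [sphNorm_symm (q + 1), sphNorm_symm q, add_comm q 0] at this
          exact_mod_cast this.symm
        · simp
      rcases k with - | k
      · exact z l
      rcases l with - | l
      · rw [← pairing_conj, z]
        simp
      · refine mul_left_cancel₀ (mul_ne_zero (hN (0 + q + 1)) (by exact_mod_cast hN k))
          ((gram_succ_right_succ 0 q k l).trans ?_)
        rw [ih]
        simp only [Nat.add_right_cancel_iff]
        split_ifs with h
        · have := sphNorm_succ_left_succ q 0 k
          rw [sphNorm_symm (q + 1), sphNorm_symm q, add_comm q 0] at this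
          exact_mod_cast this.symm
        · simp
  | succ p ih =>
    have z (l : ℕ) : pairing (sphFun (p + 1) q 0) (sphFun (p + 1) q l) =
        if 0 = l then (sphNorm (p + 1) q 0 : ℂ) else 0 := by
      refine mul_left_cancel₀ (hN (p + q + 1)) ((gram_succ_left_zero p q l).trans ?_)
      rw [ih]
      split_ifs with h
      · have := sphNorm_succ_left_zero p q
        exact_mod_cast this.symm
      · simp
    rcases k with - | k
    · exact z l
    rcases l with - | l
    · rw [← pairing_conj, z]
      simp
    · refine mul_left_cancel₀ (mul_ne_zero (hN (p + q + 1)) (by exact_mod_cast hN k))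
        ((gram_succ_left_succ p q k l).trans ?_)
      rw [ih]
      simp only [Nat.add_right_cancel_iff]
      split_ifs with h
      · have := sphNorm_succ_left_succ p q k
        exact_mod_cast this.symm
      · simp

/-! ### The reproducing kernels -/

/-- The reproducing kernel of the space of spherical functions of bidegree `(p, q)`. -/
noncomputable def repKernel (p q : ℕ) (x y : S3) : ℂ :=
  ∑ k ∈ Finset.range (p + q + 1), sphFun p q k x * conj (sphFun p q k y) / sphNorm p q k

theorem repKernel_conj (p q : ℕ) (x y : S3) :
    conj (repKernel p q x y) = repKernel p q y x := by
  simp only [repKernel, map_sum, map_div₀, map_mul, Complex.conj_conj, Complex.conj_ofReal,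
    mul_comm]

theorem pairing_sum_sphFun (p q l : ℕ) (hl : l ∈ Finset.range (p + q + 1)) (c : ℕ → ℂ) :
    pairing (fun x => ∑ k ∈ Finset.range (p + q + 1), c k * sphFun p q k x) (sphFun p q l) =
      c l * sphNorm p q l := by
  rw [pairing_sum _ (fun k _ => continuous_sphFun p q k) (continuous_sphFun p q l)]
  simp only [gram]
  rw [Finset.sum_eq_single l (fun k _ hk => by simp [hk]) (fun h => (h hl).elim)]
  simp

/-- Expand the translated zonal function with coefficients b. By left invariance its pairing with
the k-th function equals the pairing of the zonal function with the k-th function translated by x.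
Only the coefficient d q of that translate contributes, and evaluation at the identity shows d q =
`sphFun p q k x`. -/
theorem repKernel_eq (p q : ℕ) (x y : S3) :
    repKernel p q y x = (p + q + 1) * sphFun p q q (x⁻¹ * y) := by
  have hq : q ∈ Finset.range (p + q + 1) := by simp
  obtain ⟨b, hb⟩ := exists_sphFun_mul_left p q q x⁻¹
  rw [hb, repKernel, Finset.mul_sum]
  refine Finset.sum_congr rfl fun k hk => ?_
  have hpos : (sphNorm p q k : ℂ) ≠ 0 := by
    exact_mod_cast (sphNorm_pos (Nat.lt_succ_iff.1 (Finset.mem_range.1 hk))).ne'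
  have h1 := pairing_sum_sphFun p q k hk b
  simp only [← hb] at h1
  obtain ⟨d, hd⟩ := exists_sphFun_mul_left p q k x
  have h2 : pairing (fun y => sphFun p q q (x⁻¹ * y)) (sphFun p q k) =
      pairing (sphFun p q q) (fun y => sphFun p q k (x * y)) := by
    simp only [pairing]
    rw [← integral_mul_left_eq_self _ x]
    simp only [inv_mul_cancel_left]
  have h3 := pairing_sum_sphFun p q q hq d
  simp only [← hd] at h3
  have h4 := congrArg (starRingEnd ℂ) h3
  rw [pairing_conj, ← h2, h1] at h4
  have h5 : d q = sphFun p q k x := by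
    have := hd 1
    simp only [mul_one, sphFun_one] at this
    rw [this, Finset.sum_eq_single q (fun l _ hl => by simp [hl]) (fun h => (h hq).elim)]
    simp
  rw [h5, sphNorm_middle, map_mul, Complex.conj_ofReal] at h4
  have hne : ((p : ℂ) + q + 1) ≠ 0 := by exact_mod_cast (p + q).succ_ne_zero
  push_cast at h4
  field_simp at h4 ⊢
  linear_combination (-(sphFun p q k y)) * h4

theorem integral_norm_repKernel (p q : ℕ) (x : S3) :
    ∫ y, ‖repKernel p q x y‖ ∂haarProb S3 =
      (p + q + 1) * ∫ y, ‖sphFun p q q y‖ ∂haarProb S3 := by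
  have h : ∀ y, ‖repKernel p q x y‖ = (p + q + 1) * ‖sphFun p q q (x⁻¹ * y)‖ := fun y => by
    rw [← repKernel_conj, RCLike.norm_conj, repKernel_eq, norm_mul]
    congr 1
    have : ((p : ℂ) + q + 1) = ((p + q + 1 : ℕ) : ℂ) := by push_cast; ring
    rw [this, Complex.norm_natCast]
    push_cast; ring
  simp only [h, integral_const_mul]
  rw [integral_mul_left_eq_self (fun y => ‖sphFun p q q y‖)]

/-! ### The `L¹` norm of the zonal spherical functions -/

theorem integral_sq_norm_sphFun (p q k : ℕ) :
    ∫ x, ‖sphFun p q k x‖ ^ 2 ∂haarProb S3 = sphNorm p q k := by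
  have h := pairing_self (sphFun p q k)
  rw [gram, if_pos rfl] at h
  exact_mod_cast h.symm

/-- u^n is the spherical function of bidegree (n, 0) and index 0, so its norm is already known. -/
theorem integral_norm_u_pow (n : ℕ) : ∫ x, (‖S3.u x‖ ^ 2) ^ n ∂haarProb S3 = 1 / (n + 1) := by
  have h : ∀ x, sphFun n 0 0 x = S3.u x ^ n := fun x => by
    simp [sphFun, genPoly, polyA, Polynomial.coeff_zero_eq_eval_zero]
  have h1 := integral_sq_norm_sphFun n 0 0
  simp only [h, norm_pow] at h1
  rw [sphNorm_middle] at h1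
  simp only [← pow_mul, mul_comm n 2] at h1 ⊢
  simpa using h1

/-- v times the zonal function has components only in the orthogonal bidegrees (p, q - 1) and (p +
1, q), so the Gram matrix gives its norm exactly. This measures how the zonal function concentrates
on the circle v = 0. -/
theorem integral_v_sphFun_sq (p q : ℕ) :
    (p + q + 1) ^ 2 * ∫ x, ‖S3.v x * sphFun p q q x‖ ^ 2 ∂haarProb S3 ≤
      2 * ((p + 1) * (q + 1)) / (p + q + 1) := by
  set g : S3 → ℂ := fun x => S3.v x * sphFun p q q x with hg
  have hgc : Continuous g := S3.continuous_v.mul (continuous_sphFun p q q)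
  have h1 := pairing_v_mul p q q hgc
  have h2 (p' q' k' : ℕ) := pairing_v_mul p q q (continuous_sphFun p' q' k')
  have h3 := h2 p (q - 1) q
  have h4 := h2 (p + 1) q (q + 1)
  rw [gram, if_pos rfl, pairing_sphFun_of_ne (p := p + 1) (by simp), mul_zero, sub_zero] at h3
  rw [gram, if_pos rfl, pairing_sphFun_of_ne (p := p) (by simp), mul_zero, zero_sub] at h4
  have h3' := congrArg (starRingEnd ℂ) h3
  have h4' := congrArg (starRingEnd ℂ) h4
  simp only [map_mul, map_neg, map_add, map_one, pairing_conj, Complex.conj_natCast,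
    Complex.conj_ofReal] at h3' h4'
  rw [pairing_self] at h1
  have key : ((p + q + 1 : ℕ) : ℂ) ^ 2 * ((∫ x, ‖g x‖ ^ 2 ∂haarProb S3 : ℝ) : ℂ) =
      (q : ℂ) * (q * sphNorm p (q - 1) q) +
        (q + 1) * ((q + 1) * sphNorm (p + 1) q (q + 1)) := by
    linear_combination ((p + q + 1 : ℕ) : ℂ) * h1 + (q : ℂ) * h3' - ((q : ℂ) + 1) * h4'
  have key' : ((p : ℝ) + q + 1) ^ 2 * ∫ x, ‖g x‖ ^ 2 ∂haarProb S3 =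
      (q : ℝ) * (q * sphNorm p (q - 1) q) +
        (q + 1) * ((q + 1) * sphNorm (p + 1) q (q + 1)) := by
    push_cast at key
    exact_mod_cast key
  rw [key', sphNorm_middle_succ]
  have e1 : (q : ℝ) * (q * sphNorm p (q - 1) q) ≤ (p + 1) * (q + 1) / (p + q + 1) := by
    rcases q with - | q
    · simp; positivity
    · have := sphNorm_middle_succ p q
      simp only [Nat.add_sub_cancel]
      push_cast
      rw [this, ← mul_div_assoc, div_le_div_iff₀ (by positivity) (by positivity)]
      have hp : (0 : ℝ) ≤ p := by positivity
      have hq : (0 : ℝ) ≤ q := by positivity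
      nlinarith [mul_nonneg hp hq, mul_nonneg hp hp, mul_nonneg hq hq]
  have e2 : ((q : ℝ) + 1) * (((p + 1 : ℕ) : ℝ) / ((p + 1 : ℕ) + q + 1)) ≤
      (p + 1) * (q + 1) / (p + q + 1) := by
    push_cast
    rw [← mul_div_assoc, mul_comm ((p : ℝ) + 1)]
    gcongr
    linarith
  calc _ ≤ _ := add_le_add e1 e2
    _ = _ := by ring

/-- The geometric sum dominates M / (1 + M s), and for s = |v|² it is a polynomial in |u|² with
known integral. The proof uses that s times the sum is 1 - (1-s)^M and that each of the M summands
is at least (1-s)^M. -/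
theorem inv_weight_le {M : ℕ} {s : ℝ} (h0 : 0 ≤ s) (h1 : s ≤ 1) :
    (M : ℝ) ≤ (1 + M * s) * ∑ n ∈ Finset.range M, (1 - s) ^ n := by
  have h2 : s * ∑ n ∈ Finset.range M, (1 - s) ^ n = 1 - (1 - s) ^ M := by
    have := mul_neg_geom_sum (1 - s) M
    rwa [sub_sub_cancel] at this
  have h3 : (M : ℝ) * (1 - s) ^ M ≤ ∑ n ∈ Finset.range M, (1 - s) ^ n := by
    have := Finset.card_nsmul_le_sum (Finset.range M) (fun n => (1 - s) ^ n) ((1 - s) ^ M)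
      (fun n hn => pow_le_pow_of_le_one (by linarith) (by linarith)
        (Finset.mem_range.1 hn).le)
    simpa using this
  linear_combination h3 - (M : ℝ) * h2

/-- Cauchy–Schwarz with W playing the role of 1/w, by integrating a pointwise arithmetic–geometric
mean inequality. The factors b/I and I/b are those that make the integrated inequality sharp. -/
theorem sq_integral_le_of_weight {f w W : S3 → ℝ} (hf : Continuous f) (hw : Continuous w)
    (hW : Continuous W) (hf0 : ∀ x, 0 ≤ f x) (hw0 : ∀ x, 0 < w x) (hwW : ∀ x, 1 ≤ w x * W x) :
    (∫ x, f x ∂haarProb S3) ^ 2 ≤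
      (∫ x, f x ^ 2 * w x ∂haarProb S3) * ∫ x, W x ∂haarProb S3 := by
  have hW0 : ∀ x, 0 < W x := fun x => by
    by_contra h
    nlinarith [hwW x, hw0 x]
  set I := ∫ x, f x ∂haarProb S3
  set a := ∫ x, f x ^ 2 * w x ∂haarProb S3
  set b := ∫ x, W x ∂haarProb S3
  have hI : 0 ≤ I := integral_nonneg hf0
  have hb : 0 < b := by
    obtain ⟨x0, -, hx0⟩ := isCompact_univ.exists_isMinOn (Set.univ_nonempty (α := S3))
      hW.continuousOn
    have : W x0 ≤ b := by
      have := integral_mono (μ := haarProb S3) (integrable_const (W x0))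
        (integrable_of_continuous hW) (fun x => hx0 (Set.mem_univ x))
      simpa using this
    exact lt_of_lt_of_le (hW0 x0) this
  rcases hI.eq_or_lt with h0 | h0
  · rw [← h0]
    have : 0 ≤ a := integral_nonneg fun x => by have := (hw0 x).le; positivity
    rw [zero_pow two_ne_zero]
    exact mul_nonneg this hb.le
  have key : ∀ x, 2 * f x ≤ b / I * (f x ^ 2 * w x) + I / b * W x := fun x => by
    have hz : 0 < b / I * w x := mul_pos (div_pos hb h0) (hw0 x)
    have h1 : 1 / (b / I * w x) ≤ I / b * W x := by
      rw [div_le_iff₀ hz]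
      have : I / b * W x * (b / I * w x) = w x * W x := by field_simp
      rw [this]; exact hwW x
    have h2 : 0 ≤ b / I * w x * f x ^ 2 + 1 / (b / I * w x) - 2 * f x := by
      have : b / I * w x * f x ^ 2 + 1 / (b / I * w x) - 2 * f x =
        (b / I * w x * f x - 1) ^ 2 / (b / I * w x) := by
        have := (hw0 x).ne'
        field_simp
        ring
      rw [this]; positivity
    linarith
  have i1 : Integrable (fun x => f x ^ 2 * w x) (haarProb S3) :=
    integrable_of_continuous ((hf.pow 2).mul hw)
  have h := integral_mono (μ := haarProb S3) ((integrable_of_continuous hf).const_mul 2)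
    ((i1.const_mul (b / I)).add ((integrable_of_continuous hW).const_mul (I / b))) key
  have h' : 2 * I ≤ b / I * a + I / b * b := by
    have e := integral_add (i1.const_mul (b / I)) ((integrable_of_continuous hW).const_mul (I / b))
    simp only [integral_const_mul] at e h
    simp only [Pi.add_apply] at h
    rw [e] at h
    exact h
  rw [div_mul_cancel₀ _ hb.ne'] at h'
  have h2 : I ≤ b / I * a := by linarith
  rw [div_mul_eq_mul_div, le_div_iff₀ h0] at h2
  linarith

/-- The bound for the norm of the spectral projections. -/
noncomputable def kernelBound (p q : ℕ) : ℝ :=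
  3 * ((p + 1) * (q + 1)) / (p + q + 1) * ∑ n ∈ Finset.range (p + q + 1), (1 / ((n : ℝ) + 1))

/-- With N = p + q + 1 and w = 1 + N|v|², the dual weight integrates to H/N, H the harmonic sum.
What remains is 1 + N² ∫ |v f|², where the 1 is absorbed because N ≤ (p+1)(q+1). -/
theorem sq_integral_norm_sphFun_le (p q : ℕ) :
    ((p + q + 1) * ∫ y, ‖sphFun p q q y‖ ∂haarProb S3) ^ 2 ≤ kernelBound p q := by
  have hf : Continuous fun x => ‖sphFun p q q x‖ := (continuous_sphFun p q q).norm
  have hv : Continuous fun x => ‖S3.v x‖ ^ 2 := S3.continuous_v.norm.pow 2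
  have hu : Continuous fun x => ‖S3.u x‖ ^ 2 := S3.continuous_u.norm.pow 2
  have h := sq_integral_le_of_weight (f := fun x => ‖sphFun p q q x‖)
    (w := fun x => 1 + ((p + q + 1 : ℕ) : ℝ) * ‖S3.v x‖ ^ 2)
    (W := fun x => (1 / ((p + q + 1 : ℕ) : ℝ)) *
      ∑ n ∈ Finset.range (p + q + 1), (‖S3.u x‖ ^ 2) ^ n)
    hf (continuous_const.add (continuous_const.mul hv))
    (continuous_const.mul (continuous_finsetSum _ fun n _ => hu.pow n))
    (fun x => norm_nonneg _) (fun x => by positivity) (fun x => by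
      have h1 := S3.normSq_u_v x
      have h2 := inv_weight_le (M := p + q + 1) (s := ‖S3.v x‖ ^ 2) (by positivity)
        (by nlinarith [sq_nonneg ‖S3.u x‖])
      rw [← eq_sub_of_add_eq h1] at h2
      have hM : (0 : ℝ) < ((p + q + 1 : ℕ) : ℝ) := by positivity
      rw [mul_left_comm, one_div, ← div_eq_inv_mul, le_div_iff₀ hM, one_mul]
      exact h2)
  have e1 : ∫ x, 1 / ((p + q + 1 : ℕ) : ℝ) *
      ∑ n ∈ Finset.range (p + q + 1), (‖S3.u x‖ ^ 2) ^ n ∂haarProb S3 =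
      1 / ((p + q + 1 : ℕ) : ℝ) * ∑ n ∈ Finset.range (p + q + 1), (1 / ((n : ℝ) + 1)) := by
    rw [integral_const_mul, integral_finsetSum (f := fun n x => (‖S3.u x‖ ^ 2) ^ n) _
      fun n _ => integrable_of_continuous (hu.pow n)]
    simp only [integral_norm_u_pow]
  have e2 : ∫ x, ‖sphFun p q q x‖ ^ 2 * (1 + ((p + q + 1 : ℕ) : ℝ) * ‖S3.v x‖ ^ 2) ∂haarProb S3 =
      1 / (p + q + 1) + (p + q + 1) * ∫ x, ‖S3.v x * sphFun p q q x‖ ^ 2 ∂haarProb S3 := by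
    rw [← sphNorm_middle, ← integral_sq_norm_sphFun, ← integral_const_mul, ← integral_add]
    · congr 1; ext x; rw [norm_mul]; push_cast; ring
    · exact integrable_of_continuous (hf.pow 2)
    · exact (integrable_of_continuous
        ((S3.continuous_v.mul (continuous_sphFun p q q)).norm.pow 2)).const_mul _
  rw [e1, e2] at h
  have e3 := integral_v_sphFun_sq p q
  set J := ∫ x, ‖S3.v x * sphFun p q q x‖ ^ 2 ∂haarProb S3
  set H := ∑ n ∈ Finset.range (p + q + 1), (1 / ((n : ℝ) + 1)) with hH
  have hH0 : 0 ≤ H := Finset.sum_nonneg fun n _ => by positivity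
  have hN : (0 : ℝ) < p + q + 1 := by positivity
  rw [mul_pow]
  calc ((p : ℝ) + q + 1) ^ 2 * (∫ y, ‖sphFun p q q y‖ ∂haarProb S3) ^ 2
      ≤ (p + q + 1) ^ 2 * ((1 / (p + q + 1) + (p + q + 1) * J) *
          (1 / ((p + q + 1 : ℕ) : ℝ) * H)) := by gcongr
    _ = (1 + (p + q + 1) ^ 2 * J) * H := by push_cast; field_simp
    _ ≤ (3 * ((p + 1) * (q + 1)) / (p + q + 1)) * H := by
        gcongr
        have : (1 : ℝ) ≤ (p + 1) * (q + 1) / (p + q + 1) := by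
          rw [le_div_iff₀ hN]
          nlinarith [mul_nonneg (Nat.cast_nonneg (α := ℝ) p) (Nat.cast_nonneg (α := ℝ) q)]
        calc _ ≤ (p + 1) * (q + 1) / (p + q + 1) + 2 * (((p : ℝ) + 1) * (q + 1)) / (p + q + 1) :=
              add_le_add this e3
          _ = _ := by ring

end SubLap

/-! ### Nuclear sums of finite-rank operators; completeness of the spherical functions -/

namespace SubLap

open ComplexConjugate

/-! ### Auerbach bases and finite rank operators -/

/-- Choose vectors of the unit ball maximising |det|. The coordinate functionals are, by Cramer's
rule, quotients of determinants with one vector replaced, so maximality bounds them by 1 on the unit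
ball. -/
theorem exists_auerbach {V : Type*} [NormedAddCommGroup V] [NormedSpace ℂ V]
    {n : ℕ} (e : Module.Basis (Fin n) ℂ V) : ∃ (b : Fin n → V) (φ : Fin n → V →L[ℂ] ℂ),
      (∀ i, ‖b i‖ ≤ 1) ∧ (∀ i, ‖φ i‖ ≤ 1) ∧ ∀ x, x = ∑ i, φ i x • b i := by
  classical
  have : FiniteDimensional ℂ V := e.finiteDimensional_of_finite
  have : ProperSpace V := FiniteDimensional.proper ℂ V
  have hcont : Continuous fun v : Fin n → V => ‖e.det v‖ := by
    have h : (fun v : Fin n → V => ‖e.det v‖) = fun v => ‖(e.toMatrix v).det‖ :=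
      funext fun v => by rw [Module.Basis.det_apply]
    rw [h]
    refine Continuous.norm ?_
    refine Continuous.matrix_det (continuous_pi fun i => continuous_pi fun j => ?_)
    simp only [Module.Basis.toMatrix_apply]
    exact (LinearMap.continuous_of_finiteDimensional (e.coord i)).comp (continuous_apply j)
  obtain ⟨v, hvK, hmax⟩ := (isCompact_closedBall (0 : Fin n → V) 1).exists_isMaxOn
    (Metric.nonempty_closedBall.2 zero_le_one) hcont.continuousOn
  have hmem (w : Fin n → V) : w ∈ Metric.closedBall (0 : Fin n → V) 1 ↔ ∀ i, ‖w i‖ ≤ 1 := by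
    rw [mem_closedBall_zero_iff, pi_norm_le_iff_of_nonneg zero_le_one]
  have hv := (hmem v).1 hvK
  have hpos : 0 < ‖e.det v‖ := by
    -- The normalised basis is a competitor, so the maximum is positive.
    have h1 : e.det (fun i => ((‖e i‖⁻¹ : ℝ) : ℂ) • e i) ≠ 0 := by
      have h2 := e.det.toMultilinearMap.map_smul_univ (fun i => ((‖e i‖⁻¹ : ℝ) : ℂ)) e
      have h3 : e.det (fun i => ((‖e i‖⁻¹ : ℝ) : ℂ) • e i) =
        (∏ i, ((‖e i‖⁻¹ : ℝ) : ℂ)) • e.det e := h2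
      rw [h3, e.det_self, smul_eq_mul, mul_one, Finset.prod_ne_zero_iff]
      intro i _
      exact_mod_cast inv_ne_zero (norm_ne_zero_iff.2 (e.ne_zero i))
    refine lt_of_lt_of_le (norm_pos_iff.2 h1) (hmax ((hmem _).2 fun i => ?_))
    rw [norm_smul, Complex.norm_real, norm_inv, norm_norm,
      inv_mul_cancel₀ (norm_ne_zero_iff.2 (e.ne_zero i))]
  have hne : e.det v ≠ 0 := norm_pos_iff.1 hpos
  let φ₀ : Fin n → V →ₗ[ℂ] ℂ := fun i => (e.det v)⁻¹ • e.det.toMultilinearMap.toLinearMap v i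
  have hφ₀ (i : Fin n) (x : V) : φ₀ i x = (e.det v)⁻¹ * e.det (Function.update v i x) := rfl
  have hbound (i : Fin n) (x : V) : ‖φ₀ i x‖ ≤ 1 * ‖x‖ := by
    rcases eq_or_ne x 0 with rfl | hx
    · simp
    have hx' : ‖x‖ ≠ 0 := norm_ne_zero_iff.2 hx
    set y : V := ((‖x‖⁻¹ : ℝ) : ℂ) • x with hy
    have hxy : x = ((‖x‖ : ℝ) : ℂ) • y := by
      rw [hy, smul_smul, ← Complex.ofReal_mul, mul_inv_cancel₀ hx', Complex.ofReal_one, one_smul]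
    have hyn : ‖y‖ ≤ 1 := by
      rw [hy, norm_smul, Complex.norm_real, norm_inv, norm_norm, inv_mul_cancel₀ hx']
    have h1 : ‖e.det (Function.update v i y)‖ ≤ ‖e.det v‖ := hmax ((hmem _).2 fun j => by
      rcases eq_or_ne j i with rfl | hj
      · simpa using hyn
      · simpa [hj] using hv j)
    have h2 : ‖φ₀ i y‖ ≤ 1 := by
      rw [hφ₀, norm_mul, norm_inv, inv_mul_le_iff₀ hpos, mul_one]
      exact h1
    have h3 : ‖φ₀ i x‖ = ‖x‖ * ‖φ₀ i y‖ := by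
      conv_lhs => rw [hxy]
      rw [map_smul, norm_smul, Complex.norm_real, norm_norm]
    rw [h3, one_mul]
    exact mul_le_of_le_one_right (norm_nonneg x) h2
  have hbasis := (Module.Basis.is_basis_iff_det e (v := v)).2 (isUnit_iff_ne_zero.2 hne)
  let B : Module.Basis (Fin n) ℂ V := Module.Basis.mk hbasis.1 hbasis.2.ge
  have hdual (i j : Fin n) : φ₀ i (v j) = if i = j then 1 else 0 := by
    rw [hφ₀]
    split_ifs with h
    · subst h
      rw [Function.update_eq_self, inv_mul_cancel₀ hne]
    · have h0 : e.det (Function.update v i (v j)) = 0 :=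
        e.det.map_eq_zero_of_eq _ (by rw [Function.update_self, Function.update_of_ne (Ne.symm h)]) h
      rw [h0, mul_zero]
  have hid : (LinearMap.id : V →ₗ[ℂ] V) = ∑ i, (φ₀ i).smulRight (v i) := by
    refine B.ext fun j => ?_
    simp [B, hdual]
  refine ⟨v, fun i => (φ₀ i).mkContinuous 1 (hbound i), hv,
    fun i => LinearMap.mkContinuous_norm_le _ zero_le_one _, fun x => ?_⟩
  have := LinearMap.congr_fun hid x
  simpa using this

/-- Compose the Auerbach functionals of W with P. There is no dimensional loss per term, and padding
with zeros gives uniform length d. -/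
theorem exists_finite_rank_decomposition {E F : Type*} [NormedAddCommGroup E] [NormedSpace ℂ E]
    [NormedAddCommGroup F] [NormedSpace ℂ F] (P : E →L[ℂ] F) (W : Submodule ℂ F)
    [FiniteDimensional ℂ W] (hW : ∀ x, P x ∈ W) {d : ℕ} (hd : Module.finrank ℂ W ≤ d) :
    ∃ (x' : ℕ → E →L[ℂ] ℂ) (y : ℕ → F), (∀ i, d ≤ i → x' i = 0) ∧ (∀ i, ‖x' i‖ ≤ ‖P‖) ∧
      (∀ i, ‖y i‖ ≤ 1) ∧ ∀ x, P x = ∑ i ∈ Finset.range d, x' i x • y i := by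
  obtain ⟨n, hn, ⟨e⟩⟩ : ∃ n, n ≤ d ∧ Nonempty (Module.Basis (Fin n) ℂ W) :=
    ⟨_, hd, ⟨Module.finBasis ℂ W⟩⟩
  obtain ⟨b, φ, hb, hφ, hx⟩ := exists_auerbach e
  let P' : E →L[ℂ] W := P.codRestrict W hW
  have hP' : ‖P'‖ ≤ ‖P‖ :=
    ContinuousLinearMap.opNorm_le_bound _ (norm_nonneg _) fun x => P.le_opNorm x
  refine ⟨fun i => if h : i < n then (φ ⟨i, h⟩).comp P' else 0,
    fun i => if h : i < n then (b ⟨i, h⟩ : F) else 0, fun i hi => ?_, fun i => ?_, fun i => ?_,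
    fun x => ?_⟩
  · exact dif_neg (by omega)
  · dsimp only
    split_ifs with h
    · calc _ ≤ ‖φ ⟨i, h⟩‖ * ‖P'‖ := ContinuousLinearMap.opNorm_comp_le _ _
        _ ≤ 1 * ‖P‖ := by gcongr; exact hφ _
        _ = ‖P‖ := one_mul _
    · simp
  · dsimp only
    split_ifs with h
    · exact hb _
    · simp
  · have h1 := congrArg (Subtype.val) (hx (P' x))
    have h2 : (P' x : F) = P x := rfl
    rw [h2] at h1
    rw [h1, Submodule.coe_sum, ← Finset.sum_subset (Finset.range_subset_range.2 hn)
      (fun i _ hi => by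
        have : ¬ i < n := by simpa using hi
        simp [this]), Finset.sum_range]
    refine Finset.sum_congr rfl fun i _ => ?_
    simp

/-- All but finitely many terms are below 1, where b ≤ b^r. -/
theorem summable_of_summable_rpow {ι : Type*} {r : ℝ} (hr₀ : 0 < r) (hr₁ : r ≤ 1) {b : ι → ℝ}
    (hb : ∀ i, 0 ≤ b i) (h : Summable fun i => b i ^ r) : Summable b := by
  refine Summable.of_norm_bounded_eventually h ?_
  have h1 := h.tendsto_cofinite_zero.eventually (gt_mem_nhds zero_lt_one)
  filter_upwards [h1] with i hi
  rw [Real.norm_of_nonneg (hb i)]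
  have h2 : b i ≤ 1 := by
    by_contra hc
    exact absurd (Real.one_le_rpow (not_le.1 hc).le hr₀.le) (not_le.2 hi)
  calc b i = b i ^ (1 : ℝ) := (Real.rpow_one _).symm
    _ ≤ b i ^ r := by
      rcases (hb i).eq_or_lt with h0 | h0
      · rw [← h0, Real.zero_rpow one_ne_zero, Real.zero_rpow hr₀.ne']
      · exact Real.rpow_le_rpow_of_exponent_ge h0 h2 hr₁

/-- The i-th operator contributes at most d i · ‖P i‖^r. Because r ≤ 1 the rank-one terms are also
absolutely summable, so T is a norm-convergent sum and may be re-enumerated by ℕ or summed in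
blocks. -/
theorem exists_isRNuclear_hasSum {E : Type*} [NormedAddCommGroup E] [NormedSpace ℂ E]
    [CompleteSpace E] {r : ℝ} (hr₀ : 0 < r) (hr₁ : r ≤ 1) (P : ℕ × ℕ → E →L[ℂ] E)
    (W : ℕ × ℕ → Submodule ℂ E) [∀ i, FiniteDimensional ℂ (W i)] (hW : ∀ i x, P i x ∈ W i)
    {d : ℕ × ℕ → ℕ} (hd : ∀ i, Module.finrank ℂ (W i) ≤ d i)
    (hs : Summable fun i => d i * ‖P i‖ ^ r) :
    ∃ T : E →L[ℂ] E, IsRNuclear r T ∧ ∀ x, HasSum (fun i => P i x) (T x) := by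
  choose x' y hx0 hx hy hP using
    fun i => exists_finite_rank_decomposition (P i) (W i) (hW i) (hd i)
  have hle (i : ℕ × ℕ) (j : ℕ) : ‖x' i j‖ ^ r * ‖y i j‖ ^ r ≤ if j < d i then ‖P i‖ ^ r else 0 := by
    split_ifs with h
    · have h1 : ‖x' i j‖ ^ r ≤ ‖P i‖ ^ r := Real.rpow_le_rpow (norm_nonneg _) (hx i j) hr₀.le
      have h2 : ‖y i j‖ ^ r ≤ 1 := Real.rpow_le_one (norm_nonneg _) (hy i j) hr₀.le
      calc _ ≤ ‖P i‖ ^ r * 1 := by gcongr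
        _ = _ := mul_one _
    · rw [hx0 i j (not_lt.1 h), norm_zero, Real.zero_rpow hr₀.ne', zero_mul]
  have hbd (i : ℕ × ℕ) :
      HasSum (fun j => if j < d i then ‖P i‖ ^ r else 0) (d i * ‖P i‖ ^ r) := by
    have h1 : HasSum (fun j => if j < d i then ‖P i‖ ^ r else 0)
        (∑ j ∈ Finset.range (d i), if j < d i then ‖P i‖ ^ r else 0) :=
      hasSum_sum_of_ne_finset_zero fun j hj => if_neg fun h => hj (Finset.mem_range.2 h)
    rw [Finset.sum_congr rfl (fun j hj => if_pos (Finset.mem_range.1 hj))] at h1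
    simpa using h1
  have hsum : Summable fun z : (ℕ × ℕ) × ℕ => ‖x' z.1 z.2‖ ^ r * ‖y z.1 z.2‖ ^ r := by
    have h1 : Summable fun z : (ℕ × ℕ) × ℕ => if z.2 < d z.1 then ‖P z.1‖ ^ r else 0 := by
      have h0 : 0 ≤ fun z : (ℕ × ℕ) × ℕ => if z.2 < d z.1 then ‖P z.1‖ ^ r else 0 := by
        intro z
        dsimp only [Pi.zero_apply]
        split_ifs
        · exact Real.rpow_nonneg (norm_nonneg _) _
        · exact le_rfl
      rw [summable_prod_of_nonneg h0]
      refine ⟨fun i => (hbd i).summable, ?_⟩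
      have h2 : (fun i => ∑' j, if j < d i then ‖P i‖ ^ r else 0) = fun i => d i * ‖P i‖ ^ r :=
        funext fun i => (hbd i).tsum_eq
      dsimp only
      rw [h2]
      exact hs
    exact Summable.of_nonneg_of_le
      (fun z => mul_nonneg (Real.rpow_nonneg (norm_nonneg _) _) (Real.rpow_nonneg (norm_nonneg _) _))
      (fun z => hle z.1 z.2) h1
  have hsum' : Summable fun z : (ℕ × ℕ) × ℕ => ‖x' z.1 z.2‖ * ‖y z.1 z.2‖ := by
    refine summable_of_summable_rpow hr₀ hr₁ (fun z => by positivity) ?_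
    simpa only [Real.mul_rpow (norm_nonneg _) (norm_nonneg _)] using hsum
  obtain ⟨T, hop⟩ : Summable fun z : (ℕ × ℕ) × ℕ => (x' z.1 z.2).smulRight (y z.1 z.2) := by
    refine Summable.of_norm ?_
    simpa only [ContinuousLinearMap.norm_smulRight_apply] using hsum'
  have hT (x : E) : HasSum (fun z : (ℕ × ℕ) × ℕ => x' z.1 z.2 x • y z.1 z.2) (T x) := by
    have := hop.mapL (ContinuousLinearMap.apply ℂ E x)
    simpa using this
  obtain ⟨e⟩ : Nonempty (ℕ ≃ (ℕ × ℕ) × ℕ) := ⟨(Denumerable.eqv ((ℕ × ℕ) × ℕ)).symm⟩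
  have n1 : Summable fun n => ‖x' (e n).1 (e n).2‖ ^ r * ‖y (e n).1 (e n).2‖ ^ r :=
    hsum.comp_injective e.injective
  have n2 (x : E) : HasSum (fun n => x' (e n).1 (e n).2 x • y (e n).1 (e n).2) (T x) := by
    have := hT x
    rw [← e.hasSum_iff] at this
    exact this
  refine ⟨T, ⟨fun n => x' (e n).1 (e n).2, fun n => y (e n).1 (e n).2, n1, n2⟩, fun x => ?_⟩
  refine HasSum.prod_fiberwise (f := fun z : (ℕ × ℕ) × ℕ => x' z.1 z.2 x • y z.1 z.2) (hT x)
    fun i => ?_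
  rw [hP i x]
  refine hasSum_sum_of_ne_finset_zero fun j hj => ?_
  rw [Finset.mem_range, not_lt] at hj
  simp [hx0 i j hj]

/-! ### Density of the spherical functions -/

/-- The spherical functions as continuous functions. -/
noncomputable def sphC (p q k : ℕ) : C(S3, ℂ) := ⟨sphFun p q k, continuous_sphFun p q k⟩

/-- The span of the spherical functions. -/
noncomputable def sphSpan : Submodule ℂ C(S3, ℂ) :=
  Submodule.span ℂ (Set.range fun z : ℕ × ℕ × ℕ => sphC z.1 z.2.1 z.2.2)

theorem sphC_mem (p q k : ℕ) : sphC p q k ∈ sphSpan := Submodule.subset_span ⟨(p, q, k), rfl⟩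

theorem mul_mem_sphSpan {a : C(S3, ℂ)} (h : ∀ p q k, a * sphC p q k ∈ sphSpan) {s : C(S3, ℂ)}
    (hs : s ∈ sphSpan) : a * s ∈ sphSpan := by
  induction hs using Submodule.span_induction with
  | mem x hx => obtain ⟨z, rfl⟩ := hx; exact h _ _ _
  | zero => rw [mul_zero]; exact sphSpan.zero_mem
  | add x y _ _ hx hy => rw [mul_add]; exact sphSpan.add_mem hx hy
  | smul c x _ hx =>
    have h1 : a * (c • x) = c • (a * x) := ContinuousMap.ext fun y => mul_left_comm _ _ _
    rw [h1]
    exact sphSpan.smul_mem c hx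

/-- The coordinate `u` as a continuous function. -/
def uC : C(S3, ℂ) := ⟨S3.u, S3.continuous_u⟩

/-- The coordinate `v` as a continuous function. -/
def vC : C(S3, ℂ) := ⟨S3.v, S3.continuous_v⟩

theorem vC_mul_mem (p q k : ℕ) : vC * sphC p q k ∈ sphSpan := by
  have h : vC * sphC p q k = ((p + q + 1 : ℕ) : ℂ)⁻¹ • ((q : ℂ) • sphC p (q - 1) k -
      ((k : ℂ) + 1) • sphC (p + 1) q (k + 1)) := by
    ext x
    have hN : ((p + q + 1 : ℕ) : ℂ) ≠ 0 := by exact_mod_cast (p + q).succ_ne_zero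
    have := v_mul_sphFun p q k x
    change S3.v x * sphFun p q k x = ((p + q + 1 : ℕ) : ℂ)⁻¹ *
      (q * sphFun p (q - 1) k x - (k + 1) * sphFun (p + 1) q (k + 1) x)
    rw [← this, inv_mul_cancel_left₀ hN]
  rw [h]
  exact sphSpan.smul_mem _ (sphSpan.sub_mem (sphSpan.smul_mem _ (sphC_mem _ _ _))
    (sphSpan.smul_mem _ (sphC_mem _ _ _)))

theorem star_uC_mul_mem (p q k : ℕ) : star uC * sphC p q k ∈ sphSpan := by
  have h : star uC * sphC p q k = ((p + q + 1 : ℕ) : ℂ)⁻¹ • ((p : ℂ) • sphC (p - 1) q k +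
      ((k : ℂ) + 1) • sphC p (q + 1) (k + 1)) := by
    ext x
    have hN : ((p + q + 1 : ℕ) : ℂ) ≠ 0 := by exact_mod_cast (p + q).succ_ne_zero
    have := uconj_mul_sphFun p q k x
    change conj (S3.u x) * sphFun p q k x = ((p + q + 1 : ℕ) : ℂ)⁻¹ *
      (p * sphFun (p - 1) q k x + (k + 1) * sphFun p (q + 1) (k + 1) x)
    rw [← this, inv_mul_cancel_left₀ hN]
  rw [h]
  exact sphSpan.smul_mem _ (sphSpan.add_mem (sphSpan.smul_mem _ (sphC_mem _ _ _))
    (sphSpan.smul_mem _ (sphC_mem _ _ _)))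

theorem uC_mul_mem (p q k : ℕ) : uC * sphC p q k ∈ sphSpan := by
  rcases k with - | k
  · have h : uC * sphC p q 0 = sphC (p + 1) q 0 := ContinuousMap.ext fun x =>
      u_mul_sphFun_zero p q x
    rw [h]
    exact sphC_mem _ _ _
  · have h : uC * sphC p q (k + 1) = sphC (p + 1) q (k + 1) + vC * sphC p q k :=
      ContinuousMap.ext fun x => u_mul_sphFun_succ p q k x
    rw [h]
    exact sphSpan.add_mem (sphC_mem _ _ _) (vC_mul_mem _ _ _)

theorem star_vC_mul_mem (p q k : ℕ) : star vC * sphC p q k ∈ sphSpan := by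
  rcases k with - | k
  · have h : star vC * sphC p q 0 = sphC p (q + 1) 0 := ContinuousMap.ext fun x =>
      vconj_mul_sphFun_zero p q x
    rw [h]
    exact sphC_mem _ _ _
  · have h : star vC * sphC p q (k + 1) = sphC p (q + 1) (k + 1) - star uC * sphC p q k :=
      ContinuousMap.ext fun x => vconj_mul_sphFun_succ p q k x
    rw [h]
    exact sphSpan.sub_mem (sphC_mem _ _ _) (star_uC_mul_mem _ _ _)

theorem one_mem_sphSpan : (1 : C(S3, ℂ)) ∈ sphSpan := by
  have h : (1 : C(S3, ℂ)) = sphC 0 0 0 := by ext x; simp [sphC, sphFun, genPoly]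
  rw [h]
  exact sphC_mem _ _ _

/-- The recurrences make the span stable under multiplication by u, v and their conjugates.
Containing 1, it contains the star algebra generated by u and v, to which Stone–Weierstrass applies.
-/
theorem sphSpan_topologicalClosure : sphSpan.topologicalClosure = ⊤ := by
  have h1 := ContinuousMap.starSubalgebra_topologicalClosure_eq_top_of_separatesPoints
    (StarAlgebra.adjoin ℂ ({uC, vC} : Set C(S3, ℂ))) (fun x y hxy => by
      by_contra hc
      push Not at hc
      refine hxy (S3.ext_u_v ?_ ?_)
      · exact hc _ ⟨uC, StarAlgebra.subset_adjoin ℂ _ (by simp), rfl⟩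
      · exact hc _ ⟨vC, StarAlgebra.subset_adjoin ℂ _ (by simp), rfl⟩)
  have h2 : ∀ a ∈ StarAlgebra.adjoin ℂ ({uC, vC} : Set C(S3, ℂ)), ∀ s ∈ sphSpan,
      a * s ∈ sphSpan := by
    intro a ha
    rw [← StarSubalgebra.mem_toSubalgebra, StarAlgebra.adjoin_toSubalgebra] at ha
    induction ha using Algebra.adjoin_induction with
    | mem x hx =>
      refine fun s hs => mul_mem_sphSpan ?_ hs
      simp only [Set.mem_union, Set.mem_star, Set.mem_insert_iff, Set.mem_singleton_iff] at hx
      rcases hx with (rfl | rfl) | (hx | hx)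
      · exact uC_mul_mem
      · exact vC_mul_mem
      · rw [← star_star x, hx]; exact star_uC_mul_mem
      · rw [← star_star x, hx]; exact star_vC_mul_mem
    | algebraMap c =>
      intro s hs
      rw [← Algebra.smul_def]
      exact sphSpan.smul_mem c hs
    | add x y _ _ hx hy =>
      intro s hs
      rw [add_mul]
      exact sphSpan.add_mem (hx s hs) (hy s hs)
    | mul x y _ _ hx hy =>
      intro s hs
      rw [mul_assoc]
      exact hx _ (hy s hs)
  rw [eq_top_iff]
  intro f _
  have h3 : f ∈ (StarAlgebra.adjoin ℂ ({uC, vC} : Set C(S3, ℂ))).topologicalClosure := by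
    rw [h1]; trivial
  refine closure_mono (fun a ha => ?_) h3
  have := h2 a ha 1 one_mem_sphSpan
  rwa [mul_one] at this

/-- Pairing with ψ is a continuous functional vanishing on a dense span, hence on ψ itself. -/
theorem eq_zero_of_pairing_sphFun {ψ : S3 → ℂ} (hψ : Continuous ψ)
    (h : ∀ p q k, k ≤ p + q → pairing ψ (sphFun p q k) = 0) : ψ = 0 := by
  have hint (g : C(S3, ℂ)) : Integrable (fun x => g x * conj (ψ x)) (haarProb S3) :=
    integrable_of_continuous (g.continuous.mul (Complex.continuous_conj.comp hψ))
  obtain ⟨C, hC⟩ := IsCompact.exists_bound_of_continuousOn (isCompact_univ (X := S3))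
    hψ.continuousOn
  let L : C(S3, ℂ) →ₗ[ℂ] ℂ :=
    { toFun := fun g => pairing g ψ
      map_add' := fun g g' => by
        simp only [pairing, ContinuousMap.add_apply, add_mul]
        exact integral_add (hint g) (hint g')
      map_smul' := fun c g => pairing_const_mul c g ψ }
  have hL : Continuous L := by
    refine (L.mkContinuous C fun g => ?_).continuous
    refine (norm_integral_le_of_norm_le_const (C := ‖g‖ * C)
      (Filter.Eventually.of_forall fun x => ?_)).trans_eq ?_
    · rw [norm_mul, RCLike.norm_conj]
      gcongr
      · exact g.norm_coe_le_norm x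
      · exact hC x trivial
    · simp [mul_comm]
  have h0 : ∀ g : C(S3, ℂ), L g = 0 := by
    have hz : sphSpan ≤ LinearMap.ker L := by
      rw [sphSpan, Submodule.span_le]
      rintro _ ⟨⟨p, q, k⟩, rfl⟩
      change pairing (sphFun p q k) ψ = 0
      rcases le_or_gt k (p + q) with hk | hk
      · rw [← pairing_conj, h p q k hk, map_zero]
      · rw [show sphFun p q k = fun _ => 0 from funext (sphFun_eq_zero hk)]
        simp [pairing]
    have hcl : IsClosed (LinearMap.ker L : Set C(S3, ℂ)) := isClosed_singleton.preimage hL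
    have := Submodule.topologicalClosure_minimal _ hz hcl
    rw [sphSpan_topologicalClosure] at this
    exact fun g => this trivial
  have h1 : pairing ψ ψ = 0 := h0 ⟨ψ, hψ⟩
  rw [pairing_self, Complex.ofReal_eq_zero,
    integral_eq_zero_iff_of_nonneg (fun x => by positivity)
      (integrable_of_continuous (f := fun x => ‖ψ x‖ ^ 2) (hψ.norm.pow 2))] at h1
  have h2 := Continuous.ae_eq_iff_eq (haarProb S3) (hψ.norm.pow 2) continuous_const |>.1 h1
  ext x
  have h3 : ‖ψ x‖ ^ 2 = 0 := congrFun h2 x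
  exact norm_eq_zero.1 (pow_eq_zero_iff two_ne_zero |>.1 h3)

end SubLap

/-! ### Norms of the projections on L^p and the power on the sphere -/

namespace SubLap

open ComplexConjugate

/-! ### Integral operators on `L^p` -/

/-- Schur's test: write |K| = |K|^(1-1/P) |K|^(1/P), apply Hölder in y using the row bound, then
Tonelli using the column bound. -/
theorem eLpNorm_integral_kernel_le {X : Type*} [TopologicalSpace X] [MeasurableSpace X]
    [OpensMeasurableSpace X] [SecondCountableTopology X] {μ : Measure X} [IsFiniteMeasure μ]
    {K : X → X → ℂ} (hK : Continuous (Function.uncurry K)) {M : ℝ≥0∞}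
    (h1 : ∀ x, ∫⁻ y, ‖K x y‖ₑ ∂μ ≤ M) (h2 : ∀ y, ∫⁻ x, ‖K x y‖ₑ ∂μ ≤ M) {p : ℝ≥0∞} (hp1 : 1 ≤ p)
    (hp : p ≠ ⊤) {f : X → ℂ} (hf : AEStronglyMeasurable f μ) :
    eLpNorm (fun x => ∫ y, K x y * f y ∂μ) p μ ≤ M * eLpNorm f p μ := by
  have hp0 : p ≠ 0 := (zero_lt_one.trans_le hp1).ne'
  have hP1 : 1 ≤ p.toReal := by
    have := ENNReal.toReal_mono hp hp1
    simpa using this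
  rw [eLpNorm_eq_lintegral_rpow_enorm_toReal hp0 hp, eLpNorm_eq_lintegral_rpow_enorm_toReal hp0 hp]
  set P := p.toReal with hP
  have hPpos : 0 < P := by linarith
  have hP' : 0 ≤ 1 - 1 / P := by
    rw [sub_nonneg, div_le_iff₀ hPpos]; linarith
  have hinv : 0 ≤ 1 / P := by positivity
  have hKm (x : X) : Measurable fun y => ‖K x y‖ₑ :=
    (hK.comp (Continuous.prodMk_right x)).enorm.measurable
  have hKm' (y : X) : Measurable fun x => ‖K x y‖ₑ :=
    (hK.comp (Continuous.prodMk_left y)).enorm.measurable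
  have hpt (x : X) : ‖∫ y, K x y * f y ∂μ‖ₑ ^ P ≤
      M ^ (P - 1) * ∫⁻ y, ‖K x y‖ₑ * ‖f y‖ₑ ^ P ∂μ := by
    have e1 : ‖∫ y, K x y * f y ∂μ‖ₑ ≤ ∫⁻ y, ‖K x y‖ₑ * ‖f y‖ₑ ∂μ := by
      refine (enorm_integral_le_lintegral_enorm _).trans_eq ?_
      simp only [enorm_mul]
    have e2 : ∫⁻ y, ‖K x y‖ₑ * ‖f y‖ₑ ∂μ ≤
        (∫⁻ y, ‖K x y‖ₑ ∂μ) ^ (1 - 1 / P) * (∫⁻ y, ‖K x y‖ₑ * ‖f y‖ₑ ^ P ∂μ) ^ (1 / P) := by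
      have := ENNReal.lintegral_mul_norm_pow_le (μ := μ) (f := fun y => ‖K x y‖ₑ)
        (g := fun y => ‖K x y‖ₑ * ‖f y‖ₑ ^ P) (hKm x).aemeasurable
        ((hKm x).aemeasurable.mul (hf.enorm.pow_const P)) hP' hinv (by ring)
      refine le_trans (le_of_eq ?_) this
      congr 1; ext y
      rw [ENNReal.mul_rpow_of_nonneg _ _ hinv, ← mul_assoc, ← ENNReal.rpow_add_of_nonneg _ _ hP' hinv,
        ← ENNReal.rpow_mul]
      rw [sub_add_cancel, ENNReal.rpow_one, mul_one_div_cancel hPpos.ne', ENNReal.rpow_one]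
    calc ‖∫ y, K x y * f y ∂μ‖ₑ ^ P
        ≤ (M ^ (1 - 1 / P) * (∫⁻ y, ‖K x y‖ₑ * ‖f y‖ₑ ^ P ∂μ) ^ (1 / P)) ^ P := by
          gcongr
          refine e1.trans (e2.trans ?_)
          gcongr
          exact h1 x
      _ = _ := by
          rw [ENNReal.mul_rpow_of_nonneg _ _ hPpos.le, ← ENNReal.rpow_mul, ← ENNReal.rpow_mul,
            one_div_mul_cancel hPpos.ne', ENNReal.rpow_one]
          congr 2
          field_simp
  have hKprod : AEMeasurable (Function.uncurry fun x y => ‖K x y‖ₑ * ‖f y‖ₑ ^ P) (μ.prod μ) := by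
    refine AEMeasurable.mul ?_ ?_
    · exact hK.enorm.measurable.aemeasurable
    · exact (hf.enorm.pow_const P).comp_quasiMeasurePreserving Measure.quasiMeasurePreserving_snd
  have key : ∫⁻ x, ‖∫ y, K x y * f y ∂μ‖ₑ ^ P ∂μ ≤ M ^ P * ∫⁻ y, ‖f y‖ₑ ^ P ∂μ := by
    calc ∫⁻ x, ‖∫ y, K x y * f y ∂μ‖ₑ ^ P ∂μ
        ≤ ∫⁻ x, M ^ (P - 1) * ∫⁻ y, ‖K x y‖ₑ * ‖f y‖ₑ ^ P ∂μ ∂μ := lintegral_mono hpt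
      _ = M ^ (P - 1) * ∫⁻ x, ∫⁻ y, ‖K x y‖ₑ * ‖f y‖ₑ ^ P ∂μ ∂μ :=
          lintegral_const_mul'' _ hKprod.lintegral_prod_right'
      _ = M ^ (P - 1) * ∫⁻ y, ∫⁻ x, ‖K x y‖ₑ * ‖f y‖ₑ ^ P ∂μ ∂μ := by
          rw [lintegral_lintegral_swap hKprod]
      _ ≤ M ^ (P - 1) * ∫⁻ y, M * ‖f y‖ₑ ^ P ∂μ := by
          gcongr with y
          rw [lintegral_mul_const _ (hKm' y)]
          gcongr
          exact h2 y
      _ = M ^ P * ∫⁻ y, ‖f y‖ₑ ^ P ∂μ := by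
          rw [lintegral_const_mul'' _ (hf.enorm.pow_const P), ← mul_assoc]
          congr 1
          conv_lhs => rw [← ENNReal.rpow_one M, ← ENNReal.rpow_mul, one_mul]
          rw [← ENNReal.rpow_add_of_nonneg _ _ (by linarith) zero_le_one, sub_add_cancel]
  calc (∫⁻ x, ‖∫ y, K x y * f y ∂μ‖ₑ ^ P ∂μ) ^ (1 / P)
      ≤ (M ^ P * ∫⁻ y, ‖f y‖ₑ ^ P ∂μ) ^ (1 / P) := by gcongr
    _ = M * (∫⁻ y, ‖f y‖ₑ ^ P ∂μ) ^ (1 / P) := by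
        rw [ENNReal.mul_rpow_of_nonneg _ _ hinv, ← ENNReal.rpow_mul,
          mul_one_div_cancel hPpos.ne', ENNReal.rpow_one]

/-! ### The spectral projections on `L^p(𝕊³)` -/

section Projections

variable (p : ℝ≥0∞) [Fact (1 ≤ p)]

theorem integrable_mul_conj (f : Lp ℂ p (haarProb S3)) (h : C(S3, ℂ)) :
    Integrable (fun x => f x * conj (h x)) (haarProb S3) := by
  have hf : Integrable f (haarProb S3) := (Lp.memLp f).integrable Fact.out
  refine Integrable.mul_bdd (c := ‖h‖) hf
    (Complex.continuous_conj.comp h.continuous).aestronglyMeasurable ?_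
  exact Filter.Eventually.of_forall fun x => by
    rw [RCLike.norm_conj]; exact h.norm_coe_le_norm x

/-- The functional `f ↦ ∫ f conj h` on `L^p(𝕊³)`. -/
noncomputable def pairingCLM (h : C(S3, ℂ)) : Lp ℂ p (haarProb S3) →L[ℂ] ℂ :=
  LinearMap.mkContinuous
    { toFun := fun f => ∫ x, f x * conj (h x) ∂haarProb S3
      map_add' := fun f g => by
        rw [← integral_add (integrable_mul_conj p f h) (integrable_mul_conj p g h)]
        refine integral_congr_ae ?_
        filter_upwards [Lp.coeFn_add f g] with x hx
        rw [hx, Pi.add_apply, add_mul]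
      map_smul' := fun c f => by
        rw [RingHom.id_apply, smul_eq_mul, ← integral_const_mul]
        refine integral_congr_ae ?_
        filter_upwards [Lp.coeFn_smul c f] with x hx
        rw [hx, Pi.smul_apply, smul_eq_mul, mul_assoc] } ‖h‖ (fun f => by
      have hf : MemLp f p (haarProb S3) := Lp.memLp f
      have hf1 : Integrable f (haarProb S3) := hf.integrable Fact.out
      calc ‖∫ x, f x * conj (h x) ∂haarProb S3‖
          ≤ ∫ x, ‖h‖ * ‖f x‖ ∂haarProb S3 := by
            refine norm_integral_le_of_norm_le (hf1.norm.const_mul _)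
              (Filter.Eventually.of_forall fun x => ?_)
            rw [norm_mul, RCLike.norm_conj, mul_comm]
            gcongr
            exact h.norm_coe_le_norm x
        _ = ‖h‖ * ∫ x, ‖f x‖ ∂haarProb S3 := integral_const_mul _ _
        _ ≤ ‖h‖ * ‖f‖ := by
            gcongr
            rw [integral_norm_eq_lintegral_enorm hf1.1, Lp.norm_def, ← eLpNorm_one_eq_lintegral_enorm]
            exact ENNReal.toReal_mono hf.2.ne
              (eLpNorm_le_eLpNorm_of_exponent_le Fact.out hf1.1))

theorem pairingCLM_apply (h : C(S3, ℂ)) (f : Lp ℂ p (haarProb S3)) :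
    pairingCLM p h f = ∫ x, f x * conj (h x) ∂haarProb S3 := rfl

theorem pairingCLM_toLp (h g : C(S3, ℂ)) :
    pairingCLM p h (ContinuousMap.toLp p (haarProb S3) ℂ g) = pairing g h := by
  rw [pairingCLM_apply, pairing]
  refine integral_congr_ae ?_
  filter_upwards [ContinuousMap.coeFn_toLp (p := p) (𝕜 := ℂ) (haarProb S3) g] with x hx
  rw [hx]

/-- The projection of `L^p(𝕊³)` onto the spherical functions of bidegree `(m, n)`. -/
noncomputable def sphProj (m n : ℕ) : Lp ℂ p (haarProb S3) →L[ℂ] Lp ℂ p (haarProb S3) :=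
  ∑ k ∈ Finset.range (m + n + 1), ((sphNorm m n k : ℂ)⁻¹ • pairingCLM p (sphC m n k)).smulRight
    (ContinuousMap.toLp p (haarProb S3) ℂ (sphC m n k))

theorem sphProj_apply (m n : ℕ) (f : Lp ℂ p (haarProb S3)) :
    sphProj p m n f = ∑ k ∈ Finset.range (m + n + 1),
      ((sphNorm m n k : ℂ)⁻¹ * pairingCLM p (sphC m n k) f) •
        ContinuousMap.toLp p (haarProb S3) ℂ (sphC m n k) := by
  simp [sphProj]

theorem sphProj_ae (m n : ℕ) (f : Lp ℂ p (haarProb S3)) :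
    sphProj p m n f =ᵐ[haarProb S3] fun x => ∫ y, repKernel m n x y * f y ∂haarProb S3 := by
  have h1 : ∀ x, ∫ y, repKernel m n x y * f y ∂haarProb S3 = (∑ k ∈ Finset.range (m + n + 1),
      ((sphNorm m n k : ℂ)⁻¹ * pairingCLM p (sphC m n k) f) • sphC m n k) x := by
    intro x
    simp only [repKernel, Finset.sum_mul]
    rw [integral_finsetSum]
    · rw [ContinuousMap.coe_sum, Finset.sum_apply]
      refine Finset.sum_congr rfl fun k _ => ?_
      rw [ContinuousMap.smul_apply, smul_eq_mul, pairingCLM_apply, mul_right_comm,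
        ← integral_const_mul]
      congr 1; ext y
      simp only [sphC, ContinuousMap.coe_mk]
      ring
    · intro k _
      have := (integrable_mul_conj p f (sphC m n k)).const_mul
        (sphFun m n k x / (sphNorm m n k : ℂ))
      refine this.congr (Filter.Eventually.of_forall fun y => ?_)
      simp only [sphC, ContinuousMap.coe_mk]
      ring
  have h2 : sphProj p m n f = ContinuousMap.toLp p (haarProb S3) ℂ
      (∑ k ∈ Finset.range (m + n + 1),
        ((sphNorm m n k : ℂ)⁻¹ * pairingCLM p (sphC m n k) f) • sphC m n k) := by
    rw [sphProj_apply, map_sum]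
    simp only [map_smul]
  rw [h2, funext h1]
  exact ContinuousMap.coeFn_toLp _ _

theorem continuous_repKernel (m n : ℕ) : Continuous (Function.uncurry (repKernel m n)) := by
  unfold repKernel Function.uncurry
  refine continuous_finsetSum _ fun k _ => ?_
  exact (((continuous_sphFun m n k).comp continuous_fst).mul (Complex.continuous_conj.comp
    ((continuous_sphFun m n k).comp continuous_snd))).div_const _

/-- Every row of the kernel has the scaled L¹ norm of the zonal function, and conjugate symmetry
transfers this to the columns. -/
theorem norm_sphProj_le (hp : p ≠ ⊤) (m n : ℕ) :
    ‖sphProj p m n‖ ≤ Real.sqrt (kernelBound m n) := by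
  obtain ⟨M, hMdef⟩ : ∃ M, M = Real.sqrt (kernelBound m n) := ⟨_, rfl⟩
  have hM0 : 0 ≤ M := hMdef ▸ Real.sqrt_nonneg _
  rw [← hMdef]
  have hM : ((m : ℝ) + n + 1) * ∫ y, ‖sphFun m n n y‖ ∂haarProb S3 ≤ M := by
    rw [hMdef]
    exact Real.le_sqrt_of_sq_le (sq_integral_norm_sphFun_le m n)
  have hc (x : S3) : Continuous fun y => repKernel m n x y := by
    have := (continuous_repKernel m n).comp (Continuous.prodMk_right x)
    simpa only [Function.comp_def, Function.uncurry] using this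
  have h1 (x : S3) : ∫⁻ y, ‖repKernel m n x y‖ₑ ∂haarProb S3 ≤ ENNReal.ofReal M := by
    have hi : Integrable (fun y => repKernel m n x y) (haarProb S3) :=
      integrable_of_continuous (hc x)
    have e := ofReal_integral_norm_eq_lintegral_enorm hi
    rw [← e]
    refine ENNReal.ofReal_le_ofReal ?_
    rw [integral_norm_repKernel]
    exact hM
  have h2 (y : S3) : ∫⁻ x, ‖repKernel m n x y‖ₑ ∂haarProb S3 ≤ ENNReal.ofReal M := by
    have e (x : S3) : ‖repKernel m n x y‖ₑ = ‖repKernel m n y x‖ₑ := by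
      rw [← repKernel_conj, enorm_eq_iff_norm_eq]
      exact RCLike.norm_conj _
    simp only [e]
    exact h1 y
  refine ContinuousLinearMap.opNorm_le_bound _ hM0 fun f => ?_
  have hf := Lp.memLp f
  have h3 := eLpNorm_integral_kernel_le (continuous_repKernel m n) h1 h2 Fact.out hp hf.1
  rw [Lp.norm_def, Lp.norm_def, eLpNorm_congr_ae (sphProj_ae p m n f)]
  calc _ ≤ (ENNReal.ofReal M * eLpNorm f p (haarProb S3)).toReal :=
        ENNReal.toReal_mono (ENNReal.mul_ne_top ENNReal.ofReal_ne_top hf.2.ne) h3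
    _ = _ := by rw [ENNReal.toReal_mul, ENNReal.toReal_ofReal hM0]

/-- The spherical functions of bidegree `(m, n)` in `L^p(𝕊³)`. -/
noncomputable def sphSubmodule (m n : ℕ) : Submodule ℂ (Lp ℂ p (haarProb S3)) :=
  Submodule.span ℂ (Set.range fun k : Fin (m + n + 1) =>
    ContinuousMap.toLp p (haarProb S3) ℂ (sphC m n k))

instance (m n : ℕ) : FiniteDimensional ℂ (sphSubmodule p m n) :=
  FiniteDimensional.span_of_finite ℂ (Set.finite_range _)

theorem finrank_sphSubmodule_le (m n : ℕ) :
    Module.finrank ℂ (sphSubmodule p m n) ≤ m + n + 1 := by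
  refine (finrank_range_le_card _).trans ?_
  simp

theorem sphProj_mem (m n : ℕ) (f : Lp ℂ p (haarProb S3)) :
    sphProj p m n f ∈ sphSubmodule p m n := by
  rw [sphProj_apply]
  refine Submodule.sum_mem _ fun k hk => Submodule.smul_mem _ _ (Submodule.subset_span ?_)
  exact ⟨⟨k, Finset.mem_range.1 hk⟩, rfl⟩

end Projections

/-! ### Expansion of eigenfunctions -/

/-- The component of bidegree `(m, n)` of a continuous function. -/
noncomputable def component (m n : ℕ) (φ : C(S3, ℂ)) : C(S3, ℂ) :=
  ∑ k ∈ Finset.range (m + n + 1), ((sphNorm m n k : ℂ)⁻¹ * pairing φ (sphC m n k)) • sphC m n k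

theorem sphProj_toLp (p : ℝ≥0∞) [Fact (1 ≤ p)] (m n : ℕ) (φ : C(S3, ℂ)) :
    sphProj p m n (ContinuousMap.toLp p (haarProb S3) ℂ φ) =
      ContinuousMap.toLp p (haarProb S3) ℂ (component m n φ) := by
  rw [sphProj_apply, component, map_sum]
  simp only [map_smul, pairingCLM_toLp]

theorem component_apply (m n : ℕ) (φ : C(S3, ℂ)) (x : S3) : component m n φ x =
    ∑ k ∈ Finset.range (m + n + 1),
      ((sphNorm m n k : ℂ)⁻¹ * pairing φ (sphC m n k)) * sphFun m n k x := by
  simp only [component, ContinuousMap.coe_sum, Finset.sum_apply, ContinuousMap.smul_apply,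
    smul_eq_mul]
  rfl

theorem pairing_component (m n : ℕ) (φ : C(S3, ℂ)) (m' n' l : ℕ) (hl : l ≤ m' + n') :
    pairing (component m n φ) (sphFun m' n' l) =
      if (m, n) = (m', n') then pairing φ (sphFun m' n' l) else 0 := by
  rw [show (component m n φ : S3 → ℂ) = fun x => ∑ k ∈ Finset.range (m + n + 1),
      ((sphNorm m n k : ℂ)⁻¹ * pairing φ (sphC m n k)) * sphFun m n k x from
    funext (component_apply m n φ)]
  split_ifs with h
  · obtain ⟨rfl, rfl⟩ := Prod.mk.inj h
    rw [pairing_sum_sphFun m n l (by simpa [Nat.lt_succ_iff] using hl)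
      (fun k => (sphNorm m n k : ℂ)⁻¹ * pairing φ (sphC m n k))]
    have hne : (sphNorm m n l : ℂ) ≠ 0 := by exact_mod_cast (sphNorm_pos hl).ne'
    rw [mul_right_comm, inv_mul_cancel₀ hne, one_mul]
    rfl
  · rw [pairing_sum _ (fun k _ => continuous_sphFun m n k) (continuous_sphFun m' n' l)]
    exact Finset.sum_eq_zero fun k _ => by rw [pairing_sphFun_of_ne h, mul_zero]

theorem IsEigen.pairing_sphFun_eq_zero {c : ℝ} {φ : S3 → ℂ} (h : IsEigen c φ) {m n : ℕ}
    (hc : eigenval m n ≠ c) (k : ℕ) : pairing φ (sphFun m n k) = 0 :=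
  h.integral_mul_eq_zero (isEigen_sphFun m n k).conjugate hc.symm

theorem IsEigen.component_eq_zero {c : ℝ} {φ : C(S3, ℂ)} (h : IsEigen c φ) {m n : ℕ}
    (hc : eigenval m n ≠ c) : component m n φ = 0 := by
  refine ContinuousMap.ext fun x => ?_
  rw [component_apply]
  refine Finset.sum_eq_zero fun k _ => ?_
  have : pairing φ (sphC m n k) = 0 := h.pairing_sphFun_eq_zero hc k
  rw [this, mul_zero, zero_mul]

/-- Components at other eigenvalues vanish by symmetry of ℒ, and the difference of the two sides is
orthogonal to all spherical functions. For negative c the set is empty and φ = 0, so no condition on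
c is needed. -/
theorem IsEigen.exists_eq_sum {c : ℝ} {φ : C(S3, ℂ)} (h : IsEigen c φ) :
    ∃ s : Finset (ℕ × ℕ), (∀ i, i ∈ s ↔ eigenval i.1 i.2 = c) ∧
      φ = ∑ i ∈ s, component i.1 i.2 φ := by
  classical
  -- The eigenvalue is at least half of i.1 + i.2, so this box contains every bidegree with
  -- eigenvalue c.
  set B := ⌈2 * c⌉₊ + 1
  set s := (Finset.range B ×ˢ Finset.range B).filter fun i => eigenval i.1 i.2 = c
  have hs (i : ℕ × ℕ) : i ∈ s ↔ eigenval i.1 i.2 = c := by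
    simp only [s, Finset.mem_filter, Finset.mem_product, Finset.mem_range, and_iff_right_iff_imp]
    intro hi
    have h1 : (i.1 : ℝ) + i.2 ≤ 2 * c := by
      rw [← hi, eigenval]
      have : (0 : ℝ) ≤ i.1 * i.2 := by positivity
      linarith
    have h2 := Nat.le_ceil (2 * c)
    have h3 : i.1 + i.2 ≤ ⌈2 * c⌉₊ := by exact_mod_cast h1.trans h2
    constructor <;> omega
  refine ⟨s, hs, ?_⟩
  have hz := eq_zero_of_pairing_sphFun (ψ := φ - ∑ i ∈ s, component i.1 i.2 φ)
    (φ.continuous.sub (∑ i ∈ s, component i.1 i.2 φ).continuous) (fun m n k hk => ?_)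
  · ext x
    have := congrFun hz x
    exact sub_eq_zero.1 this
  · have e1 := pairing_linear φ.continuous (∑ i ∈ s, component i.1 i.2 φ).continuous
      (continuous_sphFun m n k) 1 (-1)
    simp only [one_mul, neg_mul, ← sub_eq_add_neg] at e1
    refine e1.trans ?_
    have e2 := pairing_sum s (f := fun i => component i.1 i.2 φ) (fun i _ => (component i.1 i.2 φ).continuous)
      (continuous_sphFun m n k) (fun _ => 1)
    simp only [one_mul] at e2
    rw [ContinuousMap.coe_sum, show (∑ i ∈ s, (component i.1 i.2 φ : S3 → ℂ)) =
      fun x => ∑ i ∈ s, component i.1 i.2 φ x from by ext x; simp, e2]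
    simp only [pairing_component _ _ _ _ _ _ hk, Prod.mk.eta]
    rw [Finset.sum_ite_eq']
    split_ifs with hmem
    · exact sub_self _
    · rw [sub_zero]
      exact h.pairing_sphFun_eq_zero (fun he => hmem ((hs _).2 he)) k

/-! ### Summability -/

/-- The logarithm hidden in the harmonic sum costs only an arbitrarily small power of X. -/
theorem sum_one_div_le {ε : ℝ} (hε : 0 < ε) {N : ℕ} {X : ℝ} (hX : (N : ℝ) + 1 ≤ X) :
    ∑ n ∈ Finset.range (N + 1), (1 / ((n : ℝ) + 1)) ≤ (1 + 1 / ε) * X ^ ε := by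
  have h1 : ∑ n ∈ Finset.range (N + 1), (1 / ((n : ℝ) + 1)) ≤ 1 + Real.log (N + 1) := by
    have := harmonic_le_one_add_log (N + 1)
    simp only [harmonic] at this
    push_cast at this
    simpa only [one_div] using this
  have hX1 : 1 ≤ X := by linarith [(Nat.cast_nonneg N : (0 : ℝ) ≤ N)]
  have h2 : Real.log (N + 1) ≤ X ^ ε / ε :=
    (Real.log_le_log (by positivity) hX).trans (Real.log_le_rpow_div (by linarith) hε)
  have h3 : 1 ≤ X ^ ε := Real.one_le_rpow hX1 hε.le
  calc _ ≤ _ := h1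
    _ ≤ X ^ ε + X ^ ε / ε := by linarith
    _ = _ := by ring

theorem one_le_kernelBound (m n : ℕ) : 1 ≤ kernelBound m n := by
  have hm : (0 : ℝ) ≤ m := by positivity
  have hn : (0 : ℝ) ≤ n := by positivity
  have h1 : (1 : ℝ) ≤ 3 * ((m + 1) * (n + 1)) / (m + n + 1) := by
    rw [le_div_iff₀ (by positivity)]
    nlinarith [mul_nonneg hm hn]
  have h2 : (1 : ℝ) ≤ ∑ j ∈ Finset.range (m + n + 1), (1 / ((j : ℝ) + 1)) := by
    have := Finset.single_le_sum (f := fun j : ℕ => 1 / ((j : ℝ) + 1)) (fun j _ => by positivity)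
      (Finset.mem_range.2 (Nat.succ_pos (m + n)))
    simpa using this
  exact one_le_mul_of_one_le_of_one_le h1 h2

theorem summable_sphProj (p : ℝ≥0∞) [Fact (1 ≤ p)] (hp : p ≠ ⊤) {r α : ℝ} (hr₀ : 0 < r)
    (hr₁ : r ≤ 1) (hα : 4 / r < α) :
    Summable fun i : ℕ × ℕ => ((i.1 + i.2 + 1 : ℕ) : ℝ) *
      ‖(((1 + eigenval i.1 i.2) ^ (-(α / 2)) : ℝ) : ℂ) • sphProj p i.1 i.2‖ ^ r := by
  set β := α * r / 2 with hβ
  have hβ2 : 2 < β := by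
    rw [div_lt_iff₀ hr₀] at hα
    rw [hβ]; linarith
  -- Taking ε = β/2 - 1 for the harmonic sum leaves the total exponent 1 + ε - β = -β/2, still below
  -- -1.
  have hε : 0 < β / 2 - 1 := by linarith
  have hsum : Summable fun n : ℕ => ((n : ℝ) + 1) ^ (-(β / 2)) := by
    have := (summable_nat_add_iff 1).2 (Real.summable_nat_rpow.2 (by linarith : -(β / 2) < -1))
    simpa using this
  have hsum2 := (hsum.mul_of_nonneg hsum (fun n => by positivity) (fun n => by positivity)).mul_left
    (2 ^ β * 3 * (1 + 1 / (β / 2 - 1)))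
  refine Summable.of_nonneg_of_le (fun i => by positivity) (fun i => ?_) hsum2
  obtain ⟨m, n⟩ := i
  simp only
  have hm : (0 : ℝ) ≤ m := by positivity
  have hn : (0 : ℝ) ≤ n := by positivity
  set X : ℝ := (m + 1) * (n + 1) with hX
  have hXpos : 0 < X := by positivity
  have hlam : X / 2 ≤ 1 + eigenval m n := by
    rw [hX, eigenval]
    nlinarith [mul_nonneg hm hn]
  have hlam0 : 0 < 1 + eigenval m n := lt_of_lt_of_le (by positivity) hlam
  set k := kernelBound m n with hk
  have hk1 : 1 ≤ k := one_le_kernelBound m n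
  have h1 : ‖(((1 + eigenval m n) ^ (-(α / 2)) : ℝ) : ℂ) • sphProj p m n‖ ^ r ≤
      2 ^ β * X ^ (-β) * k := by
    rw [norm_smul, Complex.norm_real, Real.norm_of_nonneg (by positivity)]
    rw [Real.mul_rpow (by positivity) (norm_nonneg _), ← Real.rpow_mul hlam0.le]
    gcongr
    · calc (1 + eigenval m n) ^ (-(α / 2) * r) = (1 + eigenval m n) ^ (-β) := by
            congr 1; rw [hβ]; ring
        _ ≤ (X / 2) ^ (-β) := Real.rpow_le_rpow_of_nonpos (by positivity) hlam (by linarith)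
        _ = 2 ^ β * X ^ (-β) := by
            rw [Real.div_rpow hXpos.le zero_le_two, Real.rpow_neg zero_le_two β, div_inv_eq_mul,
              mul_comm]
    -- As k ≥ 1 and r ≤ 1, the power k^(r/2) may be replaced by k, whose denominator then cancels
    -- the rank m + n + 1.
    · calc ‖sphProj p m n‖ ^ r ≤ (Real.sqrt k) ^ r := by
            gcongr
            exact norm_sphProj_le p hp m n
        _ ≤ (Real.sqrt k) ^ (1 : ℝ) := by
            refine Real.rpow_le_rpow_of_exponent_le ?_ hr₁
            rw [← Real.sqrt_one]
            exact Real.sqrt_le_sqrt hk1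
        _ = Real.sqrt k := Real.rpow_one _
        _ ≤ k := by
            rw [Real.sqrt_le_left (by linarith)]
            nlinarith
  have hH := sum_one_div_le hε (N := m + n) (X := X) (by push_cast; rw [hX]; nlinarith [mul_nonneg hm hn])
  have h2 : ((m + n + 1 : ℕ) : ℝ) * k ≤ 3 * X * ((1 + 1 / (β / 2 - 1)) * X ^ (β / 2 - 1)) := by
    have : ((m + n + 1 : ℕ) : ℝ) * k =
        3 * X * ∑ j ∈ Finset.range (m + n + 1), (1 / ((j : ℝ) + 1)) := by
      rw [hk, kernelBound, hX]
      push_cast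
      field_simp
    rw [this]
    gcongr
  calc _ ≤ ((m + n + 1 : ℕ) : ℝ) * (2 ^ β * X ^ (-β) * k) := by gcongr
    _ = 2 ^ β * X ^ (-β) * (((m + n + 1 : ℕ) : ℝ) * k) := by ring
    _ ≤ 2 ^ β * X ^ (-β) * (3 * X * ((1 + 1 / (β / 2 - 1)) * X ^ (β / 2 - 1))) := by gcongr
    _ = 2 ^ β * 3 * (1 + 1 / (β / 2 - 1)) * (X ^ (-β) * X ^ (1 : ℝ) * X ^ (β / 2 - 1)) := by
        rw [Real.rpow_one]; ring
    _ = 2 ^ β * 3 * (1 + 1 / (β / 2 - 1)) * (X ^ (-(β / 2))) := by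
        rw [← Real.rpow_add hXpos, ← Real.rpow_add hXpos]
        congr 2; ring
    _ = _ := by
        rw [hX, Real.mul_rpow (by positivity) (by positivity)]

/-! ### Powers of the sub-Laplacian on `𝕊³` -/

/-- On an eigenfunction the defining series has finitely many nonzero terms, all with the same
multiplier. -/
theorem exists_power_S3 (p : ℝ≥0∞) [Fact (1 ≤ p)] (hp : p ≠ ⊤) {r α : ℝ} (hr₀ : 0 < r)
    (hr₁ : r ≤ 1) (hα : 4 / r < α) :
    ∃ T : Lp ℂ p (haarProb S3) →L[ℂ] Lp ℂ p (haarProb S3), IsRNuclear r T ∧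
      ∀ (c : ℝ) (φ : C(S3, ℂ)), IsEigen c φ →
        T (ContinuousMap.toLp p (haarProb S3) ℂ φ) =
          (((1 + c) ^ (-(α / 2)) : ℝ) : ℂ) • ContinuousMap.toLp p (haarProb S3) ℂ φ := by
  obtain ⟨T, hT, hTs⟩ := exists_isRNuclear_hasSum hr₀ hr₁
    (fun i : ℕ × ℕ => (((1 + eigenval i.1 i.2) ^ (-(α / 2)) : ℝ) : ℂ) • sphProj p i.1 i.2)
    (fun i => sphSubmodule p i.1 i.2)
    (fun i x => Submodule.smul_mem _ _ (sphProj_mem p i.1 i.2 x))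
    (fun i => finrank_sphSubmodule_le p i.1 i.2) (summable_sphProj p hp hr₀ hr₁ hα)
  refine ⟨T, hT, fun c φ hφ => ?_⟩
  obtain ⟨s, hs, hsum⟩ := hφ.exists_eq_sum
  have h1 := hTs (ContinuousMap.toLp p (haarProb S3) ℂ φ)
  have h2 := hasSum_sum_of_ne_finset_zero (L := SummationFilter.unconditional _) (s := s)
    (f := fun i : ℕ × ℕ => ((((1 + eigenval i.1 i.2) ^ (-(α / 2)) : ℝ) : ℂ) • sphProj p i.1 i.2)
      (ContinuousMap.toLp p (haarProb S3) ℂ φ)) (fun i hi => by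
        rw [_root_.smul_apply, sphProj_toLp,
          hφ.component_eq_zero (fun he => hi ((hs i).2 he)), map_zero, smul_zero])
  rw [h1.unique h2]
  conv_rhs => rw [hsum, map_sum, Finset.smul_sum]
  refine Finset.sum_congr rfl fun i hi => ?_
  rw [_root_.smul_apply, sphProj_toLp, (hs i).1 hi]

end SubLap

/-! ### Descent to quotients of the sphere -/

namespace SubLap

open ComplexConjugate

/-! ### Transport to quotients of `𝕊³` -/

theorem IsRNuclear.comp {E F E' F' : Type*} [NormedAddCommGroup E] [NormedSpace ℂ E]
    [NormedAddCommGroup F] [NormedSpace ℂ F] [NormedAddCommGroup E'] [NormedSpace ℂ E']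
    [NormedAddCommGroup F'] [NormedSpace ℂ F'] {r : ℝ} (hr : 0 ≤ r) {T : E →L[ℂ] F}
    (h : IsRNuclear r T) (A : F →L[ℂ] F') (B : E' →L[ℂ] E) :
    IsRNuclear r (A.comp (T.comp B)) := by
  obtain ⟨x', y, hs, hT⟩ := h
  refine ⟨fun n => (x' n).comp B, fun n => A (y n), ?_, fun x => ?_⟩
  · refine Summable.of_nonneg_of_le (fun n => by positivity) (fun n => ?_)
      (hs.mul_left (‖B‖ ^ r * ‖A‖ ^ r))
    calc ‖(x' n).comp B‖ ^ r * ‖A (y n)‖ ^ r ≤ (‖x' n‖ * ‖B‖) ^ r * (‖A‖ * ‖y n‖) ^ r := by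
          gcongr
          · exact ContinuousLinearMap.opNorm_comp_le _ _
          · exact A.le_opNorm _
      _ = ‖B‖ ^ r * ‖A‖ ^ r * (‖x' n‖ ^ r * ‖y n‖ ^ r) := by
          rw [Real.mul_rpow (norm_nonneg _) (norm_nonneg _),
            Real.mul_rpow (norm_nonneg _) (norm_nonneg _)]
          ring
  · have := (hT (B x)).mapL A
    simpa using this

theorem toLp_comp {G : Type*} [Group G] [TopologicalSpace G] [IsTopologicalGroup G]
    [CompactSpace G] [MeasurableSpace G] [BorelSpace G] {π : S3 → G}
    (hmp : MeasurePreserving π (haarProb S3) (haarProb G)) (p : ℝ≥0∞) [Fact (1 ≤ p)]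
    (g : C(G, ℂ)) (g' : C(S3, ℂ)) (h : ∀ x, g (π x) = g' x) :
    Lp.compMeasurePreservingₗᵢ ℂ π hmp (ContinuousMap.toLp p (haarProb G) ℂ g) =
      ContinuousMap.toLp p (haarProb S3) ℂ g' := by
  refine Lp.ext ?_
  have h1 := Lp.coeFn_compMeasurePreserving (ContinuousMap.toLp p (haarProb G) ℂ g) hmp
  have h2 := hmp.quasiMeasurePreserving.ae_eq_comp
    (ContinuousMap.coeFn_toLp (p := p) (𝕜 := ℂ) (haarProb G) g)
  have h3 := ContinuousMap.coeFn_toLp (p := p) (𝕜 := ℂ) (haarProb S3) g'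
  filter_upwards [h1, h2, h3] with x hx1 hx2 hx3
  rw [hx3, ← h x]
  exact hx1.trans hx2

theorem invField_comp {G : Type*} [Group G] {π : S3 →* G} {ω : ℝ → S3} {ω' : ℝ → G} (h : ∀ t, π (ω t) = ω' t)
    (φ : G → ℂ) : invField ω (fun x => φ (π x)) = fun x => invField ω' φ (π x) := by
  ext x
  simp only [invField, map_mul, h]

theorem subLaplacian_comp {G : Type*} [Group G] {π : S3 →* G} {ω₁ ω₂ : ℝ → S3} {ω₁' ω₂' : ℝ → G}
    (h₁ : ∀ t, π (ω₁ t) = ω₁' t) (h₂ : ∀ t, π (ω₂ t) = ω₂' t) (φ : G → ℂ) (x : S3) :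
    subLaplacian ω₁ ω₂ (fun x => φ (π x)) x = subLaplacian ω₁' ω₂' φ (π x) := by
  simp only [subLaplacian, invField_comp h₁, invField_comp h₂]

section Cover

variable {G E : Type*} [Group G] [TopologicalSpace G] [IsTopologicalGroup G] [CompactSpace G]
  [T2Space G] [MeasurableSpace G] [BorelSpace G] [NormedAddCommGroup E] [NormedSpace ℝ E]

theorem measurePreserving_of_surjective {π : S3 →* G} (hπ : Continuous π)
    (hs : Function.Surjective π) : MeasurePreserving π (haarProb S3) (haarProb G) := by
  refine ⟨hπ.measurable, ?_⟩
  have h1 : ((haarProb S3).map π).IsHaarMeasure :=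
    Measure.isHaarMeasure_map_of_isFiniteMeasure _ π hπ hs
  have h2 : IsProbabilityMeasure ((haarProb S3).map π) :=
    Measure.isProbabilityMeasure_map hπ.measurable.aemeasurable
  exact Measure.isHaarMeasure_eq_of_isProbabilityMeasure _ _

/-- A bounded left inverse of the embedding of `L^p(G)` into `L^p(𝕊³)`, for a quotient `G` of
`𝕊³` by a group with at most two elements. -/
theorem exists_leftInverse {π : S3 →* G} (hπ : Continuous π) (hs : Function.Surjective π)
    (hmp : MeasurePreserving π (haarProb S3) (haarProb G)) {κ : S3} (hκ : κ * κ = 1)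
    (hπκ : π κ = 1) (hker : ∀ x y, π x = π y → y = x ∨ y = κ * x) (p : ℝ≥0∞) [Fact (1 ≤ p)]
    (hp : p ≠ ⊤) : ∃ A : Lp ℂ p (haarProb S3) →L[ℂ] Lp ℂ p (haarProb G),
      (∀ f, A (Lp.compMeasurePreservingₗᵢ ℂ π hmp f) = f) ∧
      ∀ g : C(S3, ℂ), (∀ x, g (κ * x) = -g x) → A (ContinuousMap.toLp p (haarProb S3) ℂ g) = 0 := by
  set J : Lp ℂ p (haarProb G) →ₗᵢ[ℂ] Lp ℂ p (haarProb S3) :=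
    Lp.compMeasurePreservingₗᵢ ℂ π hmp with hJ
  have hκmp : MeasurePreserving (fun x => κ * x) (haarProb S3) (haarProb S3) :=
    measurePreserving_mul_left _ κ
  have hκc : Continuous fun x : S3 => κ * x := continuous_const_mul κ
  set R : Lp ℂ p (haarProb S3) →ₗᵢ[ℂ] Lp ℂ p (haarProb S3) :=
    Lp.compMeasurePreservingₗᵢ ℂ (fun x => κ * x) hκmp with hR
  -- Averaging over {1, κ}: the identity on pull-backs, and zero on functions odd under κ.
  let S : Lp ℂ p (haarProb S3) →L[ℂ] Lp ℂ p (haarProb S3) :=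
    (2 : ℂ)⁻¹ • (ContinuousLinearMap.id ℂ _ + R.toContinuousLinearMap)
  have hS (f) : S f = (2 : ℂ)⁻¹ • (f + R f) := rfl
  have hSg (g : C(S3, ℂ)) : S (ContinuousMap.toLp p (haarProb S3) ℂ g) =
      ContinuousMap.toLp p (haarProb S3) ℂ
        ((2 : ℂ)⁻¹ • (g + g.comp ⟨fun x => κ * x, hκc⟩)) := by
    rw [hS, map_smul, map_add, hR, toLp_comp hκmp p g (g.comp ⟨fun x => κ * x, hκc⟩)
      fun x => rfl]
  have hmem (f : Lp ℂ p (haarProb S3)) : S f ∈ LinearMap.range J.toLinearMap := by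
    -- The range of an isometry of a complete space is closed, so it suffices to treat continuous
    -- functions. Their averages are constant on the fibres of π and factor through the quotient
    -- map.
    have hcl : IsClosed (LinearMap.range J.toLinearMap : Set (Lp ℂ p (haarProb S3))) :=
      J.isometry.isClosedEmbedding.isClosed_range
    refine (ContinuousMap.toLp_denseRange ℂ (haarProb S3) ℂ hp).induction_on
      (p := fun f => S f ∈ LinearMap.range J.toLinearMap) f (hcl.preimage S.continuous)
      fun g => ?_
    have hq := hπ.isClosedMap.isQuotientMap hπ hs
    let g' : C(S3, ℂ) := (2 : ℂ)⁻¹ • (g + g.comp ⟨fun x => κ * x, hκc⟩)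
    have hg' (x : S3) : g' x = (2 : ℂ)⁻¹ * (g x + g (κ * x)) := rfl
    have hfac : Function.FactorsThrough g' π := fun x y hxy => by
      rcases hker x y hxy with rfl | rfl
      · rfl
      · rw [hg', hg', ← mul_assoc, hκ, one_mul, add_comm]
    refine ⟨ContinuousMap.toLp p (haarProb G) ℂ (Topology.IsQuotientMap.lift (f := ⟨π, hπ⟩) hq g' hfac), ?_⟩
    rw [hSg]
    refine toLp_comp hmp p _ g' fun x => ?_
    exact congrArg (fun F : C(S3, ℂ) => F x) (Topology.IsQuotientMap.lift_comp (f := ⟨π, hπ⟩) hq g' hfac)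
  let A : Lp ℂ p (haarProb S3) →L[ℂ] Lp ℂ p (haarProb G) :=
    (J.equivRange.symm.toContinuousLinearEquiv : _ →L[ℂ] Lp ℂ p (haarProb G)).comp
      (S.codRestrict _ hmem)
  have hJA (f) : J (A f) = S f := by
    have := J.equivRange.apply_symm_apply ⟨S f, hmem f⟩
    exact congrArg Subtype.val this
  refine ⟨A, fun f => J.injective ?_, fun g hg => J.injective ?_⟩
  · rw [hJA, hS]
    have h1 : R (J f) = J f := by
      refine Lp.ext ?_
      have a1 : R (J f) =ᵐ[haarProb S3] (J f) ∘ fun x => κ * x :=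
        Lp.coeFn_compMeasurePreserving (J f) hκmp
      have a2 : J f =ᵐ[haarProb S3] f ∘ π := Lp.coeFn_compMeasurePreserving f hmp
      have a3 := hκmp.quasiMeasurePreserving.ae_eq_comp a2
      filter_upwards [a1, a2, a3] with x h1 h2 h3
      rw [h1, h2, h3]
      simp [hπκ]
    rw [h1, ← two_smul ℂ, smul_smul, inv_mul_cancel₀ two_ne_zero, one_smul]
  · rw [hJA, hSg, map_zero]
    have : (2 : ℂ)⁻¹ • (g + g.comp ⟨fun x => κ * x, hκc⟩) = 0 := by
      refine ContinuousMap.ext fun x => ?_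
      change (2 : ℂ)⁻¹ * (g x + g (κ * x)) = 0
      rw [hg, add_neg_cancel, mul_zero]
    rw [this, map_zero]

/-- `f` is the pull-back of a smooth function on `G`. -/
def Descends (ι : G → E) (π : S3 → G) (f : S3 → ℂ) : Prop :=
  ∃ φ : G → ℂ, IsSmooth ι φ ∧ ∀ x, φ (π x) = f x

/-- Interpolation reduces the span to the generating functions, whose parity under κ is visible. -/
theorem sphSpan_le {V : Submodule ℂ C(S3, ℂ)}
    (h : ∀ m n t, (⟨genFun m n t, continuous_genFun m n t⟩ : C(S3, ℂ)) ∈ V) : sphSpan ≤ V := by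
  rw [sphSpan, Submodule.span_le]
  rintro _ ⟨⟨m, n, k⟩, rfl⟩
  obtain ⟨c, hc⟩ := exists_sphFun_eq_sum m n k
  have e : sphC m n k = ∑ i ∈ Finset.range (m + n + 1),
      c i • (⟨genFun m n i, continuous_genFun m n i⟩ : C(S3, ℂ)) := by
    refine ContinuousMap.ext fun x => ?_
    rw [ContinuousMap.coe_sum, Finset.sum_apply]
    exact hc x
  change sphC m n k ∈ V
  rw [e]
  exact V.sum_mem fun i _ => V.smul_mem _ (h m n i)

/-- Pull-back intertwines the two sub-Laplacians, so J sends an eigenfunction on G to one on the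
sphere; T scales it, and A undoes J. The choice κ = 1 covers isomorphisms. -/
theorem subLaplacianPowerIsRNuclear_of_cover {ι : G → E} {ω₁ ω₂ : ℝ → G} {π : S3 →* G}
    (hπ : Continuous π) (hs : Function.Surjective π) (h₁ : ∀ t, π (S3.omega₁ t) = ω₁ t)
    (h₂ : ∀ t, π (S3.omega₂ t) = ω₂ t)
    (hι : ∃ Φ : ℍ[ℝ] → E, ContDiff ℝ (⊤ : ℕ∞) Φ ∧ ∀ x, ι (π x) = Φ (S3.incl x))
    {κ : S3} (hκ : κ * κ = 1) (hπκ : π κ = 1) (hker : ∀ x y, π x = π y → y = x ∨ y = κ * x)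
    (hgen : ∀ m n t, (∀ x, genFun m n t (κ * x) = -genFun m n t x) ∨
      Descends ι π (genFun m n t))
    {r α : ℝ} (hr₀ : 0 < r) (hr₁ : r ≤ 1) (hα : 4 / r < α) (p : ℝ≥0∞) [Fact (1 ≤ p)]
    (hp : p ≠ ⊤) : SubLaplacianPowerIsRNuclear ι ω₁ ω₂ (haarProb G) r α p := by
  have hmp := measurePreserving_of_surjective hπ hs
  obtain ⟨A, hAJ, hA0⟩ := exists_leftInverse hπ hs hmp hκ hπκ hker p hp
  obtain ⟨T, hT, hTe⟩ := exists_power_S3 p hp hr₀ hr₁ hα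
  set J : Lp ℂ p (haarProb G) →ₗᵢ[ℂ] Lp ℂ p (haarProb S3) :=
    Lp.compMeasurePreservingₗᵢ ℂ π hmp with hJ
  have hpow : IsSubLaplacianPower ι ω₁ ω₂ (haarProb G) α p
      (A.comp (T.comp J.toContinuousLinearMap)) := by
    intro c φ hφ hφc u hu
    have hsm : IsSmooth S3.incl (fun x => φ (π x)) := by
      obtain ⟨F, hF, hφF⟩ := hφ
      obtain ⟨Φ, hΦ, hιΦ⟩ := hι
      exact ⟨F ∘ Φ, hF.comp hΦ, fun x => by simp only [hφF, hιΦ, Function.comp_apply]⟩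
    have heig : IsEigen c (fun x => φ (π x)) :=
      ⟨hsm, fun x => by rw [subLaplacian_comp h₁ h₂]; exact hφc _⟩
    have hJu : J u = ContinuousMap.toLp p (haarProb S3) ℂ ⟨_, heig.continuous⟩ := by
      refine Lp.ext ?_
      have a1 : J u =ᵐ[haarProb S3] u ∘ π := Lp.coeFn_compMeasurePreserving u hmp
      have a2 := hmp.quasiMeasurePreserving.ae_eq_comp hu
      have a3 := ContinuousMap.coeFn_toLp (p := p) (𝕜 := ℂ) (haarProb S3)
        ⟨fun x => φ (π x), heig.continuous⟩
      filter_upwards [a1, a2, a3] with x hx1 hx2 hx3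
      rw [hx1, hx3]
      exact hx2
    have e1 := hTe c ⟨_, heig.continuous⟩ heig
    rw [← hJu] at e1
    change A (T (J u)) = _
    rw [e1, map_smul, hAJ]
  refine ⟨_, hpow, fun T' hT' => ?_, hT.comp hr₀.le A _⟩
  -- As A J = id, the map A is onto, so two candidates may be compared after A, on the sphere, where
  -- the generating functions span a dense subspace.
  have hall : ∀ f, T' (A f) = (A.comp (T.comp J.toContinuousLinearMap)) (A f) := by
    let D : Lp ℂ p (haarProb S3) →L[ℂ] Lp ℂ p (haarProb G) :=
      T'.comp A - (A.comp (T.comp J.toContinuousLinearMap)).comp A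
    have hD : ∀ f, D f = 0 := by
      have h0 : ∀ g : C(S3, ℂ), D (ContinuousMap.toLp p (haarProb S3) ℂ g) = 0 := by
        let D' : C(S3, ℂ) →L[ℂ] Lp ℂ p (haarProb G) :=
          D.comp (ContinuousMap.toLp p (haarProb S3) ℂ)
        have hle : sphSpan ≤ LinearMap.ker D'.toLinearMap := by
          refine sphSpan_le fun m n t => ?_
          change T' (A (ContinuousMap.toLp p (haarProb S3) ℂ _)) - (A.comp (T.comp
            J.toContinuousLinearMap)) (A (ContinuousMap.toLp p (haarProb S3) ℂ _)) = 0
          rcases hgen m n t with hodd | ⟨φ, hφ, hφg⟩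
          · rw [hA0 _ hodd, map_zero, map_zero, sub_zero]
          · have hφc : Continuous φ := by
              rw [(hπ.isClosedMap.isQuotientMap hπ hs).continuous_iff]
              have : φ ∘ π = genFun m n t := funext hφg
              rw [this]
              exact continuous_genFun m n t
            have hφe : ∀ x, -subLaplacian ω₁ ω₂ φ x = (eigenval m n : ℂ) * φ x := by
              intro x
              obtain ⟨x, rfl⟩ := hs x
              rw [← subLaplacian_comp h₁ h₂, hφg]
              have := (isEigen_genFun m n t).2 x
              rw [← funext hφg] at this
              simpa only [hφg] using this
            have e := toLp_comp hmp p ⟨φ, hφc⟩ ⟨genFun m n t, continuous_genFun m n t⟩ hφg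
            rw [← e, hAJ, sub_eq_zero]
            have hae := ContinuousMap.coeFn_toLp (p := p) (𝕜 := ℂ) (haarProb G) ⟨φ, hφc⟩
            rw [hT' _ φ hφ hφe _ hae, hpow _ φ hφ hφe _ hae]
        have hcl : IsClosed (LinearMap.ker D'.toLinearMap : Set C(S3, ℂ)) :=
          isClosed_singleton.preimage D'.continuous
        have := Submodule.topologicalClosure_minimal _ hle hcl
        rw [sphSpan_topologicalClosure] at this
        exact fun g => this trivial
      exact fun f => (ContinuousMap.toLp_denseRange ℂ (haarProb S3) ℂ hp).induction_on
        (p := fun f => D f = 0) f (isClosed_singleton.preimage D.continuous) h0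
    exact fun f => sub_eq_zero.1 (hD f)
  refine ContinuousLinearMap.ext fun f => ?_
  have := hall (J f)
  rwa [hAJ] at this

end Cover

end SubLap

/-! ### The isomorphic models: unit quaternions and special unitary matrices -/

namespace SubLap

open ComplexConjugate

/-! ### The groups `𝕊³` and `SU(2)` -/

theorem subLaplacianPowerIsRNuclear_S3 {r α : ℝ} (hr₀ : 0 < r) (hr₁ : r ≤ 1) (hα : 4 / r < α)
    (p : ℝ≥0∞) [Fact (1 ≤ p)] (hp : p ≠ ⊤) :
    SubLaplacianPowerIsRNuclear S3.incl S3.omega₁ S3.omega₂ (haarProb S3) r α p :=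
  subLaplacianPowerIsRNuclear_of_cover (π := MonoidHom.id S3) (κ := 1) continuous_id
    Function.surjective_id (fun _ => rfl) (fun _ => rfl) ⟨fun q => q, contDiff_fun_id, fun _ => rfl⟩
    (one_mul 1) rfl (fun _ _ h => Or.inl h.symm)
    (fun m n t => Or.inr ⟨_, isSmooth_genFun m n t, fun _ => rfl⟩) hr₀ hr₁ hα p hp

theorem IsSmooth.ofComplex_of_clm {G E : Type*} [NormedAddCommGroup E] [NormedSpace ℝ E]
    {ι : G → E} (l : E →L[ℝ] ℂ) : IsSmooth ι (fun x => l (ι x)) :=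
  ⟨l, l.contDiff, fun _ => rfl⟩

/-- The matrix of a unit quaternion in `SU(2)`. -/
noncomputable def S3.suMatrix (x : S3) : Matrix (Fin 2) (Fin 2) ℂ :=
  !![u x, -conj (v x); v x, conj (u x)]

theorem S3.suMatrix_mem (x : S3) : x.suMatrix ∈ Matrix.specialUnitaryGroup (Fin 2) ℂ := by
  have h := u_v_sphere x
  rw [Matrix.mem_specialUnitaryGroup_iff, Matrix.mem_unitaryGroup_iff]
  constructor
  · ext i j
    fin_cases i <;> fin_cases j <;>
      simp [suMatrix, Matrix.mul_apply, Fin.sum_univ_two, Matrix.star_apply] <;>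
      first
        | ring1
        | linear_combination h
  · rw [suMatrix, Matrix.det_fin_two_of]
    linear_combination h

/-- The isomorphism of `𝕊³` with `SU(2)`. -/
noncomputable def S3.toSU2 : S3 →* SU2 where
  toFun x := ⟨x.suMatrix, x.suMatrix_mem⟩
  map_one' := by
    refine Subtype.ext ?_
    ext i j
    fin_cases i <;> fin_cases j <;> simp [suMatrix, u_one, v_one]
  map_mul' x y := by
    refine Subtype.ext ?_
    ext i j
    fin_cases i <;> fin_cases j <;>
      simp [suMatrix, u_mul, v_mul] <;> ring

theorem S3.toSU2_apply (x : S3) : (toSU2 x).1 = x.suMatrix := rfl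

theorem S3.continuous_toSU2 : Continuous toSU2 := by
  refine Continuous.subtype_mk ?_ _
  refine continuous_matrix fun i j => ?_
  fin_cases i <;> fin_cases j
  · exact continuous_u
  · exact (Complex.continuous_conj.comp continuous_v).neg
  · exact continuous_v
  · exact Complex.continuous_conj.comp continuous_u

theorem S3.toSU2_injective : Function.Injective toSU2 := fun x y h => by
  have h' := congrArg Subtype.val h
  exact ext_u_v (congrFun (congrFun h' 0) 0) (congrFun (congrFun h' 1) 0)

/-- For a unitary matrix of determinant one the conjugate transpose is the adjugate. This determines
the second column from the first. -/
theorem S3.toSU2_surjective : Function.Surjective toSU2 := by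
  intro A
  obtain ⟨hU, hdet⟩ := Matrix.mem_specialUnitaryGroup_iff.1 A.2
  have h1 := Matrix.mem_unitaryGroup_iff'.1 hU
  have hadj : star A.1 = A.1.adjugate := by
    have h2 : A.1 * A.1.adjugate = 1 := by rw [Matrix.mul_adjugate, hdet, one_smul]
    calc star A.1 = star A.1 * (A.1 * A.1.adjugate) := by rw [h2, mul_one]
      _ = A.1.adjugate := by rw [← mul_assoc, h1, one_mul]
  rw [Matrix.adjugate_fin_two] at hadj
  have h00 : conj (A.1 0 0) = A.1 1 1 := congrFun (congrFun hadj 0) 0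
  have h10 : conj (A.1 1 0) = -A.1 0 1 := congrFun (congrFun hadj 0) 1
  rw [Matrix.det_fin_two, ← h00, ← neg_neg (A.1 0 1), ← h10] at hdet
  have hre := congrArg Complex.re hdet
  simp only [Complex.sub_re, Complex.mul_re, Complex.conj_re, Complex.conj_im, Complex.neg_re,
    Complex.neg_im, Complex.one_re] at hre
  refine ⟨⟨quat (A.1 0 0).re (A.1 1 0).im (A.1 1 0).re (A.1 0 0).im,
    quat_mem _ _ _ _ (by linarith)⟩, Subtype.ext ?_⟩
  rw [toSU2_apply]
  ext i j
  fin_cases i <;> fin_cases j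
  · rfl
  · change -conj (A.1 1 0) = A.1 0 1
    rw [h10, neg_neg]
  · rfl
  · exact h00

theorem subLaplacianPowerIsRNuclear_SU2 {r α : ℝ} (hr₀ : 0 < r) (hr₁ : r ≤ 1) (hα : 4 / r < α)
    (p : ℝ≥0∞) [Fact (1 ≤ p)] (hp : p ≠ ⊤) :
    SubLaplacianPowerIsRNuclear SU2.entries SU2.omega₁ SU2.omega₂ (haarProb SU2) r α p := by
  refine subLaplacianPowerIsRNuclear_of_cover (κ := 1) S3.continuous_toSU2 S3.toSU2_surjective
    (fun t => Subtype.ext ?_) (fun t => Subtype.ext ?_) ?_ (one_mul 1) (map_one _)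
    (fun x y h => Or.inl (S3.toSU2_injective h.symm)) (fun m n t => Or.inr ?_) hr₀ hr₁ hα p hp
  · rw [S3.toSU2_apply, S3.suMatrix, S3.u_omega₁, S3.v_omega₁]
    simp [SU2.omega₁, -Complex.ofReal_cos, -Complex.ofReal_sin]
  · rw [S3.toSU2_apply, S3.suMatrix, S3.u_omega₂, S3.v_omega₂]
    simp [SU2.omega₂, -Complex.ofReal_cos, -Complex.ofReal_sin]
  · obtain ⟨U, hU, hUu⟩ := isSmooth_u
    obtain ⟨V, hV, hVv⟩ := isSmooth_v
    refine ⟨fun q => ![![U q, -conj (V q)], ![V q, conj (U q)]], ?_, fun x => ?_⟩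
    · have hc {F : ℍ[ℝ] → ℂ} (hF : ContDiff ℝ (⊤ : ℕ∞) F) :
          ContDiff ℝ (⊤ : ℕ∞) fun q => conj (F q) := Complex.conjCLE.contDiff.comp hF
      refine contDiff_pi.2 fun i => contDiff_pi.2 fun j => ?_
      fin_cases i <;> fin_cases j
      exacts [hU, (hc hV).neg, hV, hc hU]
    · ext i j
      fin_cases i <;> fin_cases j
      · exact hUu x
      · exact congrArg (fun z => -conj z) (hVv x)
      · exact hVv x
      · exact congrArg conj (hUu x)
  · let E (i j : Fin 2) : IsSmooth SU2.entries (fun x => x.1 i j) :=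
      IsSmooth.ofComplex_of_clm (ι := SU2.entries) ((ContinuousLinearMap.proj j).comp
        (ContinuousLinearMap.proj (R := ℝ) (φ := fun _ : Fin 2 => Fin 2 → ℂ) i))
    refine ⟨_, (((E 0 0).add ((IsSmooth.const (-t)).mul (E 1 0))).pow m).mul
      (((E 1 0).conjugate.add ((IsSmooth.const t).mul (E 0 0).conjugate)).pow n), fun x => ?_⟩
    change (S3.u x + -t * S3.v x) ^ m * (conj (S3.v x) + t * conj (S3.u x)) ^ n = _
    rw [genFun, neg_mul, sub_eq_add_neg]

end SubLap

/-! ### The double cover of the rotation group -/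

namespace SubLap

open ComplexConjugate

/-! ### The group `SO(3)` -/

/-- The rotation defined by a unit quaternion, as a matrix. -/
noncomputable def S3.soMatrix (x : S3) : Matrix (Fin 3) (Fin 3) ℝ :=
  !![x.1.re ^ 2 + x.1.imI ^ 2 - x.1.imJ ^ 2 - x.1.imK ^ 2,
      2 * (x.1.imI * x.1.imJ - x.1.re * x.1.imK), 2 * (x.1.imI * x.1.imK + x.1.re * x.1.imJ);
    2 * (x.1.imI * x.1.imJ + x.1.re * x.1.imK),
      x.1.re ^ 2 - x.1.imI ^ 2 + x.1.imJ ^ 2 - x.1.imK ^ 2,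
      2 * (x.1.imJ * x.1.imK - x.1.re * x.1.imI);
    2 * (x.1.imI * x.1.imK - x.1.re * x.1.imJ), 2 * (x.1.imJ * x.1.imK + x.1.re * x.1.imI),
      x.1.re ^ 2 - x.1.imI ^ 2 - x.1.imJ ^ 2 + x.1.imK ^ 2]

theorem S3.soMatrix_mem (x : S3) : x.soMatrix ∈ Matrix.specialOrthogonalGroup (Fin 3) ℝ := by
  have h := sq_components x
  rw [SO3.mem_iff, soMatrix]
  generalize x.1.re = a, x.1.imI = b, x.1.imJ = c, x.1.imK = d at h
  constructor
  · ext i j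
    fin_cases i <;> fin_cases j <;>
      simp [Matrix.mul_apply, Fin.sum_univ_three] <;>
      first
        | ring1
        | linear_combination (a ^ 2 + b ^ 2 + c ^ 2 + d ^ 2 + 1) * h
  · simp [Matrix.det_fin_three]
    linear_combination ((a ^ 2 + b ^ 2 + c ^ 2 + d ^ 2) ^ 2 +
      (a ^ 2 + b ^ 2 + c ^ 2 + d ^ 2) + 1) * h

/-- The double cover of `SO(3)` by `𝕊³`. -/
noncomputable def S3.toSO3 : S3 →* SO3 where
  toFun x := ⟨x.soMatrix, x.soMatrix_mem⟩
  map_one' := by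
    refine Subtype.ext ?_
    ext i j
    fin_cases i <;> fin_cases j <;> simp [soMatrix]
  map_mul' x y := by
    refine Subtype.ext ?_
    ext i j
    fin_cases i <;> fin_cases j <;>
      simp [soMatrix] <;> ring

theorem S3.toSO3_apply (x : S3) : (toSO3 x).1 = x.soMatrix := rfl

theorem S3.contDiff_soMatrix : ∃ Φ : ℍ[ℝ] → Fin 3 → Fin 3 → ℝ, ContDiff ℝ (⊤ : ℕ∞) Φ ∧
    ∀ x, SO3.entries (toSO3 x) = Φ (incl x) := by
  refine ⟨fun q => ![![q.re ^ 2 + q.imI ^ 2 - q.imJ ^ 2 - q.imK ^ 2,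
      2 * (q.imI * q.imJ - q.re * q.imK), 2 * (q.imI * q.imK + q.re * q.imJ)],
    ![2 * (q.imI * q.imJ + q.re * q.imK), q.re ^ 2 - q.imI ^ 2 + q.imJ ^ 2 - q.imK ^ 2,
      2 * (q.imJ * q.imK - q.re * q.imI)],
    ![2 * (q.imI * q.imK - q.re * q.imJ), 2 * (q.imJ * q.imK + q.re * q.imI),
      q.re ^ 2 - q.imI ^ 2 - q.imJ ^ 2 + q.imK ^ 2]], ?_, fun x => rfl⟩
  have h0 : ContDiff ℝ (⊤ : ℕ∞) fun q : ℍ[ℝ] => q.re :=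
    (quatCoord ⟨⟨fun q => q.re, fun _ _ => rfl⟩, fun _ _ => by simp⟩).contDiff
  have h1 : ContDiff ℝ (⊤ : ℕ∞) fun q : ℍ[ℝ] => q.imI :=
    (quatCoord ⟨⟨fun q => q.imI, fun _ _ => rfl⟩, fun _ _ => by simp⟩).contDiff
  have h2 : ContDiff ℝ (⊤ : ℕ∞) fun q : ℍ[ℝ] => q.imJ :=
    (quatCoord ⟨⟨fun q => q.imJ, fun _ _ => rfl⟩, fun _ _ => by simp⟩).contDiff
  have h3 : ContDiff ℝ (⊤ : ℕ∞) fun q : ℍ[ℝ] => q.imK :=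
    (quatCoord ⟨⟨fun q => q.imK, fun _ _ => rfl⟩, fun _ _ => by simp⟩).contDiff
  refine contDiff_pi.2 fun i => contDiff_pi.2 fun j => ?_
  fin_cases i <;> fin_cases j <;> simp <;> fun_prop

theorem S3.continuous_toSO3 : Continuous toSO3 := by
  obtain ⟨Φ, hΦ, h⟩ := contDiff_soMatrix
  refine Continuous.subtype_mk ?_ _
  have e : soMatrix = fun x => Φ (incl x) := funext h
  rw [e]
  exact hΦ.continuous.comp continuous_subtype_val

/-- The quaternion monomials of degree two, as functions of the rotation matrix. -/
theorem S3.soMatrix_monomials (x : S3) :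
    x.1.re ^ 2 = (1 + x.soMatrix 0 0 + x.soMatrix 1 1 + x.soMatrix 2 2) / 4 ∧
    x.1.imI ^ 2 = (1 + x.soMatrix 0 0 - x.soMatrix 1 1 - x.soMatrix 2 2) / 4 ∧
    x.1.imJ ^ 2 = (1 - x.soMatrix 0 0 + x.soMatrix 1 1 - x.soMatrix 2 2) / 4 ∧
    x.1.imK ^ 2 = (1 - x.soMatrix 0 0 - x.soMatrix 1 1 + x.soMatrix 2 2) / 4 ∧
    x.1.re * x.1.imI = (x.soMatrix 2 1 - x.soMatrix 1 2) / 4 ∧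
    x.1.re * x.1.imJ = (x.soMatrix 0 2 - x.soMatrix 2 0) / 4 ∧
    x.1.re * x.1.imK = (x.soMatrix 1 0 - x.soMatrix 0 1) / 4 ∧
    x.1.imI * x.1.imJ = (x.soMatrix 0 1 + x.soMatrix 1 0) / 4 ∧
    x.1.imI * x.1.imK = (x.soMatrix 0 2 + x.soMatrix 2 0) / 4 ∧
    x.1.imJ * x.1.imK = (x.soMatrix 1 2 + x.soMatrix 2 1) / 4 := by
  have h := sq_components x
  refine ⟨?_, ?_, ?_, ?_, ?_, ?_, ?_, ?_, ?_, ?_⟩ <;> simp [soMatrix] <;> linarith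

/-- For the column vectors w, w' the hypotheses say w wᵀ = w' w'ᵀ. Hence w' = w' w'ᵀ w' = w wᵀ w' =
s w, and unit length forces s = ±1. -/
theorem eq_or_eq_neg_of_monomials {a b c d a' b' c' d' : ℝ} (h : a ^ 2 + b ^ 2 + c ^ 2 + d ^ 2 = 1)
    (h' : a' ^ 2 + b' ^ 2 + c' ^ 2 + d' ^ 2 = 1)
    (haa : a ^ 2 = a' ^ 2) (hbb : b ^ 2 = b' ^ 2) (hcc : c ^ 2 = c' ^ 2) (hdd : d ^ 2 = d' ^ 2)
    (hab : a * b = a' * b') (hac : a * c = a' * c') (had : a * d = a' * d')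
    (hbc : b * c = b' * c') (hbd : b * d = b' * d') (hcd : c * d = c' * d') :
    (a' = a ∧ b' = b ∧ c' = c ∧ d' = d) ∨ (a' = -a ∧ b' = -b ∧ c' = -c ∧ d' = -d) := by
  set s := a * a' + b * b' + c * c' + d * d' with hs
  have ha : a' = s * a := by linear_combination -a' * h' - a' * haa - b' * hab - c' * hac - d' * had
  have hb : b' = s * b := by linear_combination -b' * h' - a' * hab - b' * hbb - c' * hbc - d' * hbd
  have hc : c' = s * c := by linear_combination -c' * h' - a' * hac - b' * hbc - c' * hcc - d' * hcd
  have hd : d' = s * d := by linear_combination -d' * h' - a' * had - b' * hbd - c' * hcd - d' * hdd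
  have hs1 : s * s = 1 := by
    rw [ha, hb, hc, hd] at h'
    linear_combination h' - s ^ 2 * h
  rcases mul_self_eq_one_iff.1 hs1 with e | e
  · left; rw [e] at ha hb hc hd; simp [ha, hb, hc, hd]
  · right; rw [e] at ha hb hc hd; simp [ha, hb, hc, hd]

theorem S3.eq_or_eq_neg_of_toSO3_eq (x y : S3) (h : toSO3 x = toSO3 y) : y = x ∨ y = -1 * x := by
  have h' : x.soMatrix = y.soMatrix := congrArg Subtype.val h
  have hx := soMatrix_monomials x
  rw [h'] at hx
  obtain ⟨x1, x2, x3, x4, x5, x6, x7, x8, x9, x10⟩ := hx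
  obtain ⟨y1, y2, y3, y4, y5, y6, y7, y8, y9, y10⟩ := soMatrix_monomials y
  refine (eq_or_eq_neg_of_monomials (sq_components x) (sq_components y) (x1.trans y1.symm)
    (x2.trans y2.symm) (x3.trans y3.symm) (x4.trans y4.symm) (x5.trans y5.symm)
    (x6.trans y6.symm) (x7.trans y7.symm) (x8.trans y8.symm) (x9.trans y9.symm)
    (x10.trans y10.symm)).imp ?_ ?_
  · rintro ⟨ha, hb, hc, hd⟩
    exact Subtype.ext (QuaternionAlgebra.ext ha hb hc hd)
  · rintro ⟨ha, hb, hc, hd⟩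
    have e : (-1 * x).1 = -x.1 := neg_one_mul x.1
    refine Subtype.ext ?_
    rw [e]
    exact QuaternionAlgebra.ext ha hb hc hd

theorem S3.toSO3_neg_one : toSO3 (-1) = 1 := by
  refine Subtype.ext ?_
  rw [toSO3_apply]
  ext i j
  fin_cases i <;> fin_cases j <;> simp [soMatrix]

theorem S3.toSO3_omega₁ (t : ℝ) : toSO3 (omega₁ t) = SO3.omega₁ t := by
  refine Subtype.ext ?_
  have h1 := Real.sin_sq_add_cos_sq (t / 2)
  have h2 := Real.cos_two_mul (t / 2)
  have h3 := Real.sin_two_mul (t / 2)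
  rw [mul_div_cancel₀ t (two_ne_zero' ℝ)] at h2 h3
  rw [toSO3_apply]
  ext i j
  fin_cases i <;> fin_cases j <;> simp [soMatrix, omega₁, SO3.omega₁] <;> linarith

theorem S3.toSO3_omega₂ (t : ℝ) : toSO3 (omega₂ t) = SO3.omega₂ t := by
  refine Subtype.ext ?_
  have h1 := Real.sin_sq_add_cos_sq (t / 2)
  have h2 := Real.cos_two_mul (t / 2)
  have h3 := Real.sin_two_mul (t / 2)
  rw [mul_div_cancel₀ t (two_ne_zero' ℝ)] at h2 h3
  rw [toSO3_apply]
  ext i j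
  fin_cases i <;> fin_cases j <;> simp [soMatrix, omega₂, SO3.omega₂] <;> linarith

theorem S3.soMatrix_rot (θ : ℝ) : soMatrix (rot (θ / 2)) =
    !![Real.cos θ, -Real.sin θ, 0; Real.sin θ, Real.cos θ, 0; 0, 0, 1] := by
  have h1 := Real.sin_sq_add_cos_sq (θ / 2)
  have h2 := Real.cos_two_mul (θ / 2)
  have h3 := Real.sin_two_mul (θ / 2)
  rw [mul_div_cancel₀ θ (two_ne_zero' ℝ)] at h2 h3
  ext i j
  fin_cases i <;> fin_cases j <;> simp [soMatrix, rot] <;> linarith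

/-- A point of the unit circle is `(cos θ, sin θ)`. -/
theorem exists_polar (a b : ℝ) : ∃ θ, a = Real.sqrt (a ^ 2 + b ^ 2) * Real.cos θ ∧
    b = Real.sqrt (a ^ 2 + b ^ 2) * Real.sin θ := by
  have e : ‖(⟨a, b⟩ : ℂ)‖ = Real.sqrt (a ^ 2 + b ^ 2) := by
    rw [Complex.norm_def, Complex.normSq_mk, sq, sq]
  refine ⟨Complex.arg ⟨a, b⟩, ?_, ?_⟩
  · rw [← e, Complex.norm_mul_cos_arg]
  · rw [← e, Complex.norm_mul_sin_arg]

theorem S3.exists_toSO3_eq_of_fixed (R : SO3) (h0 : R.1 0 2 = 0) (h1 : R.1 1 2 = 0)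
    (h2 : R.1 2 2 = 1) : ∃ x, toSO3 x = R := by
  obtain ⟨hR, hdet⟩ := (SO3.mem_iff R.1).1 R.2
  have hRt : R.1.transpose * R.1 = 1 := mul_eq_one_comm.1 hR
  have e22 := congrFun (congrFun hR 2) 2
  simp only [Matrix.mul_apply, Fin.sum_univ_three, Matrix.transpose_apply,
    Matrix.one_apply_eq] at e22
  rw [h2] at e22
  have h20 : R.1 2 0 = 0 := by nlinarith
  have h21 : R.1 2 1 = 0 := by nlinarith
  have e00 := congrFun (congrFun hRt 0) 0
  have e01 := congrFun (congrFun hRt 0) 1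
  simp only [Matrix.mul_apply, Fin.sum_univ_three, Matrix.transpose_apply,
    Matrix.one_apply_eq, h20, h21, Matrix.one_apply_ne (zero_ne_one' (Fin 3))] at e00 e01
  rw [Matrix.det_fin_three, h0, h1, h2, h20, h21] at hdet
  obtain ⟨θ, hc, hs⟩ := exists_polar (R.1 0 0) (R.1 1 0)
  have hn : R.1 0 0 ^ 2 + R.1 1 0 ^ 2 = 1 := by linarith
  rw [hn, Real.sqrt_one, one_mul] at hc hs
  -- Orthogonality to the first column and determinant one form a 2 × 2 linear system for the second
  -- column, whose determinant is 1 by `hn`.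
  have h01 : R.1 0 1 = -R.1 1 0 := by
    linear_combination (-R.1 0 1) * hn + R.1 0 0 * e01 - R.1 1 0 * hdet
  have h11 : R.1 1 1 = R.1 0 0 := by
    linear_combination (-R.1 1 1) * hn + R.1 1 0 * e01 + R.1 0 0 * hdet
  refine ⟨rot (θ / 2), Subtype.ext ?_⟩
  rw [toSO3_apply, soMatrix_rot, ← hc, ← hs]
  ext i j
  fin_cases i <;> fin_cases j <;> simp [*]

/-- Euler angles: a rotation about the second axis followed by one about the third carries the third
basis vector to the third column of R, and the remaining factor fixes that vector. -/
theorem S3.toSO3_surjective : Function.Surjective toSO3 := by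
  intro R
  obtain ⟨φ, hp, hq⟩ := exists_polar (R.1 0 2) (R.1 1 2)
  obtain ⟨θ, hs, hρ⟩ := exists_polar (R.1 2 2) (Real.sqrt (R.1 0 2 ^ 2 + R.1 1 2 ^ 2))
  have hRt : R.1.transpose * R.1 = 1 := mul_eq_one_comm.1 ((SO3.mem_iff R.1).1 R.2).1
  have e22 := congrFun (congrFun hRt 2) 2
  simp only [Matrix.mul_apply, Fin.sum_univ_three, Matrix.transpose_apply,
    Matrix.one_apply_eq] at e22
  have hn : R.1 2 2 ^ 2 + Real.sqrt (R.1 0 2 ^ 2 + R.1 1 2 ^ 2) ^ 2 = 1 := by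
    rw [Real.sq_sqrt (by positivity)]
    linarith
  rw [hn, Real.sqrt_one, one_mul] at hs hρ
  rw [hρ] at hp hq
  set g : S3 := rot (φ / 2) * omega₂ θ with hg
  have hcol (i : Fin 3) : (toSO3 g).1 i 2 = R.1 i 2 := by
    have e : (toSO3 g).1 = soMatrix (rot (φ / 2)) * (SO3.omega₂ θ).1 := by
      rw [hg, map_mul, toSO3_omega₂]
      rfl
    rw [e, soMatrix_rot]
    fin_cases i <;> simp [SO3.omega₂, Matrix.mul_apply, Fin.sum_univ_three] <;> linarith
  have hfix (i : Fin 3) : ((toSO3 g)⁻¹ * R).1 i 2 = (1 : Matrix (Fin 3) (Fin 3) ℝ) i 2 := by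
    have e : ((toSO3 g)⁻¹ * toSO3 g).1 i 2 = (1 : Matrix (Fin 3) (Fin 3) ℝ) i 2 := by
      rw [inv_mul_cancel]
      rfl
    rw [← e]
    change (((toSO3 g)⁻¹).1 * R.1) i 2 = (((toSO3 g)⁻¹).1 * (toSO3 g).1) i 2
    simp only [Matrix.mul_apply, hcol]
  obtain ⟨x, hx⟩ := exists_toSO3_eq_of_fixed ((toSO3 g)⁻¹ * R) (hfix 0) (hfix 1) (hfix 2)
  exact ⟨g * x, by rw [map_mul, hx, mul_inv_cancel_left]⟩

/-! ### Even polynomials on the sphere as functions of the rotation matrix -/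

namespace Descends

variable {G E : Type*} [NormedAddCommGroup E] [NormedSpace ℝ E] {ι : G → E} {π : S3 → G}
  {f g : S3 → ℂ}

theorem const (c : ℂ) : Descends ι π fun _ => c := ⟨_, IsSmooth.const c, fun _ => rfl⟩

theorem add (hf : Descends ι π f) (hg : Descends ι π g) : Descends ι π fun x => f x + g x := by
  obtain ⟨φ, hφ, hφf⟩ := hf
  obtain ⟨ψ, hψ, hψg⟩ := hg
  exact ⟨_, hφ.add hψ, fun x => by simp only [hφf, hψg]⟩

theorem mul (hf : Descends ι π f) (hg : Descends ι π g) : Descends ι π fun x => f x * g x := by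
  obtain ⟨φ, hφ, hφf⟩ := hf
  obtain ⟨ψ, hψ, hψg⟩ := hg
  exact ⟨_, hφ.mul hψ, fun x => by simp only [hφf, hψg]⟩

theorem pow (hf : Descends ι π f) (n : ℕ) : Descends ι π fun x => f x ^ n := by
  obtain ⟨φ, hφ, hφf⟩ := hf
  exact ⟨_, hφ.pow n, fun x => by simp only [hφf]⟩

theorem conjugate (hf : Descends ι π f) : Descends ι π fun x => conj (f x) := by
  obtain ⟨φ, hφ, hφf⟩ := hf
  exact ⟨_, hφ.conjugate, fun x => by simp only [hφf]⟩

end Descends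

theorem descends_of_soMatrix {f : S3 → ℂ} (P Q : (Fin 3 → Fin 3 → ℝ) → ℝ)
    (hP : ContDiff ℝ (⊤ : ℕ∞) P) (hQ : ContDiff ℝ (⊤ : ℕ∞) Q)
    (h : ∀ x : S3, (P x.soMatrix : ℂ) + Q x.soMatrix * Complex.I = f x) :
    Descends SO3.entries S3.toSO3 f :=
  ⟨fun R => (P R.1 : ℂ) + Q R.1 * Complex.I,
    ⟨fun M => (P M : ℂ) + Q M * Complex.I, (Complex.ofRealCLM.contDiff.comp hP).add
      ((Complex.ofRealCLM.contDiff.comp hQ).mul contDiff_const), fun _ => rfl⟩, h⟩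

theorem descends_u_sq : Descends SO3.entries S3.toSO3 fun x => S3.u x ^ 2 :=
  descends_of_soMatrix (fun M => (M 0 0 + M 1 1) / 2) (fun M => (M 1 0 - M 0 1) / 2)
    (by fun_prop) (by fun_prop) fun x => by
      apply Complex.ext <;> simp [S3.u, S3.soMatrix, sq] <;> ring

theorem descends_v_sq : Descends SO3.entries S3.toSO3 fun x => S3.v x ^ 2 :=
  descends_of_soMatrix (fun M => (M 1 1 - M 0 0) / 2) (fun M => (M 0 1 + M 1 0) / 2)
    (by fun_prop) (by fun_prop) fun x => by
      apply Complex.ext <;> simp [S3.v, S3.soMatrix, sq] <;> ring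

theorem descends_u_mul_v : Descends SO3.entries S3.toSO3 fun x => S3.u x * S3.v x :=
  descends_of_soMatrix (fun M => -M 2 0 / 2) (fun M => M 2 1 / 2)
    (by fun_prop) (by fun_prop) fun x => by
      apply Complex.ext <;> simp [S3.u, S3.v, S3.soMatrix] <;> ring

theorem descends_u_mul_conj_v : Descends SO3.entries S3.toSO3 fun x => S3.u x * conj (S3.v x) :=
  descends_of_soMatrix (fun M => M 0 2 / 2) (fun M => M 1 2 / 2)
    (by fun_prop) (by fun_prop) fun x => by
      apply Complex.ext <;> simp [S3.u, S3.v, S3.soMatrix] <;> ring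

/-- The constant 1 stands for the sum of the four squares; this is where the sphere equation enters.
-/
theorem descends_u_mul_conj_u : Descends SO3.entries S3.toSO3 fun x => S3.u x * conj (S3.u x) :=
  descends_of_soMatrix (fun M => (1 + M 2 2) / 2) (fun _ => 0)
    (by fun_prop) (by fun_prop) fun x => by
      have h := S3.sq_components x
      simp only [sq] at h
      apply Complex.ext <;> simp [S3.u, S3.soMatrix, sq] <;> linarith

theorem descends_v_mul_conj_v : Descends SO3.entries S3.toSO3 fun x => S3.v x * conj (S3.v x) :=
  descends_of_soMatrix (fun M => (1 - M 2 2) / 2) (fun _ => 0)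
    (by fun_prop) (by fun_prop) fun x => by
      have h := S3.sq_components x
      simp only [sq] at h
      apply Complex.ext <;> simp [S3.v, S3.soMatrix, sq] <;> linarith

theorem genFun_neg_one_mul (m n : ℕ) (t : ℂ) (x : S3) :
    genFun m n t (-1 * x) = (-1) ^ (m + n) * genFun m n t x := by
  have e : (-1 * x).1 = -x.1 := neg_one_mul x.1
  have hu : S3.u (-1 * x) = -S3.u x := by
    simp only [S3.u, e]
    apply Complex.ext <;> simp
  have hv : S3.v (-1 * x) = -S3.v x := by
    simp only [S3.v, e]
    apply Complex.ext <;> simp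
  simp only [genFun, hu, hv, map_neg]
  rw [show -S3.u x - t * -S3.v x = -1 * (S3.u x - t * S3.v x) by ring,
    show -conj (S3.v x) + t * -conj (S3.u x) = -1 * (conj (S3.v x) + t * conj (S3.u x)) by ring,
    mul_pow, mul_pow, pow_add]
  ring

/-- If m + n is even the factors group into copies of A² and B², with one AB when both exponents are
odd. Each group is quadratic in the quaternion coordinates, hence affine in the matrix entries. -/
theorem descends_genFun {m n : ℕ} (h : Even (m + n)) (t : ℂ) :
    Descends SO3.entries S3.toSO3 (genFun m n t) := by
  have hAA : Descends SO3.entries S3.toSO3 fun x => (S3.u x - t * S3.v x) ^ 2 := by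
    convert (descends_u_sq.add ((Descends.const (-2 * t)).mul descends_u_mul_v)).add
      ((Descends.const (t ^ 2)).mul descends_v_sq) using 2 with x
    ring
  have hBB : Descends SO3.entries S3.toSO3 fun x => (conj (S3.v x) + t * conj (S3.u x)) ^ 2 := by
    convert (descends_v_sq.conjugate.add ((Descends.const (2 * t)).mul
      descends_u_mul_v.conjugate)).add ((Descends.const (t ^ 2)).mul descends_u_sq.conjugate)
      using 2 with x
    simp only [map_mul, map_pow]
    ring
  have hAB : Descends SO3.entries S3.toSO3
      fun x => (S3.u x - t * S3.v x) * (conj (S3.v x) + t * conj (S3.u x)) := by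
    convert (descends_u_mul_conj_v.add ((Descends.const t).mul descends_u_mul_conj_u)).add
      (((Descends.const (-t)).mul descends_v_mul_conj_v).add
        ((Descends.const (-t ^ 2)).mul descends_u_mul_conj_v.conjugate)) using 2 with x
    simp only [map_mul, Complex.conj_conj]
    ring
  rcases Nat.even_or_odd' m with ⟨k, rfl | rfl⟩
  · obtain ⟨l, rfl⟩ := even_iff_two_dvd.1 ((Nat.even_add.1 h).1 (even_two_mul k))
    convert (hAA.pow k).mul (hBB.pow l) using 2 with x
    rw [genFun, pow_mul, pow_mul]
  · obtain ⟨l, rfl⟩ : Odd n := by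
      rw [← Nat.not_even_iff_odd]
      exact fun hn => Nat.not_even_iff_odd.2 (odd_two_mul_add_one k) ((Nat.even_add.1 h).2 hn)
    convert ((hAA.pow k).mul (hBB.pow l)).mul hAB using 2 with x
    rw [genFun, pow_succ, pow_succ, pow_mul, pow_mul]
    ring

theorem subLaplacianPowerIsRNuclear_SO3 {r α : ℝ} (hr₀ : 0 < r) (hr₁ : r ≤ 1) (hα : 4 / r < α)
    (p : ℝ≥0∞) [Fact (1 ≤ p)] (hp : p ≠ ⊤) :
    SubLaplacianPowerIsRNuclear SO3.entries SO3.omega₁ SO3.omega₂ (haarProb SO3) r α p := by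
  refine subLaplacianPowerIsRNuclear_of_cover (κ := -1) S3.continuous_toSO3 S3.toSO3_surjective
    S3.toSO3_omega₁ S3.toSO3_omega₂ S3.contDiff_soMatrix
    (Subtype.ext ((neg_mul_neg (1 : ℍ[ℝ]) 1).trans (one_mul 1))) S3.toSO3_neg_one
    S3.eq_or_eq_neg_of_toSO3_eq (fun m n t => ?_) hr₀ hr₁ hα p hp
  rcases Nat.even_or_odd (m + n) with h | h
  · exact Or.inr (descends_genFun h t)
  · refine Or.inl fun x => ?_
    rw [genFun_neg_one_mul, h.neg_one_pow, neg_one_mul]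

end SubLap

theorem mainTheorem12 (r α : ℝ) (hr₀ : 0 < r) (hr₁ : r ≤ 1) (hα : 4 / r < α)
    (p : ℝ≥0∞) [Fact (1 ≤ p)] (hp : p ≠ ⊤) :
    SubLap.SubLaplacianPowerIsRNuclear SubLap.SO3.entries SubLap.SO3.omega₁ SubLap.SO3.omega₂
      (SubLap.haarProb SubLap.SO3) r α p ∧
    SubLap.SubLaplacianPowerIsRNuclear SubLap.SU2.entries SubLap.SU2.omega₁ SubLap.SU2.omega₂
      (SubLap.haarProb SubLap.SU2) r α p ∧
    SubLap.SubLaplacianPowerIsRNuclear SubLap.S3.incl SubLap.S3.omega₁ SubLap.S3.omega₂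
      (SubLap.haarProb SubLap.S3) r α p :=
  ⟨SubLap.subLaplacianPowerIsRNuclear_SO3 hr₀ hr₁ hα p hp,
    SubLap.subLaplacianPowerIsRNuclear_SU2 hr₀ hr₁ hα p hp,
    SubLap.subLaplacianPowerIsRNuclear_S3 hr₀ hr₁ hα p hp⟩
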